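/- Let $D,T\in\{0,1\}$ (treatment group, period), let $X$ be covariates in a standard Borel space (e.g. $\mathbb{R}^k$), and let $Y^d(t)$, $d,t\in\{0,1\}$, be integrable real potential outcomes. Write $G_{d,t}=\mathbf 1\{D=d,T=t\}$. One observes (i.i.d. copies of) $W=(Y,D,T,X)$, where $Y=\sum_{d,t}G_{d,t}Y^d(t)$ and $\mathbb{E}[Y^2]<\infty$. Identification assumptions, for a.e. $x$: - (common support) there is $c>0$ with $\Pr(D=d,T=t\mid X=x)\ge c$ for all $d,t\in\{0,1\}$; - (no anticipation) $\mathbb{E}[Y^1(0)-Y^0(0)\mid D=1,T=0,X=x]=0$; - (conditional common trends) $\mathbb{E}[Y^0(1)\mid D=0,T=1,X=x]-\mathbb{E}[Y^0(0)\mid D=0,T=0,X=x]=\mathbb{E}[Y^0(1)\mid D=1,T=1,X=x]-\mathbb{E}[Y^0(0)\mid D=1,T=0,X=x]$. The five settings are: (CS-1) no further assumption; (CS-2) $D\perp T\mid X$; (CS-3) $X\perp T$; (CS-4) $(D,X)\perp T$; (CS-5) $D,T,X$ mutually independent. The parameter is $\theta=\mathbb{E}[Y^1(1)-Y^0(1)\mid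 D=1,T=1]$. Put $m_Y(d,t,x)=\mathbb{E}[Y\mid D=d,T=t,X=x]$, $m_Y(x)=\sum_{d,t}(-1)^{d+t}m_Y(d,t,x)$, $p_{D=d,T=t}(x)=\Pr(D=d,T=t\mid X=x)$, $p_{D=d}(x)=\Pr(D=d\mid X=x)$, $p_{T=t}(x)=\Pr(T=t\mid X=x)$, $p_{D=d}(t,x)=\Pr(D=d\mid T=t,X=x)$, $p_{DT}=\Pr(D=1,T=1)$, $p_{D=d}=\Pr(D=d)$, $p_{T=t}=\Pr(T=t)$, $p_D(1)=\Pr(D=1\mid T=1)$; the subscripts $D$, $T$ without a value mean $D=1$, $T=1$. Fix one of the settings. A regular parametric submodel through the law $P$ of $W$ is a family, indexed by a real $\beta$ near $0$, of laws of $(Y^d(t))_{d,t},D,T,X$ that all satisfy the assumptions above and the relation of the setting, whose induced law of $W$ at $\beta=0$ is $P$, whose induced laws of $W$ are dominated by a $\sigma$-finite measure and differentiable in quadratic mean at $\beta=0$ with score $S\in L^2(P)$, and for which, near $\beta=0$, the common support constant is bounded away from $0$ and the second moment of $Y$ is bounded. The tangent space is the closed linear span in $L^2(P)$ of the scores of all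 these submodels. An efficient influence function is a function $\psi\in L^2(P)$ with mean zero that lies in the tangent space and satisfies $\frac{d}{d\beta}\theta(\beta)\big|_{\beta=0}=\mathbb{E}[\psi(W)S(W)]$ for every such submodel (the derivative existing). The semiparametric efficiency bound is the supremum of the Cramér–Rao bounds $\theta'(0)^2/\mathbb{E}[S(W)^2]$ over all such submodels with $\mathbb{E}[S(W)^2]>0$. **Theorem.** Under the assumptions above and each of the settings $\mathrm{CS}\in\{$(CS-1), …, (CS-5)$\}$, there is a $P$-almost surely unique efficient influence function of $\theta$, namely $$\psi^*(W;\theta)=\frac{q_{1,1}(X)}{q}\sum_{d=0}^1\sum_{t=0}^1(-1)^{d+t}\frac{G_{d,t}}{q_{d,t}(X)}\bigl(Y-m_Y(d,t,X)\bigr)+\psi^{b}(W)\bigl(m_Y(X)-\theta\bigr),$$ where - (CS-1): $q_{d,t}(X)=p_{D=d,T=t}(X)$, $q=p_{DT}$, $\psi^b=\dfrac{DT}{p_{DT}}$; - (CS-2): $q_{d,t}(X)=p_{D=d}(X)p_{T=t}(X)$, $q=p_{DT}$, $\psi^b=\dfrac{D\,p_T(X)+p_D(X)\,T-p_D(X)p_T(X)}{p_{DT}}$;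 - (CS-3): $q_{d,t}(X)=p_{D=d}(t,X)\,p_{T=t}$, $q=p_D(1)p_T$, $\psi^b=\dfrac{T(D-p_D(1,X))+p_D(1,X)p_T}{p_D(1)p_T}$; - (CS-4): $q_{d,t}(X)=p_{D=d}(X)\,p_{T=t}$, $q=p_Dp_T$, $\psi^b=\dfrac{D}{p_D}$; - (CS-5): $q_{d,t}(X)=p_{D=d}\,p_{T=t}$, $q=p_Dp_T$, $\psi^b=1$. The semiparametric efficiency bound in the setting is $\mathbb{E}[\psi^*(W;\theta)^2]$. -/

import Mathlib

open MeasureTheory ProbabilityTheory Filter Topology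

noncomputable section

namespace DiD

/-! ### Data -/

/-- Values of the full data `((Y^d(t))_{d,t}, D, T, X)`: the four potential outcomes
`ω.1 d t = Y^d(t)`, the treatment group `D`, the period `T` and the covariates `X`. -/
abbrev Full (𝒳 : Type*) := (Fin 2 → Fin 2 → ℝ) × Fin 2 × Fin 2 × 𝒳

/-- Values of the observed data `W = (Y, D, T, X)`. -/
abbrev Obs (𝒳 : Type*) := ℝ × Fin 2 × Fin 2 × 𝒳

section Data
variable {𝒳 : Type*}

/-- The outcome `Y`. -/
def Y (w : Obs 𝒳) : ℝ := w.1
/-- The treatment group indicator `D`. -/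
def D (w : Obs 𝒳) : Fin 2 := w.2.1
/-- The period indicator `T`. -/
def T (w : Obs 𝒳) : Fin 2 := w.2.2.1
/-- The covariates `X`. -/
def X (w : Obs 𝒳) : 𝒳 := w.2.2.2

/-- The cell indicator `G_{d,t} = 1{D = d, T = t}`. -/
def G (d t : Fin 2) (w : Obs 𝒳) : ℝ := if D w = d ∧ T w = t then 1 else 0

/-- The cell indicator as a function of the full data. -/
def cell (d t : Fin 2) : Set (Full 𝒳) := {ω | ω.2.1 = d ∧ ω.2.2.1 = t}

/-- Observational rule: `Y = ∑_{d,t} G_{d,t} Y^d(t)`, and `D`, `T`, `X` are observed. -/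
def observe (ω : Full 𝒳) : Obs 𝒳 :=
  (∑ d : Fin 2, ∑ t : Fin 2, (cell d t).indicator (fun ω' => ω'.1 d t) ω, ω.2)

variable [MeasurableSpace 𝒳]

lemma measurable_observe : Measurable (observe : Full 𝒳 → Obs 𝒳) := by
  refine Measurable.prodMk ?_ measurable_snd
  refine Finset.measurable_sum _ fun d _ => Finset.measurable_sum _ fun t _ => ?_
  refine Measurable.indicator (by fun_prop) ?_
  exact (measurableSet_eq_fun (by fun_prop) measurable_const).inter
    (measurableSet_eq_fun (by fun_prop) measurable_const)

lemma measurable_X : Measurable (X : Obs 𝒳 → 𝒳) := by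
  unfold X; fun_prop

/-- The law of the observed data when the full data have law `Q`. -/
def obsLaw (Q : ProbabilityMeasure (Full 𝒳)) : ProbabilityMeasure (Obs 𝒳) :=
  Q.map measurable_observe.aemeasurable

/-- The average treatment effect on the treated, `θ = E[Y^1(1) - Y^0(1) | D = 1, T = 1]`. -/
def atet (Q : ProbabilityMeasure (Full 𝒳)) : ℝ :=
  ∫ ω, (ω.1 1 1 - ω.1 0 1) ∂((Q : Measure (Full 𝒳))[|cell 1 1])

end Data

/-! ### Conditional means and conditional probabilities -/

section Cond
variable {Ω A B : Type*} [MeasurableSpace Ω] [MeasurableSpace A] [MeasurableSpace B]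

/-- The regression function `v ↦ E[Z | V = v]`. -/
def condMean (μ : ProbabilityMeasure Ω) (Z : Ω → ℝ) (V : Ω → B) (v : B) : ℝ :=
  ∫ z, z ∂(condDistrib Z V (μ : Measure Ω) v)

/-- The conditional probability function `(a, b) ↦ Pr(U = a | V = b)`. -/
def condProb [StandardBorelSpace A] [Nonempty A]
    (μ : ProbabilityMeasure Ω) (U : Ω → A) (V : Ω → B) (a : A) (b : B) : ℝ :=
  (condDistrib U V (μ : Measure Ω) b).real {a}

end Cond

section Nuisance
variable {𝒳 : Type*} [MeasurableSpace 𝒳]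

/-- The law of `X`. -/
def lawX (P : ProbabilityMeasure (Obs 𝒳)) : Measure 𝒳 := (P : Measure (Obs 𝒳)).map X

/-- `m_Y(d,t,x) = E[Y | D = d, T = t, X = x]`. -/
def mCell (P : ProbabilityMeasure (Obs 𝒳)) (d t : Fin 2) (x : 𝒳) : ℝ :=
  condMean P Y (fun w => (D w, T w, X w)) (d, t, x)

/-- `m_Y(x) = ∑_{d,t} (-1)^(d+t) m_Y(d,t,x)`. -/
def mY (P : ProbabilityMeasure (Obs 𝒳)) (x : 𝒳) : ℝ :=
  ∑ d : Fin 2, ∑ t : Fin 2, (-1 : ℝ) ^ ((d : ℕ) + (t : ℕ)) * mCell P d t x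

/-- `p_{D=d,T=t}(x) = Pr(D = d, T = t | X = x)`. -/
def pDTx (P : ProbabilityMeasure (Obs 𝒳)) (d t : Fin 2) (x : 𝒳) : ℝ :=
  condProb P (fun w => (D w, T w)) X (d, t) x

/-- `p_{D=d}(x) = Pr(D = d | X = x)`. -/
def pDx (P : ProbabilityMeasure (Obs 𝒳)) (d : Fin 2) (x : 𝒳) : ℝ := condProb P D X d x

/-- `p_{T=t}(x) = Pr(T = t | X = x)`. -/
def pTx (P : ProbabilityMeasure (Obs 𝒳)) (t : Fin 2) (x : 𝒳) : ℝ := condProb P T X t x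

/-- `p_{D=d}(t,x) = Pr(D = d | T = t, X = x)`. -/
def pDtx (P : ProbabilityMeasure (Obs 𝒳)) (d t : Fin 2) (x : 𝒳) : ℝ :=
  condProb P D (fun w => (T w, X w)) d (t, x)

/-- `p_{DT} = Pr(D = 1, T = 1)`. -/
def pDT (P : ProbabilityMeasure (Obs 𝒳)) : ℝ :=
  (P : Measure (Obs 𝒳)).real {w | D w = 1 ∧ T w = 1}

/-- `p_{D=d} = Pr(D = d)`. -/
def pD (P : ProbabilityMeasure (Obs 𝒳)) (d : Fin 2) : ℝ :=
  (P : Measure (Obs 𝒳)).real {w | D w = d}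

/-- `p_{T=t} = Pr(T = t)`. -/
def pT (P : ProbabilityMeasure (Obs 𝒳)) (t : Fin 2) : ℝ :=
  (P : Measure (Obs 𝒳)).real {w | T w = t}

/-- `p_D(1) = Pr(D = 1 | T = 1)`. -/
def pD1 (P : ProbabilityMeasure (Obs 𝒳)) : ℝ :=
  ((P : Measure (Obs 𝒳))[|{w | T w = 1}]).real {w | D w = 1}

end Nuisance

/-! ### The five settings and the identification assumptions -/

/-- The five settings on how `D`, `T` and `X` are related, labelled as in `Relation` below. -/
inductive Setting
  | cs1 | cs2 | cs3 | cs4 | cs5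

section Model
variable {𝒳 : Type*} [MeasurableSpace 𝒳] [StandardBorelSpace 𝒳]

/-- The relation between `D`, `T` and `X` imposed by each setting. -/
def Relation (s : Setting) (P : ProbabilityMeasure (Obs 𝒳)) : Prop :=
  match s with
  | .cs1 => True
  | .cs2 => CondIndepFun (MeasurableSpace.comap X inferInstance) measurable_X.comap_le D T
      (P : Measure (Obs 𝒳))
  | .cs3 => IndepFun X T (P : Measure (Obs 𝒳))
  | .cs4 => IndepFun (fun w => (D w, X w)) T (P : Measure (Obs 𝒳))
  | .cs5 => iIndep ![MeasurableSpace.comap D inferInstance, MeasurableSpace.comap T inferInstance,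
      MeasurableSpace.comap X inferInstance] (P : Measure (Obs 𝒳))

/-- Conditional mean `E[Z | D = d, T = t, X = x]` of a function `Z` of the full data. -/
def fullMean (Q : ProbabilityMeasure (Full 𝒳)) (Z : Full 𝒳 → ℝ) (d t : Fin 2) (x : 𝒳) : ℝ :=
  condMean Q Z (fun ω => ω.2) (d, t, x)

/-- Common support with constant `c`: all cell propensity scores are at least `c`. -/
def Support (P : ProbabilityMeasure (Obs 𝒳)) (c : ℝ) : Prop :=
  ∀ d t : Fin 2, ∀ᵐ x ∂(lawX P), c ≤ pDTx P d t x

/-- The laws of the full data that satisfy the identification assumptions and the relation of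
setting `s`. -/
structure InModel (s : Setting) (Q : ProbabilityMeasure (Full 𝒳)) : Prop where
  /-- the potential outcomes have finite means -/
  integrable : ∀ d t : Fin 2, Integrable (fun ω => ω.1 d t) (Q : Measure (Full 𝒳))
  /-- the observed outcome has a finite second moment -/
  memLp : MemLp Y 2 (obsLaw Q : Measure (Obs 𝒳))
  common_support : ∃ c > 0, Support (obsLaw Q) c
  no_anticipation : ∀ᵐ x ∂(lawX (obsLaw Q)),
    fullMean Q (fun ω => ω.1 1 0 - ω.1 0 0) 1 0 x = 0
  common_trends : ∀ᵐ x ∂(lawX (obsLaw Q)),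
    fullMean Q (fun ω => ω.1 0 1) 0 1 x - fullMean Q (fun ω => ω.1 0 0) 0 0 x
      = fullMean Q (fun ω => ω.1 0 1) 1 1 x - fullMean Q (fun ω => ω.1 0 0) 1 0 x
  relation : Relation s (obsLaw Q)

end Model

/-! ### Semiparametric efficiency -/

section Efficiency

/-- The family `β ↦ P β` of laws is dominated and differentiable in quadratic mean at `β = 0`
with score `S`: with densities `f_β`, `∫ ((√f_β - √f_0)/β - S √f_0 / 2)² → 0` as `β → 0`. -/
def HasScore {W : Type*} [MeasurableSpace W] (P : ℝ → ProbabilityMeasure W) (S : W → ℝ) : Prop :=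
  ∃ ν : Measure W, SigmaFinite ν ∧ (∀ β, (P β : Measure W) ≪ ν) ∧
    Tendsto (fun β : ℝ => ∫⁻ w, ENNReal.ofReal
        (((√((P β : Measure W).rnDeriv ν w).toReal - √((P 0 : Measure W).rnDeriv ν w).toReal) / β
          - S w * √((P 0 : Measure W).rnDeriv ν w).toReal / 2) ^ 2) ∂ν)
      (𝓝[≠] 0) (𝓝 0)

variable {𝒳 : Type*} [MeasurableSpace 𝒳] [StandardBorelSpace 𝒳]

/-- `Q` is a regular one-dimensional parametric submodel of setting `s` through the observed law
`P`, at `β = 0`, with score `S`. Every `Q β` satisfies the assumptions; the support constant and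
the second moment of `Y` are controlled uniformly near `β = 0`; the observed laws are
differentiable in quadratic mean. Only `β` near `0` matters: a family on an interval around `0` can
be continued by a constant. -/
structure RegularSubmodel (s : Setting) (P : ProbabilityMeasure (Obs 𝒳))
    (Q : ℝ → ProbabilityMeasure (Full 𝒳)) (S : Obs 𝒳 → ℝ) : Prop where
  mem : ∀ β, InModel s (Q β)
  at_zero : obsLaw (Q 0) = P
  support : ∃ c > 0, ∀ᶠ β in 𝓝 (0 : ℝ), Support (obsLaw (Q β)) c
  moment : ∃ C : ℝ, ∀ᶠ β in 𝓝 (0 : ℝ), ∫ w, Y w ^ 2 ∂(obsLaw (Q β) : Measure (Obs 𝒳)) ≤ C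
  memLp_score : MemLp S 2 (P : Measure (Obs 𝒳))
  hasScore : HasScore (fun β => obsLaw (Q β)) S

/-- The tangent space: the closed linear span in `L²(P)` of the scores of all regular parametric
submodels. -/
def tangentSpace (s : Setting) (P : ProbabilityMeasure (Obs 𝒳)) :
    Submodule ℝ (Lp ℝ 2 (P : Measure (Obs 𝒳))) :=
  (Submodule.span ℝ {g | ∃ Q S, ∃ h : RegularSubmodel s P Q S,
    g = h.memLp_score.toLp S}).topologicalClosure

/-- `ψ` is an efficient influence function of the ATET at `P` in setting `s`: it has mean zero and
finite second moment, it represents the derivative of the ATET along every regular parametric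
submodel (pathwise differentiability), and it lies in the tangent space. -/
structure IsEfficientInfluenceFunction (s : Setting) (P : ProbabilityMeasure (Obs 𝒳))
    (ψ : Obs 𝒳 → ℝ) : Prop where
  mean_zero : ∫ w, ψ w ∂(P : Measure (Obs 𝒳)) = 0
  gradient : ∀ Q S, RegularSubmodel s P Q S →
    HasDerivAt (fun β => atet (Q β)) (∫ w, ψ w * S w ∂(P : Measure (Obs 𝒳))) 0
  tangent : ∃ h : MemLp ψ 2 (P : Measure (Obs 𝒳)), h.toLp ψ ∈ tangentSpace s P

/-- The Cramér-Rao bounds `(∂θ/∂β)² / E[S²]` of the regular parametric submodels with positive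
information. -/
def cramerRaoBounds (s : Setting) (P : ProbabilityMeasure (Obs 𝒳)) : Set ℝ :=
  {v | ∃ Q S, RegularSubmodel s P Q S ∧ 0 < ∫ w, S w ^ 2 ∂(P : Measure (Obs 𝒳)) ∧
    ∃ θ' : ℝ, HasDerivAt (fun β => atet (Q β)) θ' 0 ∧
      v = θ' ^ 2 / ∫ w, S w ^ 2 ∂(P : Measure (Obs 𝒳))}

/-- `V` is the semiparametric efficiency bound: the supremum of the Cramér-Rao bounds of the
regular parametric submodels. -/
def IsEfficiencyBound (s : Setting) (P : ProbabilityMeasure (Obs 𝒳)) (V : ℝ) : Prop :=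
  IsLUB (cramerRaoBounds s P) V

end Efficiency

/-! ### The influence functions -/

section Influence
variable {𝒳 : Type*} [MeasurableSpace 𝒳]

/-- `q_{CS;D=d,T=t}(x)`: the form of `p_{D=d,T=t}(x)` in each setting. -/
def qx (s : Setting) (P : ProbabilityMeasure (Obs 𝒳)) (d t : Fin 2) (x : 𝒳) : ℝ :=
  match s with
  | .cs1 => pDTx P d t x
  | .cs2 => pDx P d x * pTx P t x
  | .cs3 => pDtx P d t x * pT P t
  | .cs4 => pDx P d x * pT P t
  | .cs5 => pD P d * pT P t

/-- `q_{CS;DT}`: the form of `p_{DT}` in each setting. -/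
def q (s : Setting) (P : ProbabilityMeasure (Obs 𝒳)) : ℝ :=
  match s with
  | .cs1 => pDT P
  | .cs2 => pDT P
  | .cs3 => pD1 P * pT P 1
  | .cs4 => pD P 1 * pT P 1
  | .cs5 => pD P 1 * pT P 1

/-- `ψ^a`. -/
def psiA (s : Setting) (P : ProbabilityMeasure (Obs 𝒳)) (w : Obs 𝒳) : ℝ :=
  ∑ d : Fin 2, ∑ t : Fin 2, (-1 : ℝ) ^ ((d : ℕ) + (t : ℕ)) *
    (G d t w / qx s P d t (X w)) * (Y w - mCell P d t (X w))

/-- The adjustment term `ψ^b` of each setting; here `D` and `T` are read as the real numbers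
`0` and `1`. -/
def psiB (s : Setting) (P : ProbabilityMeasure (Obs 𝒳)) (w : Obs 𝒳) : ℝ :=
  let d : ℝ := ((D w : ℕ) : ℝ)
  let t : ℝ := ((T w : ℕ) : ℝ)
  let x := X w
  match s with
  | .cs1 => d * t / pDT P
  | .cs2 => (d * pTx P 1 x + pDx P 1 x * t - pDx P 1 x * pTx P 1 x) / pDT P
  | .cs3 => (t * (d - pDtx P 1 1 x) + pDtx P 1 1 x * pT P 1) / (pD1 P * pT P 1)
  | .cs4 => d / pD P 1
  | .cs5 => 1

/-- `ψ*(W; θ) = q(X)/q ψ^a(W) + ψ^b(W) (m_Y(X) - θ)`. -/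
def psi (s : Setting) (P : ProbabilityMeasure (Obs 𝒳)) (θ : ℝ) (w : Obs 𝒳) : ℝ :=
  qx s P 1 1 (X w) / q s P * psiA s P w + psiB s P w * (mY P (X w) - θ)

end Influence

end DiD

end

open MeasureTheory ProbabilityTheory Filter Topology

noncomputable section

set_option linter.unusedSectionVars false

/-! Identification turns θ into a functional of the observed law, `theta P` = E[G₁₁ m_Y(X)] / p_DT
(`InModel.atet_eq`). Conversely, every observed law with a square-integrable outcome, common support
and the relation of the setting comes from some law of the full data (`ObsModel.inModel_fullLaw`).
The assumptions on potential outcomes therefore impose nothing further on the observed law, and the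
problem lives on observed laws.

The first half shows that ψ* represents the derivative of θ. Along a submodel P_β, the increment of
θ, multiplied by p_DT(P_β), splits exactly into the drift of the regression, E_0[G₁₁(m_β - m_0)],
and the change of E[G₁₁(m_β - θ)] when P_0 is replaced by P_β with m_β held fixed. Cell by cell, the
drift is minus the P_0-mean of a weighted residual of Y - m_β, whose P_β-mean is zero. The change of
law is, up to scale, a difference of means of b_β(m_β - θ), where the conditional mean of b_β given
X is proportional to Pr(D=1,T=1|X) both under P_β and under P_0. This double robustness of `weight`
is where the relation of the setting enters, and at β = 0 it produces ψ^b. Both terms are thus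
difference quotients of E_β[φ_β] - E_0[φ_β] for moving functions φ_β. `RootExpansion.tendsto_slope`
gives the limit E_0[φ_0 S] as soon as φ_β is bounded in L² under both laws and converges in L¹(P_0),
so no smoothness of the nuisance functions along the path is needed. One obstacle is that m_β is
square-integrable under P_β but perhaps not under P_0. It is removed by restricting X to a set on
which the P_0-law is at most four times the P_β-law (`Overlap`). Quadratic mean differentiability
forces the complement to have P_0-mass o(β²) (`RootExpansion.tendsto_div_sq`), so that by
Cauchy-Schwarz it contributes o(β). The pieces are assembled in `RegularFamily.hasDerivAt_theta`.

The second half shows that ψ* lies in the tangent space. By `psi_ae_eq`, ψ* is a residual with mean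
zero given (D,T,X) plus a weight times the centered effect. The second summand splits into
perturbations of the factors of the law of (D,T,X) that the setting leaves free
(`adjust_eq_weight`). Bounded perturbations of these kinds are scores of explicit density paths
inside the model (`Direction.exists_regularSubmodel`), and truncation with recentering approximates
ψ* by them in L². These directions need not exhaust the tangent space; they only have to reach ψ*.

The rest is Hilbert space geometry. Two efficient influence functions differ by an element of the
tangent space orthogonal to it. Cauchy-Schwarz bounds every Cramér-Rao bound by E[ψ*²], and scores
tending to ψ* approach that value. -/

namespace DiD

/-! ### Square-integrable functions: norm, Cauchy-Schwarz, truncation. -/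

section L2
variable {Ω : Type*} [MeasurableSpace Ω] {μ : Measure Ω}

/-- The `L²` norm of a real function, as a real number. -/
def nrm (μ : Measure Ω) (f : Ω → ℝ) : ℝ := √(∫ x, f x ^ 2 ∂μ)

lemma nrm_nonneg (f : Ω → ℝ) : 0 ≤ nrm μ f := Real.sqrt_nonneg _

lemma nrm_sq (f : Ω → ℝ) : nrm μ f ^ 2 = ∫ x, f x ^ 2 ∂μ :=
  Real.sq_sqrt (integral_nonneg fun _ => sq_nonneg _)

lemma nrm_toLp {f : Ω → ℝ} (hf : MemLp f 2 μ) : nrm μ f = ‖hf.toLp f‖ := by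
  rw [nrm, Real.sqrt_eq_iff_mul_self_eq (integral_nonneg fun _ => sq_nonneg _) (norm_nonneg _),
    ← real_inner_self_eq_norm_mul_norm, L2.inner_def]
  refine integral_congr_ae ?_
  filter_upwards [hf.coeFn_toLp] with x hx
  simp [hx, sq]

lemma nrm_congr {f g : Ω → ℝ} (h : f =ᵐ[μ] g) : nrm μ f = nrm μ g := by
  unfold nrm; congr 1; exact integral_congr_ae (h.mono fun x hx => by simp [hx])

lemma nrm_add_le {f g : Ω → ℝ} (hf : MemLp f 2 μ) (hg : MemLp g 2 μ) :
    nrm μ (fun x => f x + g x) ≤ nrm μ f + nrm μ g := by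
  have h : nrm μ (fun x => f x + g x) = ‖(hf.add hg).toLp _‖ := nrm_toLp (hf.add hg)
  rw [h, nrm_toLp hf, nrm_toLp hg, MemLp.toLp_add]
  exact norm_add_le _ _

lemma nrm_neg (f : Ω → ℝ) : nrm μ (fun x => - f x) = nrm μ f := by simp [nrm]

lemma nrm_sub_le {f g : Ω → ℝ} (hf : MemLp f 2 μ) (hg : MemLp g 2 μ) :
    nrm μ (fun x => f x - g x) ≤ nrm μ f + nrm μ g := by
  have h := nrm_add_le hf hg.neg
  simp only [Pi.neg_apply, ← sub_eq_add_neg] at h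
  exact h.trans (le_of_eq (by rw [← nrm_neg g]; rfl))

lemma nrm_const_mul (c : ℝ) (f : Ω → ℝ) : nrm μ (fun x => c * f x) = |c| * nrm μ f := by
  simp only [nrm, mul_pow, integral_const_mul]
  rw [Real.sqrt_mul (sq_nonneg _), Real.sqrt_sq_eq_abs]

lemma nrm_mono {f g : Ω → ℝ} (hg : MemLp g 2 μ) (h : ∀ᵐ x ∂μ, |f x| ≤ |g x|) :
    nrm μ f ≤ nrm μ g := by
  refine Real.sqrt_le_sqrt ?_
  refine integral_mono_of_nonneg (ae_of_all _ fun _ => sq_nonneg _) hg.integrable_sq ?_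
  filter_upwards [h] with x hx using sq_le_sq.2 hx

/-- Cauchy-Schwarz. -/
lemma integral_abs_mul_le {f g : Ω → ℝ} (hf : MemLp f 2 μ) (hg : MemLp g 2 μ) :
    ∫ x, |f x * g x| ∂μ ≤ nrm μ f * nrm μ g := by
  have hf' : MemLp (fun x => |f x|) 2 μ := hf.abs
  have hg' : MemLp (fun x => |g x|) 2 μ := hg.abs
  have h1 : nrm μ f = nrm μ (fun x => |f x|) := by simp [nrm]
  have h2 : nrm μ g = nrm μ (fun x => |g x|) := by simp [nrm]
  rw [h1, h2, nrm_toLp hf', nrm_toLp hg']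
  refine le_trans (le_of_eq ?_) (real_inner_le_norm _ _)
  rw [L2.inner_def]
  refine integral_congr_ae ?_
  filter_upwards [hf'.coeFn_toLp, hg'.coeFn_toLp] with x hx hy
  simp [hx, hy, abs_mul, mul_comm]

lemma abs_integral_mul_le {f g : Ω → ℝ} (hf : MemLp f 2 μ) (hg : MemLp g 2 μ) :
    |∫ x, f x * g x ∂μ| ≤ nrm μ f * nrm μ g :=
  (abs_integral_le_integral_abs).trans (integral_abs_mul_le hf hg)

/-- Truncations of a square-integrable function converge to it. -/
lemma tendsto_nrm_tail {S : Ω → ℝ} (hSm : Measurable S) (hS : MemLp S 2 μ) :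
    Tendsto (fun k : ℕ => nrm μ (fun x => {x | (k : ℝ) < |S x|}.indicator S x)) atTop (𝓝 0) := by
  have : Tendsto (fun k : ℕ => ∫ x, ({x | (k : ℝ) < |S x|}.indicator S x) ^ 2 ∂μ) atTop
      (𝓝 (∫ _, (0 : ℝ) ∂μ)) := by
    refine tendsto_integral_of_dominated_convergence (fun x => S x ^ 2) ?_ hS.integrable_sq ?_ ?_
    · intro k
      exact ((hSm.indicator (measurableSet_lt measurable_const hSm.abs)).pow_const 2
        ).aestronglyMeasurable
    · intro k
      refine ae_of_all _ fun x => ?_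
      rw [Real.norm_of_nonneg (sq_nonneg _)]
      by_cases h : (k : ℝ) < |S x| <;> simp [Set.indicator, h, sq_nonneg]
    · refine ae_of_all _ fun x => ?_
      refine tendsto_const_nhds.congr' ?_
      filter_upwards [eventually_ge_atTop ⌈|S x|⌉₊] with k hk
      have : ¬ (k : ℝ) < |S x| := not_lt.2 (Nat.ceil_le.1 hk)
      simp [Set.indicator, this]
  have h := (Real.continuous_sqrt.tendsto _).comp this
  rw [integral_zero, Real.sqrt_zero] at h
  exact h

lemma integrable_mul_of_memLp {f g : Ω → ℝ} (hf : MemLp f 2 μ) (hg : MemLp g 2 μ) :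
    Integrable (fun x => f x * g x) μ := hf.integrable_mul hg

lemma memLp_two_of_integrable_sq {f : Ω → ℝ} (hf : Measurable f)
    (h : Integrable (fun x => f x ^ 2) μ) : MemLp f 2 μ :=
  (memLp_two_iff_integrable_sq hf.aestronglyMeasurable).2 h

lemma MemLp_of_abs_le [IsFiniteMeasure μ] {f : Ω → ℝ} (hf : AEStronglyMeasurable f μ) (C : ℝ)
    (h : ∀ x, |f x| ≤ C) {p : ENNReal} : MemLp f p μ :=
  MemLp.of_bound hf C (ae_of_all _ h)

end L2

/-! ### Differentiability in quadratic mean and differentiation of means. -/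

section Root
variable {W : Type*} [MeasurableSpace W]

/-- Square roots `r β` of densities of the laws `P β` with respect to `ν`, with the remainder of
the expansion of `r` at `0` tending to zero in `L²(ν)`. -/
structure RootExpansion (P : ℝ → ProbabilityMeasure W) (S : W → ℝ) (ν : Measure W)
    (r : ℝ → W → ℝ) : Prop where
  meas : ∀ β, Measurable (r β)
  nonneg : ∀ β w, 0 ≤ r β w
  integrable_iff : ∀ β (φ : W → ℝ), Measurable φ →
    (Integrable φ (P β : Measure W) ↔ Integrable (fun w => φ w * r β w ^ 2) ν)
  integral_eq : ∀ β (φ : W → ℝ), ∫ w, φ w ∂(P β : Measure W) = ∫ w, φ w * r β w ^ 2 ∂ν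
  score_meas : Measurable S
  score_memLp : MemLp S 2 (P 0 : Measure W)
  remainder : Tendsto (fun β => nrm ν (fun w => (r β w - r 0 w) / β - S w * r 0 w / 2))
    (𝓝[≠] 0) (𝓝 0)

namespace RootExpansion
variable {P : ℝ → ProbabilityMeasure W} {S : W → ℝ} {ν : Measure W} {r : ℝ → W → ℝ}

lemma memLp (h : RootExpansion P S ν r) {β : ℝ} {φ : W → ℝ} (hm : Measurable φ)
    (hφ : MemLp φ 2 (P β : Measure W)) : MemLp (fun w => φ w * r β w) 2 ν := by
  refine memLp_two_of_integrable_sq (hm.mul (h.meas β)) ?_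
  have := (h.integrable_iff β _ (hm.pow_const 2)).1 hφ.integrable_sq
  exact this.congr (ae_of_all _ fun w => by simp [mul_pow])

lemma nrm_eq (h : RootExpansion P S ν r) (β : ℝ) (φ : W → ℝ) :
    nrm ν (fun w => φ w * r β w) = nrm (P β : Measure W) φ := by
  simp [nrm, h.integral_eq, mul_pow]

lemma memLp_root (h : RootExpansion P S ν r) (β : ℝ) : MemLp (r β) 2 ν := by
  simpa using h.memLp (β := β) (φ := fun _ => 1) measurable_const (memLp_const 1)

lemma memLp_remainder (h : RootExpansion P S ν r) (β : ℝ) :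
    MemLp (fun w => (r β w - r 0 w) / β - S w * r 0 w / 2) 2 ν := by
  have h1 : MemLp (fun w => (r β w - r 0 w)) 2 ν := (h.memLp_root β).sub (h.memLp_root 0)
  have h2 := (h1.const_mul β⁻¹).sub ((h.memLp h.score_meas h.score_memLp).const_mul (1/2))
  refine h2.ae_eq (ae_of_all _ fun w => ?_)
  simp only [Pi.sub_apply]; ring

/-- The root densities are `O(β)`-close in `L²`. -/
lemma exists_bound (h : RootExpansion P S ν r) : ∃ C : ℝ, 0 ≤ C ∧ ∀ᶠ β in 𝓝[≠] (0 : ℝ),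
    nrm ν (fun w => r β w - r 0 w) ≤ C * |β| := by
  -- The increment of the root is β times the remainder plus β S r₀/2, and the remainder eventually
  -- has norm below 1.
  refine ⟨1 + nrm ν (fun w => S w * r 0 w / 2), by have := nrm_nonneg (μ := ν) (fun w => S w * r 0 w / 2); linarith, ?_⟩
  filter_upwards [h.remainder.eventually (gt_mem_nhds one_pos), self_mem_nhdsWithin] with β hβ hne
  have hne : β ≠ 0 := hne
  have h3 : MemLp (fun w => S w * r 0 w / 2) 2 ν := by
    refine ((h.memLp h.score_meas h.score_memLp).const_mul (1/2)).ae_eq (ae_of_all _ fun w => ?_)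
    simp only; ring
  have h4 : (fun w => r β w - r 0 w) = fun w => β * (((r β w - r 0 w) / β - S w * r 0 w / 2)
      + S w * r 0 w / 2) := by
    ext w; field_simp; ring
  rw [h4, nrm_const_mul, mul_comm]
  gcongr
  exact (nrm_add_le (h.memLp_remainder β) h3).trans (by linarith)

lemma sub_eq (h : RootExpansion P S ν r) {β : ℝ} {φ : W → ℝ} (hm : Measurable φ)
    (h1 : MemLp φ 2 (P β : Measure W)) (h0 : MemLp φ 2 (P 0 : Measure W)) :
    ∫ w, φ w ∂(P β : Measure W) - ∫ w, φ w ∂(P 0 : Measure W)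
      = ∫ w, (r β w - r 0 w) * (φ w * r β w + φ w * r 0 w) ∂ν := by
  rw [h.integral_eq, h.integral_eq, ← integral_sub]
  · refine integral_congr_ae (ae_of_all _ fun w => ?_)
    simp only; ring
  · exact (h.integrable_iff β φ hm).1 (h1.integrable (by norm_num))
  · exact (h.integrable_iff 0 φ hm).1 (h0.integrable (by norm_num))

/-- Means of square-integrable functions are `O(β)`-close. -/
lemma abs_sub_le (h : RootExpansion P S ν r) {β : ℝ} {φ : W → ℝ} (hm : Measurable φ)
    (h1 : MemLp φ 2 (P β : Measure W)) (h0 : MemLp φ 2 (P 0 : Measure W)) :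
    |∫ w, φ w ∂(P β : Measure W) - ∫ w, φ w ∂(P 0 : Measure W)|
      ≤ nrm ν (fun w => r β w - r 0 w) * (nrm (P β : Measure W) φ + nrm (P 0 : Measure W) φ) := by
  rw [h.sub_eq hm h1 h0]
  refine (abs_integral_mul_le ((h.memLp_root β).sub (h.memLp_root 0))
    ((h.memLp hm h1).add (h.memLp hm h0))).trans ?_
  refine mul_le_mul_of_nonneg_left ?_ (nrm_nonneg _)
  refine (nrm_add_le (h.memLp hm h1) (h.memLp hm h0)).trans ?_
  rw [h.nrm_eq, h.nrm_eq]

lemma tendsto_of_bound {α : Type*} {l : Filter α} {a : α → ℝ} {L : ℝ}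
    (h : ∀ ε > 0, ∀ᶠ x in l, |a x - L| ≤ ε) : Tendsto a l (𝓝 L) := by
  rw [Metric.tendsto_nhds]
  intro ε hε
  filter_upwards [h (ε / 2) (by positivity)] with x hx
  rw [Real.dist_eq]; linarith

/-- Differentiability of the means of bounded-variance functions that converge in `L¹(P 0)`. -/
lemma tendsto_slope (h : RootExpansion P S ν r) {φ : ℝ → W → ℝ} {K : ℝ}
    (hm : ∀ β, Measurable (φ β))
    (h1 : ∀ᶠ β in 𝓝[≠] (0 : ℝ), MemLp (φ β) 2 (P β : Measure W) ∧ nrm (P β : Measure W) (φ β) ≤ K)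
    (h0 : ∀ᶠ β in 𝓝[≠] (0 : ℝ), MemLp (φ β) 2 (P 0 : Measure W) ∧ nrm (P 0 : Measure W) (φ β) ≤ K)
    (h00 : MemLp (φ 0) 2 (P 0 : Measure W))
    (hL : Tendsto (fun β => ∫ w, |φ β w - φ 0 w| ∂(P 0 : Measure W)) (𝓝[≠] 0) (𝓝 0)) :
    Tendsto (fun β => (∫ w, φ β w ∂(P β : Measure W) - ∫ w, φ β w ∂(P 0 : Measure W)) / β)
      (𝓝[≠] 0) (𝓝 (∫ w, φ 0 w * S w ∂(P 0 : Measure W))) := by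
  have hK : 0 ≤ K := by
    obtain ⟨β, hβ⟩ := h0.exists
    exact (nrm_nonneg _).trans hβ.2
  obtain ⟨C, hC0, hC⟩ := h.exists_bound
  refine tendsto_of_bound fun ε hε => ?_
  set K0 := nrm (P 0 : Measure W) (φ 0) with hK0
  have hK0' : 0 ≤ K0 := nrm_nonneg _
  -- The truncation level of S is fixed before β: the L¹ convergence of φ can only be paired with a
  -- bounded score. The factor collects the tail terms below, K from the cross term and K + K0 from
  -- φ β - φ 0.
  have hlim := (tendsto_nrm_tail h.score_meas h.score_memLp).const_mul (K + K0 + K)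
  rw [mul_zero] at hlim
  obtain ⟨k, hk⟩ := (hlim.eventually (gt_mem_nhds (show (0:ℝ) < ε / 4 by positivity))).exists
  set tail := nrm (P 0 : Measure W) (fun x => {x | (k : ℝ) < |S x|}.indicator S x) with htail
  have e1 : ∀ᶠ β in 𝓝[≠] (0 : ℝ),
      nrm ν (fun w => (r β w - r 0 w) / β - S w * r 0 w / 2) * (K + K) < ε / 4 := by
    have := h.remainder.mul_const (K + K)
    rw [zero_mul] at this
    exact this.eventually (gt_mem_nhds (by positivity))
  have e2 : ∀ᶠ β in 𝓝[≠] (0 : ℝ), k * K * (C * |β|) < ε / 4 := by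
    have : Tendsto (fun β : ℝ => k * K * (C * |β|)) (𝓝[≠] 0) (𝓝 0) := by
      have : Continuous (fun β : ℝ => k * K * (C * |β|)) := by fun_prop
      simpa using (this.tendsto 0).mono_left nhdsWithin_le_nhds
    exact this.eventually (gt_mem_nhds (by positivity))
  have e3 : ∀ᶠ β in 𝓝[≠] (0 : ℝ), k * ∫ w, |φ β w - φ 0 w| ∂(P 0 : Measure W) < ε / 4 := by
    have := hL.const_mul (k : ℝ)
    rw [mul_zero] at this
    exact this.eventually (gt_mem_nhds (by positivity))
  filter_upwards [h1, h0, hC, e1, e2, e3, self_mem_nhdsWithin] with β b1 b0 bC b4 b5 b6 bne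
  have bne : β ≠ 0 := bne
  set R := fun w => (r β w - r 0 w) / β - S w * r 0 w / 2 with hR
  have mR : MemLp R 2 ν := h.memLp_remainder β
  have mb := h.memLp (hm β) b1.1
  have m0 := h.memLp (hm β) b0.1
  have mS := h.memLp h.score_meas h.score_memLp
  have mη : MemLp (fun w => r β w - r 0 w) 2 ν := (h.memLp_root β).sub (h.memLp_root 0)
  set Sb := fun x => {x | (k : ℝ) < |S x|}ᶜ.indicator S x with hSb
  set St := fun x => {x | (k : ℝ) < |S x|}.indicator S x with hSt
  have hset : MeasurableSet {x | (k : ℝ) < |S x|} := measurableSet_lt measurable_const h.score_meas.abs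
  have hSbm : Measurable Sb := h.score_meas.indicator hset.compl
  have hStm : Measurable St := h.score_meas.indicator hset
  have hStl : MemLp St 2 (P 0 : Measure W) := h.score_memLp.indicator hset
  have hSb_le : ∀ x, |Sb x| ≤ k := by
    intro x
    by_cases hx : (k : ℝ) < |S x|
    · have : x ∉ {x | (k : ℝ) < |S x|}ᶜ := fun h => h hx
      simp only [hSb, Set.indicator_of_notMem this, abs_zero, Nat.cast_nonneg]
    · have : x ∈ {x | (k : ℝ) < |S x|}ᶜ := hx
      simp only [hSb, Set.indicator_of_mem this]
      exact not_lt.1 hx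
  have hSsum : ∀ x, S x = Sb x + St x := fun x => by
    simp only [hSb, hSt]; rw [add_comm, Set.indicator_self_add_compl_apply]
  have hSbl : MemLp Sb 2 (P 0 : Measure W) := MemLp_of_abs_le hSbm.aestronglyMeasurable k hSb_le
  have mSt := h.memLp hStm hStl
  have mSb := h.memLp hSbm hSbl
  have iR : Integrable (fun w => R w * (φ β w * r β w + φ β w * r 0 w)) ν :=
    mR.integrable_mul (mb.add m0)
  have iS : Integrable (fun w => φ β w * r 0 w * (S w * r 0 w)) ν := m0.integrable_mul mS
  have iSb : Integrable (fun w => (φ β w * r 0 w * Sb w) * (r β w - r 0 w)) ν := by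
    refine integrable_mul_of_memLp (f := fun w => φ β w * r 0 w * Sb w) ?_ mη
    refine MemLp.of_le (m0.const_mul (k : ℝ)) ((((hm β).mul (h.meas 0)).mul hSbm)).aestronglyMeasurable
      (ae_of_all _ fun w => ?_)
    rw [norm_mul _ (Sb w), norm_mul (k : ℝ), mul_comm]
    refine mul_le_mul_of_nonneg_right ?_ (norm_nonneg (φ β w * r 0 w))
    simpa using hSb_le w
  have iSt : Integrable (fun w => (St w * r 0 w) * (φ β w * r β w - φ β w * r 0 w)) ν :=
    mSt.integrable_mul (mb.sub m0)
  have iSbt : Integrable (fun w => (φ β w * r 0 w * Sb w) * (r β w - r 0 w)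
      + (St w * r 0 w) * (φ β w * r β w - φ β w * r 0 w)) ν := iSb.add iSt
  have md : MemLp (fun w => φ β w - φ 0 w) 2 (P 0 : Measure W) := b0.1.sub h00
  -- The difference of means is ∫ (r_β - r₀) φ_β (r_β + r₀). The first factor divided by β is R + S
  -- r₀/2. Against S r₀/2, writing r_β + r₀ = 2 r₀ + (r_β - r₀) separates the mean of φ_β S under P
  -- 0 from a cross term. In the cross term and in φ_β - φ_0, S is split into its bounded part and
  -- its tail.
  have key : (∫ w, φ β w ∂(P β : Measure W) - ∫ w, φ β w ∂(P 0 : Measure W)) / β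
      - ∫ w, φ 0 w * S w ∂(P 0 : Measure W)
      = ∫ w, R w * (φ β w * r β w + φ β w * r 0 w) ∂ν
        + (1/2) * (∫ w, (φ β w * r 0 w * Sb w) * (r β w - r 0 w) ∂ν
          + ∫ w, (St w * r 0 w) * (φ β w * r β w - φ β w * r 0 w) ∂ν)
        + (∫ w, (φ β w - φ 0 w) * Sb w ∂(P 0 : Measure W)
          + ∫ w, (φ β w - φ 0 w) * St w ∂(P 0 : Measure W)) := by
    have a1 : (∫ w, (φ β w - φ 0 w) * Sb w ∂(P 0 : Measure W)
          + ∫ w, (φ β w - φ 0 w) * St w ∂(P 0 : Measure W))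
        = ∫ w, φ β w * S w ∂(P 0 : Measure W) - ∫ w, φ 0 w * S w ∂(P 0 : Measure W) := by
      rw [← integral_add (integrable_mul_of_memLp md hSbl)
          (integrable_mul_of_memLp md hStl),
        ← integral_sub (integrable_mul_of_memLp b0.1 h.score_memLp)
          (integrable_mul_of_memLp h00 h.score_memLp)]
      refine integral_congr_ae (ae_of_all _ fun w => ?_)
      simp only [hSsum w]; ring
    rw [a1, h.sub_eq (hm β) b1.1 b0.1, h.integral_eq 0 (fun w => φ β w * S w),
      ← integral_add iSb iSt, ← integral_const_mul, div_eq_inv_mul, ← integral_const_mul,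
      ← integral_add iR (iSbt.const_mul _), ← add_sub_assoc, sub_left_inj,
      ← integral_add]
    · refine integral_congr_ae (ae_of_all _ fun w => ?_)
      simp only [hR]
      have := hSsum w
      rw [show Sb w = S w - St w by linarith]
      field_simp
      ring
    · exact iR.add (iSbt.const_mul _)
    · exact iS.congr (ae_of_all _ fun w => by simp only; ring)
  rw [key]
  have t1 : |∫ w, R w * (φ β w * r β w + φ β w * r 0 w) ∂ν| ≤ nrm ν R * (K + K) := by
    refine (abs_integral_mul_le mR (mb.add m0)).trans ?_
    refine mul_le_mul_of_nonneg_left ?_ (nrm_nonneg _)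
    refine (nrm_add_le mb m0).trans ?_
    rw [h.nrm_eq, h.nrm_eq]
    exact add_le_add b1.2 b0.2
  have t2 : |∫ w, (φ β w * r 0 w * Sb w) * (r β w - r 0 w) ∂ν| ≤ k * K * (C * |β|) := by
    have hle : ∀ w, |φ β w * r 0 w * Sb w| ≤ |k * (φ β w * r 0 w)| := by
      intro w
      rw [abs_mul, abs_mul (k : ℝ), mul_comm]
      refine mul_le_mul_of_nonneg_right ?_ (abs_nonneg _)
      simpa using hSb_le w
    have mm : MemLp (fun w => φ β w * r 0 w * Sb w) 2 ν :=
      MemLp.of_le (m0.const_mul (k : ℝ)) ((((hm β).mul (h.meas 0)).mul hSbm)).aestronglyMeasurable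
        (ae_of_all _ hle)
    refine (abs_integral_mul_le mm mη).trans ?_
    refine mul_le_mul ?_ bC (nrm_nonneg _) (by positivity)
    refine (nrm_mono (m0.const_mul (k : ℝ)) (ae_of_all _ hle)).trans ?_
    rw [nrm_const_mul, h.nrm_eq, Nat.abs_cast]
    exact mul_le_mul_of_nonneg_left b0.2 (Nat.cast_nonneg _)
  have t3 : |∫ w, (St w * r 0 w) * (φ β w * r β w - φ β w * r 0 w) ∂ν| ≤ tail * (K + K) := by
    refine (abs_integral_mul_le mSt (mb.sub m0)).trans ?_
    rw [h.nrm_eq]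
    refine mul_le_mul_of_nonneg_left ?_ (nrm_nonneg _)
    refine (nrm_sub_le mb m0).trans ?_
    rw [h.nrm_eq, h.nrm_eq]
    exact add_le_add b1.2 b0.2
  have t4 : |∫ w, (φ β w - φ 0 w) * Sb w ∂(P 0 : Measure W)|
      ≤ k * ∫ w, |φ β w - φ 0 w| ∂(P 0 : Measure W) := by
    rw [← integral_const_mul]
    refine abs_integral_le_integral_abs.trans ?_
    refine integral_mono_of_nonneg (ae_of_all _ fun _ => abs_nonneg _)
      ((md.integrable (by norm_num)).abs.const_mul _) (ae_of_all _ fun w => ?_)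
    simp only [abs_mul]
    rw [mul_comm]
    exact mul_le_mul_of_nonneg_right (hSb_le w) (abs_nonneg _)
  have t5 : |∫ w, (φ β w - φ 0 w) * St w ∂(P 0 : Measure W)| ≤ (K + K0) * tail := by
    refine (abs_integral_mul_le md hStl).trans ?_
    refine mul_le_mul_of_nonneg_right ?_ (nrm_nonneg _)
    refine (nrm_sub_le b0.1 h00).trans ?_
    exact add_le_add b0.2 le_rfl
  have ht0 : 0 ≤ tail := nrm_nonneg _
  have hk' : (K + K0 + K) * tail < ε / 4 := hk
  have := abs_le.1 t1; have := abs_le.1 t2; have := abs_le.1 t3; have := abs_le.1 t4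
  have := abs_le.1 t5
  rw [abs_le]
  constructor <;> nlinarith

/-- Sets on which `P 0` is at least four times `P β` have `P 0`-measure `o(β²)`. -/
lemma tendsto_div_sq (h : RootExpansion P S ν r) {B : ℝ → Set W} (hB : ∀ β, MeasurableSet (B β))
    (hle : ∀ β, 4 * (P β : Measure W).real (B β) ≤ (P 0 : Measure W).real (B β)) :
    Tendsto (fun β => (P 0 : Measure W).real (B β) / β ^ 2) (𝓝[≠] 0) (𝓝 0) := by
  obtain ⟨C, hC0, hC⟩ := h.exists_bound
  have ind : ∀ β, Measurable (fun w => (B β).indicator (fun _ => (1 : ℝ)) w) := fun β =>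
    measurable_const.indicator (hB β)
  have indb : ∀ β w, |(B β).indicator (fun _ => (1 : ℝ)) w| ≤ 1 := fun β w => by
    by_cases hw : w ∈ B β <;> simp [hw]
  have hnB : ∀ β β', nrm (P β' : Measure W) (fun w => (B β).indicator (fun _ => (1 : ℝ)) w)
      = √((P β' : Measure W).real (B β)) := by
    intro β β'
    unfold nrm
    congr 1
    rw [← integral_indicator_one (hB β)]
    refine integral_congr_ae (ae_of_all _ fun w => ?_)
    by_cases hw : w ∈ B β <;> simp [hw]
  -- `P 0 (B)` is controlled by the increment of the root densities on `B`
  have main : ∀ β, √((P 0 : Measure W).real (B β))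
      ≤ 2 * nrm ν (fun w => (B β).indicator (fun _ => (1 : ℝ)) w * (r β w - r 0 w)) := by
    intro β
    have i0 : MemLp (fun w => (B β).indicator (fun _ => (1 : ℝ)) w * r 0 w) 2 ν :=
      h.memLp (ind β) (MemLp_of_abs_le (ind β).aestronglyMeasurable 1 (indb β))
    have i1 : MemLp (fun w => (B β).indicator (fun _ => (1 : ℝ)) w * r β w) 2 ν :=
      h.memLp (ind β) (MemLp_of_abs_le (ind β).aestronglyMeasurable 1 (indb β))
    have tri := nrm_sub_le i1 (i1.sub i0)
    have e1 : (fun w => (B β).indicator (fun _ => (1 : ℝ)) w * r β w -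
        ((fun w => (B β).indicator (fun _ => (1 : ℝ)) w * r β w) -
          fun w => (B β).indicator (fun _ => (1 : ℝ)) w * r 0 w) w)
        = fun w => (B β).indicator (fun _ => (1 : ℝ)) w * r 0 w := by
      ext w; simp
    have e2 : ((fun w => (B β).indicator (fun _ => (1 : ℝ)) w * r β w) -
          fun w => (B β).indicator (fun _ => (1 : ℝ)) w * r 0 w)
        = fun w => (B β).indicator (fun _ => (1 : ℝ)) w * (r β w - r 0 w) := by
      ext w; simp only [Pi.sub_apply]; ring
    rw [e1, e2, h.nrm_eq, h.nrm_eq, hnB, hnB] at tri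
    -- Under the root the factor 4 becomes 2, so this term is absorbed by half of the left-hand
    -- side.
    have : √((P β : Measure W).real (B β)) ≤ √((P 0 : Measure W).real (B β)) / 2 := by
      rw [Real.sqrt_le_left (by positivity), div_pow, Real.sq_sqrt measureReal_nonneg]
      linarith [hle β]
    linarith
  have step : ∀ᶠ β in 𝓝[≠] (0 : ℝ), √((P 0 : Measure W).real (B β)) ≤ 2 * |β| *
      (nrm ν (fun w => (r β w - r 0 w) / β - S w * r 0 w / 2)
        + nrm (P 0 : Measure W) (fun w => (B β).indicator S w)) := by
    filter_upwards [self_mem_nhdsWithin] with β hne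
    have hne : β ≠ 0 := hne
    refine (main β).trans ?_
    have mR := h.memLp_remainder β
    have mS : MemLp (fun w => (B β).indicator S w * r 0 w) 2 ν :=
      h.memLp (h.score_meas.indicator (hB β)) (h.score_memLp.indicator (hB β))
    have mS2 : MemLp (fun w => (1/2 : ℝ) * ((B β).indicator S w * r 0 w)) 2 ν := mS.const_mul (1/2)
    set R := fun w => (r β w - r 0 w) / β - S w * r 0 w / 2 with hR
    have mBR : MemLp (fun w => (B β).indicator R w) 2 ν := mR.indicator (hB β)
    have e : (fun w => (B β).indicator (fun _ => (1 : ℝ)) w * (r β w - r 0 w))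
        = fun w => β * ((B β).indicator R w + (1/2 : ℝ) * ((B β).indicator S w * r 0 w)) := by
      ext w
      by_cases hw : w ∈ B β
      · simp only [hw, Set.indicator_of_mem, hR]; field_simp; ring
      · simp [hw]
    rw [e, nrm_const_mul, mul_assoc]
    refine mul_le_mul_of_nonneg_left ?_ two_pos.le
    refine mul_le_mul_of_nonneg_left ?_ (abs_nonneg _)
    refine (nrm_add_le mBR mS2).trans ?_
    refine add_le_add ?_ ?_
    · refine nrm_mono mR (ae_of_all _ fun w => ?_)
      by_cases hw : w ∈ B β <;> simp [hw]
    · rw [nrm_const_mul, h.nrm_eq, abs_of_pos (by norm_num : (0:ℝ) < 1/2)]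
      linarith [nrm_nonneg (μ := (P 0 : Measure W)) (fun w => (B β).indicator S w)]
  -- Bootstrap: the crude O(β) bound on roots makes the mass of B vanish, hence also the norm of S
  -- on B. Put back into `step`, this improves O(β) to o(β) for the root of the mass.
  have small : Tendsto (fun β => (P 0 : Measure W).real (B β)) (𝓝[≠] 0) (𝓝 0) := by
    have u : Tendsto (fun β : ℝ => (2 * (C * |β|)) ^ 2) (𝓝[≠] 0) (𝓝 0) := by
      have : Continuous (fun β : ℝ => (2 * (C * |β|)) ^ 2) := by fun_prop
      simpa using (this.tendsto 0).mono_left nhdsWithin_le_nhds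
    refine squeeze_zero' (Eventually.of_forall fun _ => measureReal_nonneg) ?_ u
    filter_upwards [hC] with β hβ
    rw [← Real.sqrt_le_left (by positivity)]
    refine (main β).trans (mul_le_mul_of_nonneg_left (le_trans ?_ hβ) two_pos.le)
    refine nrm_mono ((h.memLp_root β).sub (h.memLp_root 0)) (ae_of_all _ fun w => ?_)
    by_cases hw : w ∈ B β <;> simp [hw]
  have hS0 : Tendsto (fun β => nrm (P 0 : Measure W) (fun w => (B β).indicator S w)) (𝓝[≠] 0)
      (𝓝 0) := by
    have hi : Integrable (fun w => S w ^ 2) (P 0 : Measure W) := h.score_memLp.integrable_sq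
    have hsm : Tendsto (fun β => (P 0 : Measure W) (B β)) (𝓝[≠] 0) (𝓝 0) := by
      have := ENNReal.tendsto_ofReal small
      simpa using this
    have := hi.tendsto_setIntegral_nhds_zero hsm
    have h2 := (Real.continuous_sqrt.tendsto 0).comp this
    rw [Real.sqrt_zero] at h2
    refine h2.congr fun β => ?_
    simp only [Function.comp, nrm]
    congr 1
    rw [← integral_indicator (hB β)]
    refine integral_congr_ae (ae_of_all _ fun w => ?_)
    by_cases hw : w ∈ B β <;> simp [hw]
  have lim := ((h.remainder.add hS0).const_mul 2).pow 2
  simp only [add_zero, mul_zero, ne_eq, OfNat.ofNat_ne_zero, not_false_eq_true, zero_pow] at lim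
  refine squeeze_zero' (Eventually.of_forall fun _ => by positivity) ?_ lim
  filter_upwards [step, self_mem_nhdsWithin] with β hβ hne
  have hne : β ≠ 0 := hne
  rw [div_le_iff₀ (by positivity)]
  have hnn : 0 ≤ √((P 0 : Measure W).real (B β)) := Real.sqrt_nonneg _
  calc (P 0 : Measure W).real (B β) = √((P 0 : Measure W).real (B β)) ^ 2 :=
        (Real.sq_sqrt measureReal_nonneg).symm
    _ ≤ _ := pow_le_pow_left₀ hnn hβ 2
    _ = _ := by rw [← sq_abs β]; ring

end RootExpansion

/-- A family with a score has root densities with an `L²` expansion. -/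
lemma HasScore.exists_rootExpansion {P : ℝ → ProbabilityMeasure W} {S : W → ℝ}
    (hS : MemLp S 2 (P 0 : Measure W)) (h : HasScore P S) :
    ∃ S' ν r, S' =ᵐ[(P 0 : Measure W)] S ∧ RootExpansion P S' ν r := by
  obtain ⟨ν, hν, hac, hlim⟩ := h
  set S' := hS.aestronglyMeasurable.mk S with hS'
  have hSS' : S =ᵐ[(P 0 : Measure W)] S' := hS.aestronglyMeasurable.ae_eq_mk
  have hS'm : Measurable S' := hS.aestronglyMeasurable.stronglyMeasurable_mk.measurable
  set r : ℝ → W → ℝ := fun β w => √((P β : Measure W).rnDeriv ν w).toReal with hr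
  have hrm : ∀ β, Measurable (r β) := fun β =>
    ((Measure.measurable_rnDeriv _ _).ennreal_toReal).sqrt
  have hsq : ∀ β w, r β w ^ 2 = ((P β : Measure W).rnDeriv ν w).toReal := fun β w =>
    Real.sq_sqrt ENNReal.toReal_nonneg
  have hii : ∀ β (φ : W → ℝ), Integrable φ (P β : Measure W) ↔
      Integrable (fun w => φ w * r β w ^ 2) ν := by
    intro β φ
    rw [← integrable_rnDeriv_smul_iff (hac β)]
    simp only [hsq, smul_eq_mul, mul_comm]
  have hie : ∀ β (φ : W → ℝ), ∫ w, φ w ∂(P β : Measure W) = ∫ w, φ w * r β w ^ 2 ∂ν := by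
    intro β φ
    rw [← integral_rnDeriv_smul (hac β)]
    simp only [hsq, smul_eq_mul, mul_comm]
  refine ⟨S', ν, r, hSS'.symm, ?_⟩
  -- The two versions of the score agree almost surely under P 0 only; where the density of P 0
  -- vanishes both products are zero, which gives equality ν-almost everywhere.
  have hae : ∀ᵐ w ∂ν, S w * r 0 w = S' w * r 0 w := by
    have h1 : ∀ᵐ w ∂(ν.withDensity ((P 0 : Measure W).rnDeriv ν)), S w = S' w := by
      rw [Measure.withDensity_rnDeriv_eq _ _ (hac 0)]; exact hSS'
    rw [ae_withDensity_iff (Measure.measurable_rnDeriv _ _)] at h1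
    filter_upwards [h1] with w hw
    by_cases h0 : (P 0 : Measure W).rnDeriv ν w = 0
    · simp [hr, h0]
    · rw [hw h0]
  have mr : ∀ β, MemLp (r β) 2 ν := by
    intro β
    rw [memLp_two_iff_integrable_sq (hrm β).aestronglyMeasurable]
    have := (hii β (fun _ => 1)).1 (integrable_const 1)
    simpa using this
  have mS : MemLp (fun w => S' w * r 0 w) 2 ν := by
    refine memLp_two_of_integrable_sq (hS'm.mul (hrm 0)) ?_
    have := (hii 0 _).1 (hS.ae_eq hSS').integrable_sq
    exact this.congr (ae_of_all _ fun w => by simp [mul_pow])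
  refine ⟨hrm, fun β w => Real.sqrt_nonneg _, fun β φ _ => hii β φ, hie, hS'm, hS.ae_eq hSS', ?_⟩
  have mR : ∀ β, MemLp (fun w => (r β w - r 0 w) / β - S' w * r 0 w / 2) 2 ν := by
    intro β
    refine ((((mr β).sub (mr 0)).const_mul β⁻¹).sub (mS.const_mul (1/2))).ae_eq
      (ae_of_all _ fun w => ?_)
    simp only [Pi.sub_apply]; ring
  have h2 := (ENNReal.tendsto_toReal ENNReal.zero_ne_top).comp hlim
  have h3 := (Real.continuous_sqrt.tendsto 0).comp h2
  rw [Real.sqrt_zero] at h3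
  refine h3.congr fun β => ?_
  simp only [Function.comp, nrm]
  congr 1
  rw [integral_eq_lintegral_of_nonneg_ae (ae_of_all _ fun _ => sq_nonneg _)
    (mR β).integrable_sq.aestronglyMeasurable]
  congr 1
  refine lintegral_congr_ae ?_
  filter_upwards [hae] with w hw
  rw [hr] at hw
  simp only [hr, hw]

end Root

end DiD

namespace DiD

/-! ### Regression functions and conditional probabilities through test functions. -/

section CondSpec
variable {Ω A B : Type*} [MeasurableSpace Ω] [MeasurableSpace A] [MeasurableSpace B]

lemma integral_comp_eq_of_bounded {μ : ProbabilityMeasure Ω} {V : Ω → B} (hV : Measurable V)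
    {a b : B → ℝ} (ha : Measurable a) (hb : Measurable b)
    (ia : Integrable (fun ω => a (V ω)) (μ : Measure Ω))
    (ib : Integrable (fun ω => b (V ω)) (μ : Measure Ω))
    (h : ∀ u : B → ℝ, Measurable u → (∀ x, |u x| ≤ 1) →
      ∫ ω, u (V ω) * a (V ω) ∂(μ : Measure Ω) = ∫ ω, u (V ω) * b (V ω) ∂(μ : Measure Ω)) :
    ∀ᵐ v ∂((μ : Measure Ω).map V), a v = b v := by
  have ia' : Integrable a ((μ : Measure Ω).map V) :=
    (integrable_map_measure ha.aestronglyMeasurable hV.aemeasurable).2 ia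
  have ib' : Integrable b ((μ : Measure Ω).map V) :=
    (integrable_map_measure hb.aestronglyMeasurable hV.aemeasurable).2 ib
  refine Integrable.ae_eq_of_forall_setIntegral_eq _ _ ia' ib' fun s hs _ => ?_
  rw [setIntegral_map hs ha.aestronglyMeasurable hV.aemeasurable,
    setIntegral_map hs hb.aestronglyMeasurable hV.aemeasurable]
  have := h (s.indicator 1) (measurable_one.indicator hs) (fun x => by
    by_cases hx : x ∈ s <;> simp [hx])
  rw [← integral_indicator (hV hs), ← integral_indicator (hV hs)]
  convert this using 2 <;>
  · ext ω
    by_cases hx : V ω ∈ s <;> simp [Set.indicator, hx]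

lemma measurable_condMean (μ : ProbabilityMeasure Ω) (Z : Ω → ℝ) (V : Ω → B) :
    Measurable (condMean μ Z V) := by
  have : StronglyMeasurable (fun x : B => ∫ y, y ∂(condDistrib Z V (μ : Measure Ω) x)) :=
    StronglyMeasurable.integral_condDistrib (f := fun p : B × ℝ => p.2) measurable_snd.stronglyMeasurable
  exact this.measurable

variable {μ : ProbabilityMeasure Ω} {Z : Ω → ℝ} {V : Ω → B}

lemma condMean_ae_eq_condExp (hV : Measurable V) (hZ : Integrable Z (μ : Measure Ω)) :
    (fun ω => condMean μ Z V (V ω)) =ᵐ[(μ : Measure Ω)]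
      (μ : Measure Ω)[Z | MeasurableSpace.comap V inferInstance] :=
  (condExp_ae_eq_integral_condDistrib' hV hZ).symm

lemma integrable_condMean (hV : Measurable V) (hZ : Integrable Z (μ : Measure Ω)) :
    Integrable (fun ω => condMean μ Z V (V ω)) (μ : Measure Ω) :=
  integrable_condExp.congr (condMean_ae_eq_condExp hV hZ).symm

lemma condMean_mul_ae_eq (hV : Measurable V) (hZ : Integrable Z (μ : Measure Ω))
    {u : B → ℝ} (hu : Measurable u)
    (huZ : Integrable (fun ω => u (V ω) * Z ω) (μ : Measure Ω)) :
    (fun ω => u (V ω) * condMean μ Z V (V ω)) =ᵐ[(μ : Measure Ω)]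
      (μ : Measure Ω)[fun ω => u (V ω) * Z ω | MeasurableSpace.comap V inferInstance] := by
  have h1 := condExp_mul_of_stronglyMeasurable_left (μ := (μ : Measure Ω))
    (m := MeasurableSpace.comap V inferInstance) (f := fun ω => u (V ω)) (g := Z)
    (hu.comp (comap_measurable V)).stronglyMeasurable huZ hZ
  have h2 := condMean_ae_eq_condExp hV hZ
  filter_upwards [h1, h2] with ω e1 e2
  rw [e2]; exact e1.symm

lemma integrable_mul_condMean (hV : Measurable V) (hZ : Integrable Z (μ : Measure Ω))
    {u : B → ℝ} (hu : Measurable u)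
    (huZ : Integrable (fun ω => u (V ω) * Z ω) (μ : Measure Ω)) :
    Integrable (fun ω => u (V ω) * condMean μ Z V (V ω)) (μ : Measure Ω) :=
  integrable_condExp.congr (condMean_mul_ae_eq hV hZ hu huZ).symm

/-- The defining property of the regression function. -/
lemma integral_mul_condMean (hV : Measurable V) (hZ : Integrable Z (μ : Measure Ω))
    {u : B → ℝ} (hu : Measurable u)
    (huZ : Integrable (fun ω => u (V ω) * Z ω) (μ : Measure Ω)) :
    ∫ ω, u (V ω) * condMean μ Z V (V ω) ∂(μ : Measure Ω) = ∫ ω, u (V ω) * Z ω ∂(μ : Measure Ω) := by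
  rw [integral_congr_ae (condMean_mul_ae_eq hV hZ hu huZ), integral_condExp hV.comap_le]

lemma memLp_condMean (hV : Measurable V) (hZ : MemLp Z 2 (μ : Measure Ω)) :
    MemLp (fun ω => condMean μ Z V (V ω)) 2 (μ : Measure Ω) :=
  (hZ.condExp (by norm_num)).ae_eq (condMean_ae_eq_condExp hV (hZ.integrable (by norm_num))).symm

/-- With m the regression function, the defining property gives ‖m‖² = E[mZ], which Cauchy-Schwarz
bounds by ‖m‖ ‖Z‖. -/
lemma integral_condMean_sq_le (hV : Measurable V) (hZ : MemLp Z 2 (μ : Measure Ω)) :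
    ∫ ω, condMean μ Z V (V ω) ^ 2 ∂(μ : Measure Ω) ≤ ∫ ω, Z ω ^ 2 ∂(μ : Measure Ω) := by
  have hi := hZ.integrable (by norm_num)
  have hm := memLp_condMean hV hZ
  have hprod : Integrable (fun ω => condMean μ Z V (V ω) * Z ω) (μ : Measure Ω) :=
    integrable_mul_of_memLp hm hZ
  have h1 := integral_mul_condMean hV hi (measurable_condMean μ Z V) hprod
  have h2 := abs_integral_mul_le hm hZ
  rw [← h1] at h2
  simp only [← sq] at h2
  rw [← nrm_sq, abs_of_nonneg (sq_nonneg _)] at h2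
  rw [← nrm_sq, ← nrm_sq]
  refine pow_le_pow_left₀ (nrm_nonneg _) ?_ 2
  by_contra hlt
  push Not at hlt
  nlinarith [nrm_nonneg (μ := (μ : Measure Ω)) Z]

lemma ae_eq_condMean_of_integral {r : B → ℝ} (hV : Measurable V)
    (hZ : Integrable Z (μ : Measure Ω)) (hr : Measurable r)
    (ir : Integrable (fun ω => r (V ω)) (μ : Measure Ω))
    (h : ∀ u : B → ℝ, Measurable u → (∀ x, |u x| ≤ 1) →
      ∫ ω, u (V ω) * r (V ω) ∂(μ : Measure Ω) = ∫ ω, u (V ω) * Z ω ∂(μ : Measure Ω)) :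
    ∀ᵐ v ∂((μ : Measure Ω).map V), condMean μ Z V v = r v := by
  refine integral_comp_eq_of_bounded hV (measurable_condMean μ Z V) hr
    (integrable_condMean hV hZ) ir fun u hu hb => ?_
  rw [h u hu hb, integral_mul_condMean hV hZ hu]
  exact hZ.bdd_mul (c := 1) (hu.comp hV).aestronglyMeasurable (ae_of_all _ fun ω => hb _)

variable [StandardBorelSpace A] [Nonempty A] {U : Ω → A}

lemma measurable_condProb [MeasurableSingletonClass A] (a : A) : Measurable (condProb μ U V a) :=
  (Kernel.measurable_coe _ (measurableSet_singleton a)).ennreal_toReal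

lemma condProb_nonneg (a : A) (b : B) : 0 ≤ condProb μ U V a b := measureReal_nonneg

lemma condProb_le_one (a : A) (b : B) : condProb μ U V a b ≤ 1 := measureReal_le_one

lemma abs_condProb_le (a : A) (b : B) : |condProb μ U V a b| ≤ 1 := by
  rw [abs_of_nonneg (condProb_nonneg a b)]; exact condProb_le_one a b

/-- The defining property of the conditional probability function. -/
lemma integral_mul_condProb [MeasurableSingletonClass A] (hU : Measurable U) (hV : Measurable V)
    (a : A) {u : B → ℝ} (hu : Measurable u)
    (iu : Integrable (fun ω => u (V ω)) (μ : Measure Ω)) :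
    ∫ ω, u (V ω) * condProb μ U V a (V ω) ∂(μ : Measure Ω)
      = ∫ ω, u (V ω) * (U ⁻¹' {a}).indicator (fun _ => (1 : ℝ)) ω ∂(μ : Measure Ω) := by
  have hs : MeasurableSet (U ⁻¹' {a}) := hU (measurableSet_singleton a)
  have hi : Integrable ((U ⁻¹' {a}).indicator (fun _ => (1 : ℝ))) (μ : Measure Ω) :=
    (integrable_const _).indicator hs
  have hui : Integrable (fun ω => u (V ω) * (U ⁻¹' {a}).indicator (fun _ => (1 : ℝ)) ω)
      (μ : Measure Ω) := by
    refine iu.mul_bdd (c := 1) hi.aestronglyMeasurable (ae_of_all _ fun ω => ?_)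
    by_cases hx : ω ∈ U ⁻¹' {a} <;> simp [Set.indicator, hx]
  rw [← integral_mul_condMean hV hi hu hui]
  refine integral_congr_ae ?_
  filter_upwards [condMean_ae_eq_condExp hV hi,
    condDistrib_ae_eq_condExp (μ := (μ : Measure Ω)) hV hU (measurableSet_singleton a)] with ω h1 h2
  rw [h1]
  congr 1

end CondSpec

/-! ### Cells, propensity scores, cell regressions and common support on the observed data. -/

section ObsBasics
variable {𝒳 : Type*} [MeasurableSpace 𝒳]

attribute [fun_prop] measurable_X

@[fun_prop] lemma measurable_Y : Measurable (Y : Obs 𝒳 → ℝ) := by unfold Y; fun_prop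
@[fun_prop] lemma measurable_D : Measurable (D : Obs 𝒳 → Fin 2) := by unfold D; fun_prop
@[fun_prop] lemma measurable_T : Measurable (T : Obs 𝒳 → Fin 2) := by unfold T; fun_prop

lemma measurableSet_cell (d t : Fin 2) : MeasurableSet {w : Obs 𝒳 | D w = d ∧ T w = t} :=
  (measurable_D (measurableSet_singleton d)).inter (measurable_T (measurableSet_singleton t))

@[fun_prop] lemma measurable_G (d t : Fin 2) : Measurable (G d t : Obs 𝒳 → ℝ) :=
  Measurable.ite (measurableSet_cell d t) measurable_const measurable_const

lemma G_eq_indicator (d t : Fin 2) :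
    (G d t : Obs 𝒳 → ℝ) = {w : Obs 𝒳 | D w = d ∧ T w = t}.indicator (fun _ => 1) := by
  ext w; simp [G, Set.indicator]

lemma G_nonneg (d t : Fin 2) (w : Obs 𝒳) : 0 ≤ G d t w := by unfold G; split_ifs <;> simp

lemma G_le_one (d t : Fin 2) (w : Obs 𝒳) : G d t w ≤ 1 := by unfold G; split_ifs <;> simp

lemma abs_G_le (d t : Fin 2) (w : Obs 𝒳) : |G d t w| ≤ 1 := by
  rw [abs_of_nonneg (G_nonneg d t w)]; exact G_le_one d t w

lemma sum_G (w : Obs 𝒳) : ∑ d : Fin 2, ∑ t : Fin 2, G d t w = 1 := by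
  rw [Finset.sum_eq_single (D w), Finset.sum_eq_single (T w)]
  · simp [G]
  · intro t _ ht; simp [G, Ne.symm ht]
  · simp
  · intro d _ hd; simp [G, Ne.symm hd]
  · simp

lemma integral_lawX (P : ProbabilityMeasure (Obs 𝒳)) {u : 𝒳 → ℝ} (hu : Measurable u) :
    ∫ x, u x ∂(lawX P) = ∫ w, u (X w) ∂(P : Measure (Obs 𝒳)) :=
  integral_map measurable_X.aemeasurable hu.aestronglyMeasurable

instance (P : ProbabilityMeasure (Obs 𝒳)) : IsProbabilityMeasure (lawX P) :=
  Measure.isProbabilityMeasure_map measurable_X.aemeasurable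

lemma ae_lawX_iff (P : ProbabilityMeasure (Obs 𝒳)) {p : 𝒳 → Prop} (h : ∀ᵐ x ∂(lawX P), p x) :
    ∀ᵐ w ∂(P : Measure (Obs 𝒳)), p (X w) :=
  ae_of_ae_map measurable_X.aemeasurable h

@[fun_prop] lemma measurable_mCell (P : ProbabilityMeasure (Obs 𝒳)) (d t : Fin 2) :
    Measurable (mCell P d t) :=
  (measurable_condMean P Y _).comp (by fun_prop)

@[fun_prop] lemma measurable_mY (P : ProbabilityMeasure (Obs 𝒳)) : Measurable (mY P) := by
  unfold mY; fun_prop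

@[fun_prop] lemma measurable_pDTx (P : ProbabilityMeasure (Obs 𝒳)) (d t : Fin 2) :
    Measurable (pDTx P d t) := measurable_condProb _

@[fun_prop] lemma measurable_pDx (P : ProbabilityMeasure (Obs 𝒳)) (d : Fin 2) :
    Measurable (pDx P d) := measurable_condProb _

@[fun_prop] lemma measurable_pTx (P : ProbabilityMeasure (Obs 𝒳)) (t : Fin 2) :
    Measurable (pTx P t) := measurable_condProb _

@[fun_prop] lemma measurable_pDtx (P : ProbabilityMeasure (Obs 𝒳)) (d t : Fin 2) :
    Measurable (pDtx P d t) :=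
  (measurable_condProb (μ := P) (U := D) (V := fun w => (T w, X w)) d).comp (by fun_prop)

/-- The indicator of `D = d`. -/
def iD (d : Fin 2) (w : Obs 𝒳) : ℝ := if D w = d then 1 else 0
/-- The indicator of `T = t`. -/
def iT (t : Fin 2) (w : Obs 𝒳) : ℝ := if T w = t then 1 else 0

@[fun_prop] lemma measurable_iD (d : Fin 2) : Measurable (iD d : Obs 𝒳 → ℝ) :=
  Measurable.ite (measurable_D (measurableSet_singleton d)) measurable_const measurable_const

@[fun_prop] lemma measurable_iT (t : Fin 2) : Measurable (iT t : Obs 𝒳 → ℝ) :=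
  Measurable.ite (measurable_T (measurableSet_singleton t)) measurable_const measurable_const

lemma abs_iD_le (d : Fin 2) (w : Obs 𝒳) : |iD d w| ≤ 1 := by unfold iD; split_ifs <;> simp
lemma abs_iT_le (t : Fin 2) (w : Obs 𝒳) : |iT t w| ≤ 1 := by unfold iT; split_ifs <;> simp
lemma iD_nonneg (d : Fin 2) (w : Obs 𝒳) : 0 ≤ iD d w := by unfold iD; split_ifs <;> simp
lemma G_eq_mul (d t : Fin 2) (w : Obs 𝒳) : G d t w = iD d w * iT t w := by
  unfold G iD iT; by_cases h : D w = d <;> by_cases h' : T w = t <;> simp [h, h']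

lemma D_eq_iD (w : Obs 𝒳) : (((D w : Fin 2) : ℕ) : ℝ) = iD 1 w := by
  unfold iD; have : D w = 0 ∨ D w = 1 := by omega
  rcases this with h | h <;> simp [h]

lemma T_eq_iT (w : Obs 𝒳) : (((T w : Fin 2) : ℕ) : ℝ) = iT 1 w := by
  unfold iT; have : T w = 0 ∨ T w = 1 := by omega
  rcases this with h | h <;> simp [h]

lemma iD_zero (w : Obs 𝒳) : iD 0 w = 1 - iD 1 w := by
  unfold iD; have : D w = 0 ∨ D w = 1 := by omega
  rcases this with h | h <;> simp [h]

lemma iT_zero (w : Obs 𝒳) : iT 0 w = 1 - iT 1 w := by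
  unfold iT; have : T w = 0 ∨ T w = 1 := by omega
  rcases this with h | h <;> simp [h]

variable {P : ProbabilityMeasure (Obs 𝒳)}

lemma integral_mul_pDTx (d t : Fin 2) {u : 𝒳 → ℝ} (hu : Measurable u)
    (iu : Integrable (fun w => u (X w)) (P : Measure (Obs 𝒳))) :
    ∫ w, u (X w) * pDTx P d t (X w) ∂(P : Measure (Obs 𝒳))
      = ∫ w, u (X w) * G d t w ∂(P : Measure (Obs 𝒳)) := by
  unfold pDTx
  rw [integral_mul_condProb (by fun_prop) measurable_X _ hu iu]
  congr 1; ext w; congr 1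
  simp [G, Set.indicator]

lemma integral_mul_pDx (d : Fin 2) {u : 𝒳 → ℝ} (hu : Measurable u)
    (iu : Integrable (fun w => u (X w)) (P : Measure (Obs 𝒳))) :
    ∫ w, u (X w) * pDx P d (X w) ∂(P : Measure (Obs 𝒳))
      = ∫ w, u (X w) * iD d w ∂(P : Measure (Obs 𝒳)) := by
  unfold pDx
  rw [integral_mul_condProb (by fun_prop) measurable_X _ hu iu]
  congr 1; ext w; congr 1
  simp [iD, Set.indicator]

lemma integral_mul_pTx (t : Fin 2) {u : 𝒳 → ℝ} (hu : Measurable u)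
    (iu : Integrable (fun w => u (X w)) (P : Measure (Obs 𝒳))) :
    ∫ w, u (X w) * pTx P t (X w) ∂(P : Measure (Obs 𝒳))
      = ∫ w, u (X w) * iT t w ∂(P : Measure (Obs 𝒳)) := by
  unfold pTx
  rw [integral_mul_condProb (by fun_prop) measurable_X _ hu iu]
  congr 1; ext w; congr 1
  simp [iT, Set.indicator]

lemma integral_mul_pDtx (d t : Fin 2) {u : 𝒳 → ℝ} (hu : Measurable u)
    (iu : Integrable (fun w => u (X w)) (P : Measure (Obs 𝒳))) :
    ∫ w, u (X w) * iT t w * pDtx P d t (X w) ∂(P : Measure (Obs 𝒳))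
      = ∫ w, u (X w) * G d t w ∂(P : Measure (Obs 𝒳)) := by
  have hm : Measurable (fun p : Fin 2 × 𝒳 => u p.2 * if p.1 = t then (1 : ℝ) else 0) :=
    (hu.comp measurable_snd).mul (Measurable.ite (measurable_fst (measurableSet_singleton t))
      measurable_const measurable_const)
  have h := integral_mul_condProb (μ := P) (U := D) (V := fun w => (T w, X w)) (by fun_prop)
    (by fun_prop) d hm (iu.mul_bdd (c := 1) (measurable_iT t).aestronglyMeasurable
      (ae_of_all _ fun w => abs_iT_le t w))
  convert h using 1
  · congr 1; ext w
    by_cases h : T w = t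
    · simp [iT, h, pDtx]
    · simp [iT, h]
  · congr 1; ext w
    rw [G_eq_mul, mul_assoc, mul_comm (iD d w)]
    simp [iT, iD, Set.indicator]

/-- The regression function of the outcome represents cell means. -/
lemma integral_mul_mCell (hY : Integrable Y (P : Measure (Obs 𝒳))) (d t : Fin 2) {u : 𝒳 → ℝ}
    (hu : Measurable u) (iu : Integrable (fun w => u (X w) * G d t w * Y w) (P : Measure (Obs 𝒳))) :
    Integrable (fun w => u (X w) * G d t w * mCell P d t (X w)) (P : Measure (Obs 𝒳)) ∧
    ∫ w, u (X w) * G d t w * mCell P d t (X w) ∂(P : Measure (Obs 𝒳))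
      = ∫ w, u (X w) * G d t w * Y w ∂(P : Measure (Obs 𝒳)) := by
  have hm : Measurable (fun p : Fin 2 × Fin 2 × 𝒳 =>
      u p.2.2 * if p.1 = d ∧ p.2.1 = t then (1 : ℝ) else 0) := by
    refine (hu.comp (by fun_prop)).mul (Measurable.ite ?_ measurable_const measurable_const)
    exact (measurable_fst (measurableSet_singleton d)).inter
      ((measurable_fst.comp measurable_snd) (measurableSet_singleton t))
  have hV : Measurable (fun w : Obs 𝒳 => (D w, T w, X w)) := by fun_prop
  have h1 := integral_mul_condMean (μ := P) (Z := Y) hV hY hm iu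
  have h2 := integrable_mul_condMean (μ := P) (Z := Y) hV hY hm iu
  have e : (fun w => u (X w) * G d t w * mCell P d t (X w)) = fun w =>
      (u (X w) * if D w = d ∧ T w = t then (1 : ℝ) else 0) *
        condMean P Y (fun w => (D w, T w, X w)) (D w, T w, X w) := by
    ext w
    by_cases h : D w = d ∧ T w = t
    · simp [G, h, mCell]
    · simp [G, h]
  rw [e]
  exact ⟨h2, h1⟩

/-- Common support as an inequality between measures. -/
lemma support_iff {c : ℝ} : Support P c ↔ ∀ d t : Fin 2, ENNReal.ofReal c • lawX P
    ≤ ((P : Measure (Obs 𝒳)).restrict {w | D w = d ∧ T w = t}).map X := by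
  have key : ∀ (d t : Fin 2) (A : Set 𝒳), MeasurableSet A →
      ∫⁻ x in A, ENNReal.ofReal (pDTx P d t x) ∂(lawX P)
        = ((P : Measure (Obs 𝒳)).restrict {w | D w = d ∧ T w = t}).map X A := by
    intro d t A hA
    have h1 := setLIntegral_preimage_condDistrib (μ := (P : Measure (Obs 𝒳))) (X := X)
      (Y := fun w => (D w, T w)) (s := {(d, t)}) measurable_X
      (by fun_prop) (measurableSet_singleton _) hA
    rw [Measure.map_apply measurable_X hA, Measure.restrict_apply (measurable_X hA)]
    have e : {w : Obs 𝒳 | D w = d ∧ T w = t} = (fun w => (D w, T w)) ⁻¹' {(d, t)} := by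
      ext w; simp
    rw [e, ← h1, lawX, setLIntegral_map hA (by fun_prop) measurable_X]
    refine lintegral_congr fun w => ?_
    simp only [pDTx, condProb, measureReal_def]
    rw [ENNReal.ofReal_toReal (measure_ne_top _ _)]
  have hm : ∀ d t, Measurable (fun x => ENNReal.ofReal (pDTx P d t x)) := fun d t => by fun_prop
  constructor
  · intro h d t
    refine Measure.le_iff.2 fun A hA => ?_
    rw [← key d t A hA, Measure.smul_apply, smul_eq_mul, ← setLIntegral_const]
    refine lintegral_mono_ae (ae_restrict_of_ae ?_)
    filter_upwards [h d t] with x hx using ENNReal.ofReal_le_ofReal hx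
  · intro h d t
    have : (fun _ => ENNReal.ofReal c) ≤ᵐ[lawX P] fun x => ENNReal.ofReal (pDTx P d t x) := by
      refine ae_le_of_forall_setLIntegral_le_of_sigmaFinite measurable_const fun A hA _ => ?_
      rw [key d t A hA, setLIntegral_const, ← smul_eq_mul, ← Measure.smul_apply]
      exact h d t A
    filter_upwards [this] with x hx
    exact (ENNReal.ofReal_le_ofReal_iff (condProb_nonneg _ _)).1 hx

lemma integral_restrict_map (d t : Fin 2) {u : 𝒳 → ℝ} (hu : Measurable u) :
    ∫ x, u x ∂(((P : Measure (Obs 𝒳)).restrict {w | D w = d ∧ T w = t}).map X)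
      = ∫ w, G d t w * u (X w) ∂(P : Measure (Obs 𝒳)) := by
  rw [integral_map measurable_X.aemeasurable hu.aestronglyMeasurable,
    ← integral_indicator (measurableSet_cell d t)]
  congr 1; ext w
  by_cases h : D w = d ∧ T w = t <;> simp [G, Set.indicator, h]

lemma integrable_restrict_map (d t : Fin 2) {u : 𝒳 → ℝ} (hu : Measurable u) :
    Integrable u (((P : Measure (Obs 𝒳)).restrict {w | D w = d ∧ T w = t}).map X)
      ↔ Integrable (fun w => G d t w * u (X w)) (P : Measure (Obs 𝒳)) := by
  rw [integrable_map_measure hu.aestronglyMeasurable measurable_X.aemeasurable,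
    ← IntegrableOn, ← integrable_indicator_iff (measurableSet_cell d t)]
  refine integrable_congr (ae_of_all _ fun w => ?_)
  by_cases h : D w = d ∧ T w = t <;> simp [G, Set.indicator, h]

/-- Each cell carries at least the fraction c of the law of X, so integrability inside one cell
passes to the whole population. -/
lemma Support.integrable {c : ℝ} (hc : 0 < c) (h : Support P c) (d t : Fin 2) {u : 𝒳 → ℝ}
    (hu : Measurable u) (iu : Integrable (fun w => G d t w * u (X w)) (P : Measure (Obs 𝒳))) :
    Integrable (fun w => u (X w)) (P : Measure (Obs 𝒳)) := by
  have h1 := ((integrable_restrict_map d t hu).2 iu).mono_measure ((support_iff).1 h d t)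
  rw [integrable_smul_measure (by simpa using hc) ENNReal.ofReal_ne_top, lawX,
    integrable_map_measure hu.aestronglyMeasurable measurable_X.aemeasurable] at h1
  exact h1

lemma Support.integral_le {c : ℝ} (hc : 0 < c) (h : Support P c) (d t : Fin 2) {u : 𝒳 → ℝ}
    (hu : Measurable u) (h0 : ∀ x, 0 ≤ u x)
    (iu : Integrable (fun w => G d t w * u (X w)) (P : Measure (Obs 𝒳))) :
    c * ∫ w, u (X w) ∂(P : Measure (Obs 𝒳)) ≤ ∫ w, G d t w * u (X w) ∂(P : Measure (Obs 𝒳)) := by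
  have h1 := integral_mono_measure ((support_iff).1 h d t) (ae_of_all _ h0)
    ((integrable_restrict_map d t hu).2 iu)
  rwa [integral_restrict_map d t hu, integral_smul_measure, ENNReal.toReal_ofReal hc.le,
    integral_lawX P hu] at h1

/-- Inside its own cell the cell regression is the conditional mean of Y given (D,T,X), which
contracts the L² norm. -/
lemma integral_G_mul_mCell_sq (hY : MemLp Y 2 (P : Measure (Obs 𝒳))) (d t : Fin 2) :
    Integrable (fun w => G d t w * mCell P d t (X w) ^ 2) (P : Measure (Obs 𝒳)) ∧
    ∫ w, G d t w * mCell P d t (X w) ^ 2 ∂(P : Measure (Obs 𝒳))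
      ≤ ∫ w, Y w ^ 2 ∂(P : Measure (Obs 𝒳)) := by
  have hV : Measurable (fun w : Obs 𝒳 => (D w, T w, X w)) := by fun_prop
  have h1 := memLp_condMean hV hY
  have h2 := integral_condMean_sq_le hV hY
  have hle : ∀ w, G d t w * mCell P d t (X w) ^ 2
      ≤ condMean P Y (fun w => (D w, T w, X w)) (D w, T w, X w) ^ 2 := by
    intro w
    by_cases h : D w = d ∧ T w = t
    · simp [G, h, mCell]
    · simp [G, h, sq_nonneg]
  have h0 : ∀ w, 0 ≤ G d t w * mCell P d t (X w) ^ 2 := fun w =>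
    mul_nonneg (G_nonneg d t w) (sq_nonneg _)
  have hi : Integrable (fun w => G d t w * mCell P d t (X w) ^ 2) (P : Measure (Obs 𝒳)) := by
    refine h1.integrable_sq.mono' (by fun_prop) (ae_of_all _ fun w => ?_)
    rw [Real.norm_of_nonneg (h0 w)]; exact hle w
  exact ⟨hi, (integral_mono hi h1.integrable_sq hle).trans h2⟩

lemma Support.memLp_mCell {c : ℝ} (hc : 0 < c) (h : Support P c)
    (hY : MemLp Y 2 (P : Measure (Obs 𝒳))) (d t : Fin 2) :
    MemLp (fun w => mCell P d t (X w)) 2 (P : Measure (Obs 𝒳)) :=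
  memLp_two_of_integrable_sq (by fun_prop)
    (h.integrable hc d t (u := fun x => mCell P d t x ^ 2) (by fun_prop)
      (integral_G_mul_mCell_sq hY d t).1)

/-- This is what makes the cell regressions uniformly bounded in L² along a submodel: the bound
depends only on the support constant and the second moment of Y. -/
lemma Support.integral_mCell_sq_le {c : ℝ} (hc : 0 < c) (h : Support P c)
    (hY : MemLp Y 2 (P : Measure (Obs 𝒳))) (d t : Fin 2) :
    ∫ w, mCell P d t (X w) ^ 2 ∂(P : Measure (Obs 𝒳))
      ≤ c⁻¹ * ∫ w, Y w ^ 2 ∂(P : Measure (Obs 𝒳)) := by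
  rw [le_inv_mul_iff₀ hc]
  exact (h.integral_le hc d t (u := fun x => mCell P d t x ^ 2) (by fun_prop)
    (fun _ => sq_nonneg _) (integral_G_mul_mCell_sq hY d t).1).trans
    (integral_G_mul_mCell_sq hY d t).2

lemma Support.memLp_mY {c : ℝ} (hc : 0 < c) (h : Support P c)
    (hY : MemLp Y 2 (P : Measure (Obs 𝒳))) :
    MemLp (fun w => mY P (X w)) 2 (P : Measure (Obs 𝒳)) := by
  unfold mY
  refine memLp_finsetSum _ fun d _ => memLp_finsetSum _ fun t _ => ?_
  exact (h.memLp_mCell hc hY d t).const_mul _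

lemma pDT_eq_integral : pDT P = ∫ w, G 1 1 w ∂(P : Measure (Obs 𝒳)) := by
  rw [G_eq_indicator, integral_indicator (measurableSet_cell 1 1)]
  simp [pDT]

lemma integrable_G (d t : Fin 2) : Integrable (G d t) (P : Measure (Obs 𝒳)) :=
  (MemLp_of_abs_le (p := 2) (by fun_prop) 1 (abs_G_le d t)).integrable (by norm_num)

lemma Support.le_integral_G {c : ℝ} (hc : 0 < c) (h : Support P c) (d t : Fin 2) :
    c ≤ ∫ w, G d t w ∂(P : Measure (Obs 𝒳)) := by
  have := h.integral_le hc d t (u := fun _ => 1) measurable_const (fun _ => zero_le_one)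
    (by simpa using integrable_G (P := P) d t)
  simpa using this

end ObsBasics

end DiD

namespace DiD

/-! ### Conditional means of potential outcomes in terms of observed cells. -/

section Identification
variable {𝒳 : Type*} [MeasurableSpace 𝒳]

/-- Common support makes the law of X absolutely continuous with respect to its part in a single
cell, so an identity tested inside that cell holds for almost every covariate value. -/
lemma Support.ae_eq_of_cell {P : ProbabilityMeasure (Obs 𝒳)} {c : ℝ} (hc : 0 < c)
    (h : Support P c) (d t : Fin 2) {a b : 𝒳 → ℝ} (ha : Measurable a) (hb : Measurable b)
    (ia : Integrable (fun w => G d t w * a (X w)) (P : Measure (Obs 𝒳)))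
    (ib : Integrable (fun w => G d t w * b (X w)) (P : Measure (Obs 𝒳)))
    (hab : ∀ u : 𝒳 → ℝ, Measurable u → (∀ x, |u x| ≤ 1) →
      ∫ w, u (X w) * G d t w * a (X w) ∂(P : Measure (Obs 𝒳))
        = ∫ w, u (X w) * G d t w * b (X w) ∂(P : Measure (Obs 𝒳))) :
    ∀ᵐ x ∂(lawX P), a x = b x := by
  set ρ := ((P : Measure (Obs 𝒳)).restrict {w | D w = d ∧ T w = t}).map X with hρ
  have hac : lawX P ≪ ρ := by
    have h1 : lawX P ≪ ENNReal.ofReal c • lawX P :=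
      Measure.absolutelyContinuous_smul (by simpa using hc)
    exact h1.trans (Measure.absolutelyContinuous_of_le (support_iff.1 h d t))
  refine hac.ae_le ?_
  refine Integrable.ae_eq_of_forall_setIntegral_eq _ _ ((integrable_restrict_map d t ha).2 ia)
    ((integrable_restrict_map d t hb).2 ib) fun s hs _ => ?_
  have hu := hab (s.indicator 1) (measurable_one.indicator hs) (fun x => by
    by_cases hx : x ∈ s <;> simp [hx])
  rw [← integral_indicator hs, ← integral_indicator hs,
    integral_restrict_map d t (ha.indicator hs), integral_restrict_map d t (hb.indicator hs)]
  convert hu using 2 <;>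
  · ext w
    by_cases hx : X w ∈ s <;> simp [Set.indicator, hx]

lemma obsLaw_coe (Q : ProbabilityMeasure (Full 𝒳)) :
    (obsLaw Q : Measure (Obs 𝒳)) = (Q : Measure (Full 𝒳)).map observe := rfl

lemma integral_obsLaw (Q : ProbabilityMeasure (Full 𝒳)) {f : Obs 𝒳 → ℝ} (hf : Measurable f) :
    ∫ w, f w ∂(obsLaw Q : Measure (Obs 𝒳)) = ∫ ω, f (observe ω) ∂(Q : Measure (Full 𝒳)) := by
  rw [obsLaw_coe, integral_map measurable_observe.aemeasurable hf.aestronglyMeasurable]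

lemma integrable_obsLaw (Q : ProbabilityMeasure (Full 𝒳)) {f : Obs 𝒳 → ℝ} (hf : Measurable f) :
    Integrable f (obsLaw Q : Measure (Obs 𝒳))
      ↔ Integrable (fun ω => f (observe ω)) (Q : Measure (Full 𝒳)) := by
  rw [obsLaw_coe, integrable_map_measure hf.aestronglyMeasurable measurable_observe.aemeasurable]
  rfl

lemma G_observe_mul_Y (d t : Fin 2) (ω : Full 𝒳) :
    G d t (observe ω) * Y (observe ω) = G d t (observe ω) * ω.1 d t := by
  by_cases h : ω.2.1 = d ∧ ω.2.2.1 = t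
  · obtain ⟨rfl, rfl⟩ := h
    have : Y (observe ω) = ω.1 ω.2.1 ω.2.2.1 := by
      simp only [Y, observe]
      rw [Finset.sum_eq_single ω.2.1, Finset.sum_eq_single ω.2.2.1]
      · simp [cell]
      · intro t _ ht; simp [cell, Ne.symm ht]
      · simp
      · intro d _ hd; simp [cell, Ne.symm hd]
      · simp
    rw [this]
  · have : G d t (observe ω) = 0 := by
      have h' : ¬ (D (observe ω) = d ∧ T (observe ω) = t) := h
      simp only [G, h', if_false]
    simp [this]

lemma measurable_fullMean (Q : ProbabilityMeasure (Full 𝒳)) (Z : Full 𝒳 → ℝ) (d t : Fin 2) :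
    Measurable (fullMean Q Z d t) :=
  (measurable_condMean Q Z _).comp (by fun_prop)

/-- The conditional means of the full data represent cell means. -/
lemma integral_mul_fullMean {Q : ProbabilityMeasure (Full 𝒳)} {Z : Full 𝒳 → ℝ}
    (hZ : Integrable Z (Q : Measure (Full 𝒳))) (d t : Fin 2) {u : 𝒳 → ℝ}
    (hu : Measurable u) (hub : ∀ x, |u x| ≤ 1) :
    Integrable (fun w => u (X w) * G d t w * fullMean Q Z d t (X w)) (obsLaw Q : Measure (Obs 𝒳)) ∧
    ∫ w, u (X w) * G d t w * fullMean Q Z d t (X w) ∂(obsLaw Q : Measure (Obs 𝒳))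
      = ∫ ω, u (X (observe ω)) * G d t (observe ω) * Z ω ∂(Q : Measure (Full 𝒳)) := by
  have hm : Measurable (fun p : Fin 2 × Fin 2 × 𝒳 =>
      u p.2.2 * if p.1 = d ∧ p.2.1 = t then (1 : ℝ) else 0) := by
    refine (hu.comp (by fun_prop)).mul (Measurable.ite ?_ measurable_const measurable_const)
    exact (measurable_fst (measurableSet_singleton d)).inter
      ((measurable_fst.comp measurable_snd) (measurableSet_singleton t))
  have hV : Measurable (fun ω : Full 𝒳 => ω.2) := by fun_prop
  have hF : Measurable (fun w : Obs 𝒳 => u (X w) * G d t w * fullMean Q Z d t (X w)) :=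
    ((hu.comp measurable_X).mul (measurable_G d t)).mul
      ((measurable_fullMean Q Z d t).comp measurable_X)
  have iu : Integrable (fun ω : Full 𝒳 =>
      (u ω.2.2.2 * if ω.2.1 = d ∧ ω.2.2.1 = t then (1 : ℝ) else 0) * Z ω)
      (Q : Measure (Full 𝒳)) := by
    refine hZ.bdd_mul (c := 1) (hm.comp hV).aestronglyMeasurable (ae_of_all _ fun ω => ?_)
    split_ifs <;> simp [hub]
  have h1 := integral_mul_condMean (μ := Q) (Z := Z) hV hZ hm iu
  have h2 := integrable_mul_condMean (μ := Q) (Z := Z) hV hZ hm iu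
  have e : (fun ω => u (X (observe ω)) * G d t (observe ω) * fullMean Q Z d t (X (observe ω)))
      = fun ω => (u ω.2.2.2 * if ω.2.1 = d ∧ ω.2.2.1 = t then (1 : ℝ) else 0) *
        condMean Q Z (fun ω => ω.2) ω.2 := by
    ext ω
    by_cases h : ω.2.1 = d ∧ ω.2.2.1 = t
    · obtain ⟨rfl, rfl⟩ := h; simp [G, fullMean, X, D, T, observe]
    · simp [G, h, X, D, T, observe]
  rw [integrable_obsLaw Q hF, integral_obsLaw Q hF, e]
  exact ⟨h2, h1⟩

lemma fullMean_ae_eq {Q : ProbabilityMeasure (Full 𝒳)} {c : ℝ} (hc : 0 < c)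
    (hs : Support (obsLaw Q) c) {Z : Full 𝒳 → ℝ} (hZ : Integrable Z (Q : Measure (Full 𝒳)))
    (d t : Fin 2) {a : 𝒳 → ℝ} (ha : Measurable a)
    (ia : Integrable (fun w => G d t w * a (X w)) (obsLaw Q : Measure (Obs 𝒳)))
    (h : ∀ u : 𝒳 → ℝ, Measurable u → (∀ x, |u x| ≤ 1) →
      ∫ ω, u (X (observe ω)) * G d t (observe ω) * Z ω ∂(Q : Measure (Full 𝒳))
        = ∫ w, u (X w) * G d t w * a (X w) ∂(obsLaw Q : Measure (Obs 𝒳))) :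
    ∀ᵐ x ∂(lawX (obsLaw Q)), fullMean Q Z d t x = a x := by
  refine hs.ae_eq_of_cell hc d t (measurable_fullMean Q Z d t) ha ?_ ia fun u hu hub => ?_
  · simpa using (integral_mul_fullMean hZ d t (u := fun _ => 1) measurable_const (by simp)).1
  · rw [(integral_mul_fullMean hZ d t hu hub).2, h u hu hub]

lemma integrable_G_mul_Y {P : ProbabilityMeasure (Obs 𝒳)} (hY : Integrable Y (P : Measure (Obs 𝒳)))
    (d t : Fin 2) {u : 𝒳 → ℝ} (hu : Measurable u) (hub : ∀ x, |u x| ≤ 1) :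
    Integrable (fun w => u (X w) * G d t w * Y w) (P : Measure (Obs 𝒳)) := by
  refine hY.bdd_mul (c := 1) ((hu.comp measurable_X).mul (measurable_G d t)).aestronglyMeasurable
    (ae_of_all _ fun w => ?_)
  rw [norm_mul]
  exact mul_le_one₀ (hub _) (norm_nonneg _) (abs_G_le d t w)

/-- Consistency: inside the cell (d,t) the outcome Y is the potential outcome Y^d(t), so both
regressions have the same integrals against test functions. -/
lemma fullMean_own_cell {Q : ProbabilityMeasure (Full 𝒳)} {c : ℝ} (hc : 0 < c)
    (hs : Support (obsLaw Q) c) (hY : Integrable Y (obsLaw Q : Measure (Obs 𝒳))) (d t : Fin 2)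
    (hZ : Integrable (fun ω => ω.1 d t) (Q : Measure (Full 𝒳))) :
    ∀ᵐ x ∂(lawX (obsLaw Q)), fullMean Q (fun ω => ω.1 d t) d t x = mCell (obsLaw Q) d t x := by
  refine fullMean_ae_eq hc hs hZ d t (measurable_mCell _ d t) ?_ fun u hu hub => ?_
  · simpa using (integral_mul_mCell hY d t (u := fun _ => 1) measurable_const
      (integrable_G_mul_Y hY d t measurable_const (by simp))).1
  · rw [(integral_mul_mCell hY d t hu (integrable_G_mul_Y hY d t hu hub)).2,
      integral_obsLaw Q (by fun_prop)]
    refine integral_congr_ae (ae_of_all _ fun ω => ?_)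
    simp only [mul_assoc, G_observe_mul_Y]

end Identification

/-! ### Identification of the ATET and the induced model for observed laws. -/

section ObsModel
variable {𝒳 : Type*} [MeasurableSpace 𝒳] [StandardBorelSpace 𝒳]

/-- The observed laws that satisfy the restrictions of setting `s` on the observed data. -/
structure ObsModel (s : Setting) (P : ProbabilityMeasure (Obs 𝒳)) : Prop where
  memLp : MemLp Y 2 (P : Measure (Obs 𝒳))
  common_support : ∃ c > 0, Support P c
  relation : Relation s P

lemma InModel.obsModel {s : Setting} {Q : ProbabilityMeasure (Full 𝒳)} (h : InModel s Q) :
    ObsModel s (obsLaw Q) := ⟨h.memLp, h.common_support, h.relation⟩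

/-- The ATET as a functional of the observed law. -/
def theta (P : ProbabilityMeasure (Obs 𝒳)) : ℝ :=
  (∫ w, G 1 1 w * mY P (X w) ∂(P : Measure (Obs 𝒳))) / pDT P

lemma mY_eq (P : ProbabilityMeasure (Obs 𝒳)) (x : 𝒳) :
    mY P x = mCell P 1 1 x - (mCell P 0 1 x - mCell P 0 0 x + mCell P 1 0 x) := by
  simp [mY, Fin.sum_univ_two]; ring

/-- Identification of the ATET. -/
lemma InModel.atet_eq {s : Setting} {Q : ProbabilityMeasure (Full 𝒳)} (h : InModel s Q) :
    atet Q = theta (obsLaw Q) := by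
  obtain ⟨c, hc, hs⟩ := h.common_support
  have hY : Integrable Y (obsLaw Q : Measure (Obs 𝒳)) := h.memLp.integrable (by norm_num)
  have hmem := fun d t => (hs.memLp_mCell hc h.memLp d t).integrable (q := 2) (by norm_num)
  have hm : ∀ d t d' t', Integrable (fun w => G d' t' w * mCell (obsLaw Q) d t (X w))
      (obsLaw Q : Measure (Obs 𝒳)) := fun d t d' t' =>
    (hmem d t).bdd_mul (c := 1) (measurable_G d' t').aestronglyMeasurable
      (ae_of_all _ fun w => abs_G_le d' t' w)
  have hcell : MeasurableSet (cell 1 1 : Set (Full 𝒳)) :=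
    (measurableSet_eq_fun (by fun_prop) measurable_const).inter
    (measurableSet_eq_fun (by fun_prop) measurable_const)
  -- the mean of the treated without treatment before the treatment
  have f10 : ∀ᵐ x ∂(lawX (obsLaw Q)),
      fullMean Q (fun ω => ω.1 0 0) 1 0 x = mCell (obsLaw Q) 1 0 x := by
    have h1 := fullMean_own_cell hc hs hY 1 0 (h.integrable 1 0)
    have h2 : ∀ᵐ x ∂(lawX (obsLaw Q)), fullMean Q (fun ω => ω.1 1 0 - ω.1 0 0) 1 0 x
        = fullMean Q (fun ω => ω.1 1 0) 1 0 x - fullMean Q (fun ω => ω.1 0 0) 1 0 x := by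
      have i1 := fun u hu hub => integral_mul_fullMean (u := u) (h.integrable 1 0) 1 0 hu hub
      have i2 := fun u hu hub => integral_mul_fullMean (u := u) (h.integrable 0 0) 1 0 hu hub
      have hZ : Integrable (fun ω => ω.1 1 0 - ω.1 0 0) (Q : Measure (Full 𝒳)) :=
        (h.integrable 1 0).sub (h.integrable 0 0)
      refine fullMean_ae_eq hc hs hZ 1 0
        ((measurable_fullMean _ _ _ _).sub (measurable_fullMean _ _ _ _)) ?_ fun u hu hub => ?_
      · have := (i1 (fun _ => 1) measurable_const (by simp)).1.sub
          (i2 (fun _ => 1) measurable_const (by simp)).1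
        refine this.congr (ae_of_all _ fun w => ?_)
        simp only [Pi.sub_apply]; ring
      · simp only [mul_sub]
        have bd : ∀ Z : Full 𝒳 → ℝ, Integrable Z (Q : Measure (Full 𝒳)) →
            Integrable (fun ω => u (X (observe ω)) * G 1 0 (observe ω) * Z ω)
              (Q : Measure (Full 𝒳)) := fun Z hZ => by
          refine hZ.bdd_mul (c := 1) (((hu.comp measurable_X).mul
            (measurable_G 1 0)).comp measurable_observe).aestronglyMeasurable
            (ae_of_all _ fun w => ?_)
          refine (norm_mul_le _ _).trans ?_
          exact mul_le_one₀ (hub _) (norm_nonneg _) (abs_G_le 1 0 _)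
        rw [integral_sub (bd _ (h.integrable 1 0)) (bd _ (h.integrable 0 0)),
          integral_sub (i1 u hu hub).1 (i2 u hu hub).1, (i1 u hu hub).2, (i2 u hu hub).2]
    filter_upwards [h1, h2, h.no_anticipation] with x e1 e2 e3
    linarith
  -- Common trends expresses the only unobserved mean, that of Y^0(1) for the treated, by three
  -- means: two are observed in the control cells, the third was identified by no anticipation.
  have f11 : ∀ᵐ x ∂(lawX (obsLaw Q)), fullMean Q (fun ω => ω.1 0 1) 1 1 x
      = mCell (obsLaw Q) 0 1 x - mCell (obsLaw Q) 0 0 x + mCell (obsLaw Q) 1 0 x := by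
    filter_upwards [fullMean_own_cell hc hs hY 0 1 (h.integrable 0 1),
      fullMean_own_cell hc hs hY 0 0 (h.integrable 0 0), f10, h.common_trends] with x e1 e2 e3 e4
    linarith
  have g1 : ∫ ω in cell 1 1, ω.1 1 1 ∂(Q : Measure (Full 𝒳))
      = ∫ w, G 1 1 w * mCell (obsLaw Q) 1 1 (X w) ∂(obsLaw Q : Measure (Obs 𝒳)) := by
    have := (integral_mul_mCell hY 1 1 (u := fun _ => 1) measurable_const
      (integrable_G_mul_Y hY 1 1 measurable_const (by simp))).2
    simp only [one_mul] at this
    rw [this, integral_obsLaw Q (by fun_prop), ← integral_indicator hcell]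
    refine integral_congr_ae (ae_of_all _ fun ω => ?_)
    simp only [G_observe_mul_Y]
    by_cases hω : ω ∈ cell 1 1
    · have : ω.2.1 = 1 ∧ ω.2.2.1 = 1 := hω
      simp [hω, G, D, T, observe, this]
    · have : ¬ (ω.2.1 = 1 ∧ ω.2.2.1 = 1) := hω
      simp [hω, G, D, T, observe, this]
  have g0 : ∫ ω in cell 1 1, ω.1 0 1 ∂(Q : Measure (Full 𝒳))
      = ∫ w, G 1 1 w * (mCell (obsLaw Q) 0 1 (X w) - mCell (obsLaw Q) 0 0 (X w)
        + mCell (obsLaw Q) 1 0 (X w)) ∂(obsLaw Q : Measure (Obs 𝒳)) := by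
    have := (integral_mul_fullMean (h.integrable 0 1) 1 1 (u := fun _ => 1) measurable_const
      (by simp)).2
    simp only [one_mul] at this
    rw [← integral_indicator hcell]
    calc _ = ∫ ω, G 1 1 (observe ω) * ω.1 0 1 ∂(Q : Measure (Full 𝒳)) := by
          refine integral_congr_ae (ae_of_all _ fun ω => ?_)
          by_cases hω : ω ∈ cell 1 1
          · have : ω.2.1 = 1 ∧ ω.2.2.1 = 1 := hω
            simp [hω, G, D, T, observe, this]
          · have : ¬ (ω.2.1 = 1 ∧ ω.2.2.1 = 1) := hω
            simp [hω, G, D, T, observe, this]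
      _ = _ := this.symm
      _ = _ := by
          refine integral_congr_ae ?_
          filter_upwards [ae_lawX_iff _ f11] with w hw
          rw [hw]
  have hq : ((Q : Measure (Full 𝒳)) (cell 1 1)).toReal = pDT (obsLaw Q) := by
    rw [pDT, measureReal_def, obsLaw_coe, Measure.map_apply measurable_observe
      (measurableSet_cell 1 1)]
    rfl
  have ii : ∀ d t, IntegrableOn (fun ω => ω.1 d t) (cell 1 1) (Q : Measure (Full 𝒳)) := fun d t =>
    (h.integrable d t).integrableOn
  rw [atet, ProbabilityTheory.cond, integral_smul_measure, ENNReal.toReal_inv, hq,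
    integral_sub (ii 1 1) (ii 0 1), g1, g0, theta, smul_eq_mul, div_eq_inv_mul, ← integral_sub]
  · congr 2; ext w; rw [mY_eq]; ring
  · exact hm 1 1 1 1
  · have := ((hm 0 1 1 1).sub (hm 0 0 1 1)).add (hm 1 0 1 1)
    refine this.congr (ae_of_all _ fun w => ?_)
    simp only [Pi.sub_apply, Pi.add_apply]; ring

/-- Potential outcomes that are compatible with observed data and with the counterfactual trend
`m` of the treated. -/
def potential (m : 𝒳 → ℝ) (w : Obs 𝒳) (d t : Fin 2) : ℝ :=
  if D w = d ∧ T w = t then Y w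
  else if d = 0 ∧ t = 0 ∧ D w = 1 ∧ T w = 0 then Y w
  else if d = 0 ∧ t = 1 ∧ D w = 1 ∧ T w = 1 then m (X w)
  else 0

/-- Full data that are compatible with observed data. -/
def complete (m : 𝒳 → ℝ) (w : Obs 𝒳) : Full 𝒳 := (potential m w, w.2)

lemma observe_complete (m : 𝒳 → ℝ) (w : Obs 𝒳) : observe (complete m w) = w := by
  have : Y (observe (complete m w)) = Y w := by
    have h := G_observe_mul_Y (D w) (T w) (complete m w)
    have e : G (D w) (T w) (observe (complete m w)) = 1 := by
      simp [G, D, T, observe, complete]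
    rw [e, one_mul, one_mul] at h
    rw [h]
    simp [complete, potential]
  exact Prod.ext this rfl

lemma measurable_potential {m : 𝒳 → ℝ} (hm : Measurable m) (d t : Fin 2) :
    Measurable (fun w => potential m w d t) := by
  have hD : ∀ e : Fin 2, MeasurableSet {w : Obs 𝒳 | D w = e} := fun e =>
    measurable_D (measurableSet_singleton e)
  have hT : ∀ e : Fin 2, MeasurableSet {w : Obs 𝒳 | T w = e} := fun e =>
    measurable_T (measurableSet_singleton e)
  unfold potential
  refine Measurable.ite ((hD d).inter (hT t)) (by fun_prop) (Measurable.ite ?_ (by fun_prop)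
    (Measurable.ite ?_ (hm.comp measurable_X) measurable_const))
  · exact (MeasurableSet.const _).inter ((MeasurableSet.const _).inter ((hD 1).inter (hT 0)))
  · exact (MeasurableSet.const _).inter ((MeasurableSet.const _).inter ((hD 1).inter (hT 1)))

lemma measurable_complete {m : 𝒳 → ℝ} (hm : Measurable m) : Measurable (complete m) := by
  refine Measurable.prodMk ?_ measurable_snd
  exact measurable_pi_lambda _ fun d => measurable_pi_lambda _ fun t => measurable_potential hm d t

/-- The counterfactual mean of the treated under common trends. -/
def counterfactual (P : ProbabilityMeasure (Obs 𝒳)) (x : 𝒳) : ℝ :=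
  mCell P 0 1 x - mCell P 0 0 x + mCell P 1 0 x

@[fun_prop] lemma measurable_counterfactual (P : ProbabilityMeasure (Obs 𝒳)) :
    Measurable (counterfactual P) := by unfold counterfactual; fun_prop

/-- A law of the full data with observed law `P`. -/
def fullLaw (P : ProbabilityMeasure (Obs 𝒳)) : ProbabilityMeasure (Full 𝒳) :=
  P.map (measurable_complete (measurable_counterfactual P)).aemeasurable

lemma fullLaw_coe (P : ProbabilityMeasure (Obs 𝒳)) : (fullLaw P : Measure (Full 𝒳))
    = (P : Measure (Obs 𝒳)).map (complete (counterfactual P)) := rfl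

lemma obsLaw_fullLaw (P : ProbabilityMeasure (Obs 𝒳)) : obsLaw (fullLaw P) = P := by
  apply Subtype.ext
  change (obsLaw (fullLaw P) : Measure (Obs 𝒳)) = P
  rw [obsLaw_coe, fullLaw_coe, Measure.map_map measurable_observe
    (measurable_complete (measurable_counterfactual P))]
  have : (observe ∘ complete (counterfactual P)) = id := by
    ext1 w; exact observe_complete _ w
  rw [this, Measure.map_id]

lemma integral_fullLaw (P : ProbabilityMeasure (Obs 𝒳)) {f : Full 𝒳 → ℝ} (hf : Measurable f) :
    ∫ ω, f ω ∂(fullLaw P : Measure (Full 𝒳))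
      = ∫ w, f (complete (counterfactual P) w) ∂(P : Measure (Obs 𝒳)) := by
  rw [fullLaw_coe, integral_map (measurable_complete (measurable_counterfactual P)).aemeasurable
    hf.aestronglyMeasurable]

/-- Every law of the observed data that satisfies the restrictions of a setting is the observed law
of a law in the model. -/
lemma ObsModel.inModel_fullLaw {s : Setting} {P : ProbabilityMeasure (Obs 𝒳)}
    (h : ObsModel s P) : InModel s (fullLaw P) := by
  obtain ⟨c, hc, hs⟩ := h.common_support
  have hY : Integrable Y (P : Measure (Obs 𝒳)) := h.memLp.integrable (by norm_num)
  have hmem := fun d t => (hs.memLp_mCell hc h.memLp d t).integrable (q := 2) (by norm_num)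
  have hcf : Integrable (fun w => counterfactual P (X w)) (P : Measure (Obs 𝒳)) :=
    ((hmem 0 1).sub (hmem 0 0)).add (hmem 1 0)
  have hint : ∀ d t : Fin 2, Integrable (fun ω => ω.1 d t) (fullLaw P : Measure (Full 𝒳)) := by
    intro d t
    rw [fullLaw_coe, integrable_map_measure (by fun_prop)
      (measurable_complete (measurable_counterfactual P)).aemeasurable]
    refine (hY.norm.add hcf.norm).mono'
      (measurable_potential (measurable_counterfactual P) d t).aestronglyMeasurable
      (ae_of_all _ fun w => ?_)
    simp only [Function.comp, complete, potential, Pi.add_apply]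
    have h1 := norm_nonneg (Y w)
    have h2 := norm_nonneg (counterfactual P (X w))
    split_ifs
    · linarith
    · linarith
    · linarith
    · rw [norm_zero]; linarith
  have hs' : Support (obsLaw (fullLaw P)) c := by rwa [obsLaw_fullLaw]
  have hY' : Integrable Y (obsLaw (fullLaw P) : Measure (Obs 𝒳)) := by rwa [obsLaw_fullLaw]
  have hG : ∀ (d t : Fin 2) (a : 𝒳 → ℝ), Integrable (fun w => a (X w)) (P : Measure (Obs 𝒳)) →
      Integrable (fun w => G d t w * a (X w)) (obsLaw (fullLaw P) : Measure (Obs 𝒳)) := by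
    intro d t a ia
    rw [obsLaw_fullLaw]
    exact ia.bdd_mul (c := 1) (measurable_G d t).aestronglyMeasurable
      (ae_of_all _ fun w => abs_G_le d t w)
  have hmeas : ∀ (d t : Fin 2) (u : 𝒳 → ℝ), Measurable u → ∀ Z : Full 𝒳 → ℝ, Measurable Z →
      Measurable (fun ω : Full 𝒳 => u (X (observe ω)) * G d t (observe ω) * Z ω) := by
    intro d t u hu Z hZ
    exact (((hu.comp measurable_X).mul (measurable_G d t)).comp measurable_observe).mul hZ
  refine ⟨hint, by rw [obsLaw_fullLaw]; exact h.memLp, ⟨c, hc, hs'⟩, ?_, ?_,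
    by rw [obsLaw_fullLaw]; exact h.relation⟩
  -- No anticipation holds pointwise: in the cell (1,0) both Y^1(0) and Y^0(0) were set equal to Y.
  · refine fullMean_ae_eq hc hs' ((hint 1 0).sub (hint 0 0)) 1 0 (a := fun _ => 0)
      measurable_const (by simp) fun u hu _ => ?_
    rw [integral_fullLaw P (hmeas 1 0 u hu _ (by fun_prop))]
    simp only [mul_zero, integral_zero]
    refine integral_eq_zero_of_ae (ae_of_all _ fun w => ?_)
    simp only [observe_complete, Pi.zero_apply]
    by_cases hw : D w = 1 ∧ T w = 0
    · simp [complete, potential, hw]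
    · simp [G, hw]
  · have f10 : ∀ᵐ x ∂(lawX (obsLaw (fullLaw P))),
        fullMean (fullLaw P) (fun ω => ω.1 0 0) 1 0 x = mCell P 1 0 x := by
      refine fullMean_ae_eq hc hs' (hint 0 0) 1 0 (measurable_mCell P 1 0)
        (hG _ _ _ (hmem 1 0)) fun u hu hub => ?_
      rw [integral_fullLaw P (hmeas 1 0 u hu _ (by fun_prop)), obsLaw_fullLaw,
        (integral_mul_mCell hY 1 0 hu (integrable_G_mul_Y hY 1 0 hu hub)).2]
      refine integral_congr_ae (ae_of_all _ fun w => ?_)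
      simp only [observe_complete]
      by_cases hw : D w = 1 ∧ T w = 0
      · simp [complete, potential, hw]
      · simp [G, hw]
    -- In the treated cell Y^0(1) was set equal to the value that common trends prescribes, so that
    -- assumption becomes an identity between cell regressions.
    have f11 : ∀ᵐ x ∂(lawX (obsLaw (fullLaw P))),
        fullMean (fullLaw P) (fun ω => ω.1 0 1) 1 1 x = counterfactual P x := by
      refine fullMean_ae_eq hc hs' (hint 0 1) 1 1 (measurable_counterfactual P)
        (hG _ _ _ hcf) fun u hu hub => ?_
      rw [integral_fullLaw P (hmeas 1 1 u hu _ (by fun_prop)), obsLaw_fullLaw]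
      refine integral_congr_ae (ae_of_all _ fun w => ?_)
      simp only [observe_complete]
      by_cases hw : D w = 1 ∧ T w = 1
      · simp [complete, potential, hw]
      · simp [G, hw]
    filter_upwards [fullMean_own_cell hc hs' hY' 0 1 (hint 0 1),
      fullMean_own_cell hc hs' hY' 0 0 (hint 0 0), f10, f11] with x e1 e2 e3 e4
    rw [e1, e2, e3, e4, obsLaw_fullLaw, counterfactual]
    ring

end ObsModel

end DiD

namespace DiD

/-! ### Norms of bounded multiples and continuity of bounded means along a family. -/

section Bounds
variable {Ω : Type*} [MeasurableSpace Ω] {μ : Measure Ω}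

lemma MemLp.bdd_mul_two {f g : Ω → ℝ} (hf : Measurable f) {M : ℝ} (hM : ∀ x, |f x| ≤ M)
    (hg : MemLp g 2 μ) : MemLp (fun x => f x * g x) 2 μ := by
  refine MemLp.of_le_mul hg (hf.aestronglyMeasurable.mul hg.aestronglyMeasurable) (c := M)
    (ae_of_all _ fun x => ?_)
  simp only [norm_mul]
  exact mul_le_mul_of_nonneg_right (hM x) (norm_nonneg _)

lemma nrm_bdd_mul_le {f g : Ω → ℝ} {M : ℝ} (hM : ∀ x, |f x| ≤ M) (hM0 : 0 ≤ M)
    (hg : MemLp g 2 μ) : nrm μ (fun x => f x * g x) ≤ M * nrm μ g := by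
  have := nrm_mono (f := fun x => f x * g x) (hg.const_mul M) (ae_of_all _ fun x => by
    rw [abs_mul, abs_mul, abs_of_nonneg hM0]
    exact mul_le_mul_of_nonneg_right (hM x) (abs_nonneg _))
  rwa [nrm_const_mul, abs_of_nonneg hM0] at this

lemma nrm_const_le [IsProbabilityMeasure μ] (a : ℝ) : nrm μ (fun _ => a) = |a| := by
  simp [nrm, Real.sqrt_sq_eq_abs]

lemma nrm_le_of_abs_le [IsProbabilityMeasure μ] {f : Ω → ℝ} {M : ℝ} (hM : ∀ x, |f x| ≤ M)
    (hM0 : 0 ≤ M) : nrm μ f ≤ M := by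
  have := nrm_mono (μ := μ) (f := f) (g := fun _ => M) (memLp_const M) (ae_of_all _ fun x => by
    rw [abs_of_nonneg hM0]; exact hM x)
  rwa [nrm_const_le, abs_of_nonneg hM0] at this

end Bounds

section Family
variable {W : Type*} [MeasurableSpace W] {P : ℝ → ProbabilityMeasure W} {S : W → ℝ}
  {ν : Measure W} {r : ℝ → W → ℝ}

lemma RootExpansion.tendsto_integral (h : RootExpansion P S ν r) {φ : W → ℝ} (hm : Measurable φ)
    {M : ℝ} (hM : ∀ x, |φ x| ≤ M) :
    Tendsto (fun β => ∫ w, φ w ∂(P β : Measure W)) (𝓝[≠] 0) (𝓝 (∫ w, φ w ∂(P 0 : Measure W))) := by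
  obtain ⟨C, hC0, hC⟩ := h.exists_bound
  have hM0 : 0 ≤ M := by
    obtain ⟨w⟩ := (P 0).nonempty
    exact (abs_nonneg _).trans (hM w)
  rw [tendsto_iff_norm_sub_tendsto_zero]
  have u : Tendsto (fun β : ℝ => C * |β| * (M + M)) (𝓝[≠] 0) (𝓝 0) := by
    have : Continuous (fun β : ℝ => C * |β| * (M + M)) := by fun_prop
    simpa using (this.tendsto 0).mono_left nhdsWithin_le_nhds
  refine squeeze_zero' (Eventually.of_forall fun _ => norm_nonneg _) ?_ u
  filter_upwards [hC] with β hβ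
  refine (h.abs_sub_le hm (MemLp_of_abs_le hm.aestronglyMeasurable M hM)
    (MemLp_of_abs_le hm.aestronglyMeasurable M hM)).trans ?_
  exact mul_le_mul hβ (add_le_add (nrm_le_of_abs_le hM hM0) (nrm_le_of_abs_le hM hM0))
    (add_nonneg (nrm_nonneg _) (nrm_nonneg _)) (by positivity)

end Family

/-! ### Overlap sets, and convergence of regression functions on them. -/

section Overlap
variable {𝒳 : Type*} [MeasurableSpace 𝒳]

/-- A is the positive set of a Hahn decomposition of 4ν - μ. The factor 4 is the one required by
`RootExpansion.tendsto_div_sq`. -/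
lemma exists_overlap_set (μ ν : Measure 𝒳) [IsFiniteMeasure μ] [IsFiniteMeasure ν] :
    ∃ A, MeasurableSet A ∧ μ.restrict A ≤ (4 : ENNReal) • ν ∧ 4 * ν.real Aᶜ ≤ μ.real Aᶜ := by
  have : IsFiniteMeasure ((4 : ENNReal) • ν) :=
    ⟨by rw [Measure.smul_apply, smul_eq_mul]; exact ENNReal.mul_lt_top (by norm_num) (measure_lt_top _ _)⟩
  obtain ⟨A, hA, h1, h2⟩ := hahn_decomposition ((4 : ENNReal) • ν) μ
  refine ⟨A, hA, Measure.le_iff.2 fun s hs => ?_, ?_⟩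
  · rw [Measure.restrict_apply hs]
    exact (h1 _ (hs.inter hA) Set.inter_subset_right).trans (measure_mono Set.inter_subset_left)
  · have h := h2 Aᶜ hA.compl subset_rfl
    rw [Measure.smul_apply, smul_eq_mul] at h
    have := ENNReal.toReal_mono (measure_ne_top _ _) h
    simpa [measureReal_def] using this

/-- Sets of covariate values on which the covariate law at `0` is dominated by four times the
covariate law at `β`, and off which the reverse inequality holds. -/
structure Overlap (P : ℝ → ProbabilityMeasure (Obs 𝒳)) (A : ℝ → Set 𝒳) : Prop where
  meas : ∀ β, MeasurableSet (A β)
  zero : A 0 = Set.univ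
  le : ∀ β, (lawX (P 0)).restrict (A β) ≤ (4 : ENNReal) • lawX (P β)
  compl : ∀ β, 4 * (lawX (P β)).real (A β)ᶜ ≤ (lawX (P 0)).real (A β)ᶜ

/-- At β = 0 the whole space is chosen, so that truncated functions reduce to the untruncated ones
in the limit. -/
lemma exists_overlap (P : ℝ → ProbabilityMeasure (Obs 𝒳)) : ∃ A, Overlap P A := by
  choose A h1 h2 h3 using fun β => exists_overlap_set (lawX (P 0)) (lawX (P β))
  classical
  refine ⟨fun β => if β = 0 then Set.univ else A β, ?_, by simp, ?_, ?_⟩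
  · intro β; by_cases h : β = 0 <;> simp [h, h1]
  · intro β
    by_cases h : β = 0
    · simp only [h, if_true, Measure.restrict_univ]
      refine Measure.le_iff.2 fun s _ => ?_
      rw [Measure.smul_apply, smul_eq_mul]
      exact le_mul_of_one_le_left zero_le (by norm_num)
    · simpa [h] using h2 β
  · intro β; by_cases h : β = 0
    · simp [h]
    · simpa [h] using h3 β

/-- The indicator of the overlap set as a function of the observation. -/
def ov (A : ℝ → Set 𝒳) (β : ℝ) (x : 𝒳) : ℝ := (A β).indicator (fun _ => 1) x

namespace Overlap
variable {P : ℝ → ProbabilityMeasure (Obs 𝒳)} {A : ℝ → Set 𝒳}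

lemma measurable_ov (h : Overlap P A) (β : ℝ) : Measurable (ov A β) :=
  measurable_const.indicator (h.meas β)

lemma abs_ov_le (A : ℝ → Set 𝒳) (β : ℝ) (x : 𝒳) : |ov A β x| ≤ 1 := by
  unfold ov; by_cases h : x ∈ A β <;> simp [h]

lemma abs_one_sub_ov_le (A : ℝ → Set 𝒳) (β : ℝ) (x : 𝒳) : |1 - ov A β x| ≤ 1 := by
  unfold ov; by_cases h : x ∈ A β <;> simp [h]

lemma ov_mul_self (A : ℝ → Set 𝒳) (β : ℝ) (x : 𝒳) : ov A β x * ov A β x = ov A β x := by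
  unfold ov; by_cases h : x ∈ A β <;> simp [h]

lemma ov_nonneg (A : ℝ → Set 𝒳) (β : ℝ) (x : 𝒳) : 0 ≤ ov A β x := by
  unfold ov; by_cases h : x ∈ A β <;> simp [h]

lemma ov_zero (h : Overlap P A) (x : 𝒳) : ov A 0 x = 1 := by simp [ov, h.zero]

/-- The purpose of the overlap sets: a regression function known to be square-integrable only under
P β becomes so under P 0. The factor 4 between the measures costs 2 in the norm. -/
lemma memLp (h : Overlap P A) {β : ℝ} {u : 𝒳 → ℝ} (hu : Measurable u)
    (hL : MemLp (fun w => u (X w)) 2 (P β : Measure (Obs 𝒳))) :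
    MemLp (fun w => ov A β (X w) * u (X w)) 2 (P 0 : Measure (Obs 𝒳)) ∧
    nrm (P 0 : Measure (Obs 𝒳)) (fun w => ov A β (X w) * u (X w))
      ≤ 2 * nrm (P β : Measure (Obs 𝒳)) (fun w => u (X w)) := by
  have hL' : Integrable (fun x => u x ^ 2) (lawX (P β)) := by
    rw [lawX, integrable_map_measure (by fun_prop) measurable_X.aemeasurable]
    exact hL.integrable_sq
  have h4 : Integrable (fun x => u x ^ 2) ((4 : ENNReal) • lawX (P β)) :=
    hL'.smul_measure (by norm_num)
  have hr : Integrable (fun x => u x ^ 2) ((lawX (P 0)).restrict (A β)) := h4.mono_measure (h.le β)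
  have e : (fun x => (ov A β x * u x) ^ 2) = (A β).indicator (fun x => u x ^ 2) := by
    ext x; unfold ov; by_cases hx : x ∈ A β <;> simp [hx]
  have hm : Measurable (fun x => ov A β x * u x) := (h.measurable_ov β).mul hu
  have hi : Integrable (fun x => (ov A β x * u x) ^ 2) (lawX (P 0)) := by
    rw [e, integrable_indicator_iff (h.meas β)]; exact hr
  have hi' : Integrable (fun w => (ov A β (X w) * u (X w)) ^ 2) (P 0 : Measure (Obs 𝒳)) := by
    rw [lawX, integrable_map_measure (hm.pow_const 2).aestronglyMeasurable
      measurable_X.aemeasurable] at hi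
    exact hi
  refine ⟨memLp_two_of_integrable_sq (hm.comp measurable_X) hi', ?_⟩
  rw [nrm, Real.sqrt_le_left (mul_nonneg two_pos.le (nrm_nonneg _)), mul_pow, nrm_sq,
    ← integral_lawX (P 0) (u := fun x => (ov A β x * u x) ^ 2) (hm.pow_const 2),
    ← integral_lawX (P β) (u := fun x => u x ^ 2) (by fun_prop), e,
    integral_indicator (h.meas β)]
  refine (integral_mono_measure (h.le β) (ae_of_all _ fun x => sq_nonneg _) h4).trans ?_
  rw [integral_smul_measure]
  norm_num

variable {S : Obs 𝒳 → ℝ} {ν : Measure (Obs 𝒳)} {r : ℝ → Obs 𝒳 → ℝ}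

/-- Off the overlap set P 0 has at least four times the mass of P β, so
`RootExpansion.tendsto_div_sq` applies to P 0; the mass under P β is smaller still. -/
lemma tendsto_compl (h : Overlap P A) (hr : RootExpansion P S ν r) :
    Tendsto (fun β => nrm (P 0 : Measure (Obs 𝒳)) (fun w => 1 - ov A β (X w)) / |β|) (𝓝[≠] 0)
      (𝓝 0) ∧
    Tendsto (fun β => nrm (P β : Measure (Obs 𝒳)) (fun w => 1 - ov A β (X w)) / |β|) (𝓝[≠] 0)
      (𝓝 0) := by
  have hB : ∀ β, MeasurableSet (X ⁻¹' (A β)ᶜ : Set (Obs 𝒳)) := fun β =>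
    measurable_X (h.meas β).compl
  have hP : ∀ β β', (lawX (P β')).real (A β)ᶜ = (P β' : Measure (Obs 𝒳)).real (X ⁻¹' (A β)ᶜ) := by
    intro β β'
    rw [measureReal_def, lawX, Measure.map_apply measurable_X (h.meas β).compl, measureReal_def]
  have hn : ∀ β β', nrm (P β' : Measure (Obs 𝒳)) (fun w => 1 - ov A β (X w))
      = √((P β' : Measure (Obs 𝒳)).real (X ⁻¹' (A β)ᶜ)) := by
    intro β β'
    unfold nrm
    congr 1
    rw [← integral_indicator_one (hB β)]
    refine integral_congr_ae (ae_of_all _ fun w => ?_)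
    unfold ov
    by_cases hw : X w ∈ A β <;> simp [hw, Set.indicator]
  have hc : ∀ β, 4 * (P β : Measure (Obs 𝒳)).real (X ⁻¹' (A β)ᶜ)
      ≤ (P 0 : Measure (Obs 𝒳)).real (X ⁻¹' (A β)ᶜ) := fun β => by
    rw [← hP, ← hP]; exact h.compl β
  have lim := hr.tendsto_div_sq hB hc
  have lim2 := (Real.continuous_sqrt.tendsto 0).comp lim
  rw [Real.sqrt_zero] at lim2
  have l0 : Tendsto (fun β => nrm (P 0 : Measure (Obs 𝒳)) (fun w => 1 - ov A β (X w)) / |β|)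
      (𝓝[≠] 0) (𝓝 0) := by
    refine lim2.congr fun β => ?_
    simp only [Function.comp]
    rw [hn, Real.sqrt_div measureReal_nonneg, Real.sqrt_sq_eq_abs]
  refine ⟨l0, squeeze_zero (fun β => div_nonneg (nrm_nonneg _) (abs_nonneg _)) (fun β => ?_) l0⟩
  rw [hn, hn]
  gcongr
  linarith [hc β, measureReal_nonneg (μ := (P β : Measure (Obs 𝒳))) (s := X ⁻¹' (A β)ᶜ)]

lemma tendsto_nrm_compl (h : Overlap P A) (hr : RootExpansion P S ν r) :
    Tendsto (fun β => nrm (P 0 : Measure (Obs 𝒳)) (fun w => 1 - ov A β (X w))) (𝓝[≠] 0)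
      (𝓝 0) := by
  have h1 : Tendsto (fun β : ℝ => |β|) (𝓝[≠] 0) (𝓝 0) := by
    have : Continuous (fun β : ℝ => |β|) := by fun_prop
    simpa using (this.tendsto 0).mono_left nhdsWithin_le_nhds
  have := (h.tendsto_compl hr).1.mul h1
  rw [zero_mul] at this
  refine this.congr' ?_
  filter_upwards [self_mem_nhdsWithin] with β hβ
  have : |β| ≠ 0 := abs_ne_zero.2 hβ
  field_simp

/-- Regression functions along the family converge in `L¹` on the overlap sets. -/
lemma tendsto_regression (h : Overlap P A) (hr : RootExpansion P S ν r) {χ Z : Obs 𝒳 → ℝ}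
    (hχ : Measurable χ) (hχ1 : ∀ w, |χ w| ≤ 1) (hZ : Measurable Z) {K : ℝ} {ρ : ℝ → 𝒳 → ℝ}
    (hρ : ∀ β, Measurable (ρ β))
    (hZβ : ∀ᶠ β in 𝓝[≠] (0 : ℝ), MemLp Z 2 (P β : Measure (Obs 𝒳)) ∧
      nrm (P β : Measure (Obs 𝒳)) Z ≤ K)
    (hZ0 : MemLp Z 2 (P 0 : Measure (Obs 𝒳)))
    (hρβ : ∀ᶠ β in 𝓝[≠] (0 : ℝ), MemLp (fun w => ρ β (X w)) 2 (P β : Measure (Obs 𝒳)) ∧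
      nrm (P β : Measure (Obs 𝒳)) (fun w => ρ β (X w)) ≤ K)
    (hρ0 : MemLp (fun w => ρ 0 (X w)) 2 (P 0 : Measure (Obs 𝒳)))
    (heβ : ∀ᶠ β in 𝓝[≠] (0 : ℝ), ∀ u : 𝒳 → ℝ, Measurable u → (∀ x, |u x| ≤ 1) →
      ∫ w, u (X w) * χ w * Z w ∂(P β : Measure (Obs 𝒳))
        = ∫ w, u (X w) * χ w * ρ β (X w) ∂(P β : Measure (Obs 𝒳)))
    (he0 : ∀ u : 𝒳 → ℝ, Measurable u → (∀ x, |u x| ≤ 1) →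
      ∫ w, u (X w) * χ w * Z w ∂(P 0 : Measure (Obs 𝒳))
        = ∫ w, u (X w) * χ w * ρ 0 (X w) ∂(P 0 : Measure (Obs 𝒳)))
    {c : ℝ} (hc : 0 < c)
    (hχc : ∀ u : 𝒳 → ℝ, Measurable u → (∀ x, 0 ≤ u x) →
      Integrable (fun w => χ w * u (X w)) (P 0 : Measure (Obs 𝒳)) →
      c * ∫ w, u (X w) ∂(P 0 : Measure (Obs 𝒳)) ≤ ∫ w, χ w * u (X w) ∂(P 0 : Measure (Obs 𝒳))) :
    Tendsto (fun β => ∫ w, |ov A β (X w) * (ρ β (X w) - ρ 0 (X w))| ∂(P 0 : Measure (Obs 𝒳)))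
      (𝓝[≠] 0) (𝓝 0) := by
  obtain ⟨C, hC0, hC⟩ := hr.exists_bound
  set K0 := nrm (P 0 : Measure (Obs 𝒳)) Z
  have lim : Tendsto (fun β : ℝ => c⁻¹ * (C * |β| * (K + 2 * K) + C * |β| * (K + K0))) (𝓝[≠] 0)
      (𝓝 0) := by
    have : Continuous (fun β : ℝ => c⁻¹ * (C * |β| * (K + 2 * K) + C * |β| * (K + K0))) := by
      fun_prop
    simpa using (this.tendsto 0).mono_left nhdsWithin_le_nhds
  refine squeeze_zero' (Eventually.of_forall fun _ => integral_nonneg fun _ => abs_nonneg _) ?_ lim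
  filter_upwards [hC, hZβ, hρβ, heβ] with β bC bZ bρ be
  -- Testing against the sign of the difference turns its L¹ norm on the overlap set into a linear
  -- expression, to which the moment equations apply.
  set u : 𝒳 → ℝ := fun x => ov A β x * (if 0 ≤ ρ β x - ρ 0 x then 1 else -1) with hu
  have hum : Measurable u := by
    refine (h.measurable_ov β).mul (Measurable.ite ?_ measurable_const measurable_const)
    exact measurableSet_le measurable_const ((hρ β).sub (hρ 0))
  have hub : ∀ x, |u x| ≤ 1 := by
    intro x
    simp only [hu, abs_mul]
    refine mul_le_one₀ (abs_ov_le A β x) (abs_nonneg _) ?_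
    split_ifs <;> simp
  have habs : ∀ x, |ov A β x * (ρ β x - ρ 0 x)| = u x * (ρ β x - ρ 0 x) := by
    intro x
    rw [abs_mul, abs_of_nonneg (ov_nonneg A β x), hu]
    simp only
    split_ifs with hx
    · rw [abs_of_nonneg hx]; ring
    · rw [abs_of_neg (not_le.1 hx)]; ring
  have huov : ∀ x, u x * ov A β x = u x := fun x => by
    simp only [hu]
    rw [mul_right_comm, ov_mul_self]
  have huX : Measurable (fun w : Obs 𝒳 => u (X w) * χ w) := (hum.comp measurable_X).mul hχ
  have huχ : ∀ w : Obs 𝒳, |u (X w) * χ w| ≤ 1 := fun w => by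
    rw [abs_mul]; exact mul_le_one₀ (hub _) (abs_nonneg _) (hχ1 w)
  -- square-integrability of the pieces
  have q1 := MemLp.bdd_mul_two huX huχ bρ.1
  obtain ⟨o1, o2⟩ := h.memLp (hρ β) bρ.1
  have q2 := MemLp.bdd_mul_two huX huχ o1
  have e2 : (fun w => u (X w) * χ w * (ov A β (X w) * ρ β (X w)))
      = fun w => u (X w) * χ w * ρ β (X w) := by
    ext w; rw [← huov (X w)]; linear_combination (u (X w) * χ w * ρ β (X w)) * ov_mul_self A β (X w)
  have n2 := nrm_bdd_mul_le huχ zero_le_one o1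
  rw [e2] at q2 n2
  have q3 := MemLp.bdd_mul_two huX huχ bZ.1
  have q4 := MemLp.bdd_mul_two huX huχ hZ0
  have q5 := MemLp.bdd_mul_two huX huχ hρ0
  -- The P 0-mean of uχ(ρ_β - ρ_0) is the P 0-mean of uχρ_β minus that of uχZ. Each of these two
  -- means is O(β) away from its analogue under P β, and the two analogues coincide.
  have a1 := hr.abs_sub_le (huX.mul ((hρ β).comp measurable_X)) q1 q2
  have a2 := hr.abs_sub_le (huX.mul hZ) q3 q4
  have ηnn := nrm_nonneg (μ := ν) (fun w => r β w - r 0 w)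
  have b1 : nrm ν (fun w => r β w - r 0 w) *
      (nrm (P β : Measure (Obs 𝒳)) (fun w => u (X w) * χ w * ρ β (X w))
        + nrm (P 0 : Measure (Obs 𝒳)) (fun w => u (X w) * χ w * ρ β (X w)))
      ≤ C * |β| * (K + 2 * K) := by
    refine mul_le_mul bC (add_le_add ?_ ?_) (add_nonneg (nrm_nonneg _) (nrm_nonneg _))
      (by positivity)
    · exact (nrm_bdd_mul_le huχ zero_le_one bρ.1).trans (by rw [one_mul]; exact bρ.2)
    · refine n2.trans ?_
      rw [one_mul]
      exact o2.trans (mul_le_mul_of_nonneg_left bρ.2 two_pos.le)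
  have b2 : nrm ν (fun w => r β w - r 0 w) *
      (nrm (P β : Measure (Obs 𝒳)) (fun w => u (X w) * χ w * Z w)
        + nrm (P 0 : Measure (Obs 𝒳)) (fun w => u (X w) * χ w * Z w))
      ≤ C * |β| * (K + K0) := by
    refine mul_le_mul bC (add_le_add ?_ ?_) (add_nonneg (nrm_nonneg _) (nrm_nonneg _))
      (by positivity)
    · exact (nrm_bdd_mul_le huχ zero_le_one bZ.1).trans (by rw [one_mul]; exact bZ.2)
    · exact (nrm_bdd_mul_le huχ zero_le_one hZ0).trans (by rw [one_mul])
  have hmain : ∫ w, χ w * (u (X w) * (ρ β (X w) - ρ 0 (X w))) ∂(P 0 : Measure (Obs 𝒳))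
      = ∫ w, u (X w) * χ w * ρ β (X w) ∂(P 0 : Measure (Obs 𝒳))
        - ∫ w, u (X w) * χ w * ρ 0 (X w) ∂(P 0 : Measure (Obs 𝒳)) := by
    rw [← integral_sub (q2.integrable (by norm_num)) (q5.integrable (by norm_num))]
    congr 1; ext w; ring
  have hint : Integrable (fun w => χ w * (u (X w) * (ρ β (X w) - ρ 0 (X w))))
      (P 0 : Measure (Obs 𝒳)) := by
    refine ((q2.integrable (by norm_num)).sub (q5.integrable (by norm_num))).congr
      (ae_of_all _ fun w => ?_)
    simp only [Pi.sub_apply]; ring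
  have hfin := hχc (fun x => u x * (ρ β x - ρ 0 x)) (hum.mul ((hρ β).sub (hρ 0)))
    (fun x => by rw [← habs]; exact abs_nonneg _) hint
  rw [hmain, ← he0 u hum hub] at hfin
  have hβ := be u hum hub
  rw [le_inv_mul_iff₀ hc]
  simp only [habs]
  refine hfin.trans ?_
  have c1 := abs_le.1 (a1.trans b1)
  have c2 := abs_le.1 (a2.trans b2)
  simp only [Pi.mul_apply] at c1 c2
  change _ ≤ ∫ w, u (X w) * χ w * ρ β (X w) ∂(P β : Measure (Obs 𝒳))
    - ∫ w, u (X w) * χ w * ρ β (X w) ∂(P 0 : Measure (Obs 𝒳)) ∧ _ at c1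
  change _ ≤ ∫ w, u (X w) * χ w * Z w ∂(P β : Measure (Obs 𝒳))
    - ∫ w, u (X w) * χ w * Z w ∂(P 0 : Measure (Obs 𝒳)) ∧
    ∫ w, u (X w) * χ w * Z w ∂(P β : Measure (Obs 𝒳))
    - ∫ w, u (X w) * χ w * Z w ∂(P 0 : Measure (Obs 𝒳)) ≤ _ at c2
  linarith [c1.1, c2.2]

end Overlap

end Overlap

end DiD

namespace DiD

/-! ### Regular families and the expansion of the residual part. -/

section Gradient
variable {𝒳 : Type*} [MeasurableSpace 𝒳]

/-- A family of observed laws with an expansion of the root densities and with uniform control of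
the support constant and of the second moments near `0`. -/
structure RegularFamily (P : ℝ → ProbabilityMeasure (Obs 𝒳)) (S : Obs 𝒳 → ℝ) (ν : Measure (Obs 𝒳))
    (r : ℝ → Obs 𝒳 → ℝ) (c K : ℝ) : Prop where
  root : RootExpansion P S ν r
  c_pos : 0 < c
  memLp : ∀ β, MemLp Y 2 (P β : Measure (Obs 𝒳))
  support : ∀ᶠ β in 𝓝[≠] (0 : ℝ), Support (P β) c
  support_zero : Support (P 0) c
  bound : ∀ᶠ β in 𝓝[≠] (0 : ℝ), nrm (P β : Measure (Obs 𝒳)) Y ≤ K ∧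
    ∀ d t, nrm (P β : Measure (Obs 𝒳)) (fun w => mCell (P β) d t (X w)) ≤ K

lemma RootExpansion.regularFamily {P : ℝ → ProbabilityMeasure (Obs 𝒳)} {S : Obs 𝒳 → ℝ}
    {ν : Measure (Obs 𝒳)} {r : ℝ → Obs 𝒳 → ℝ} (h : RootExpansion P S ν r) {c C : ℝ} (hc : 0 < c)
    (hY : ∀ β, MemLp Y 2 (P β : Measure (Obs 𝒳))) (hs : ∀ᶠ β in 𝓝 (0 : ℝ), Support (P β) c)
    (hC : ∀ᶠ β in 𝓝 (0 : ℝ), ∫ w, Y w ^ 2 ∂(P β : Measure (Obs 𝒳)) ≤ C) :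
    ∃ K, RegularFamily P S ν r c K := by
  refine ⟨max √C √(c⁻¹ * C), h, hc, hY, hs.filter_mono nhdsWithin_le_nhds, hs.self_of_nhds, ?_⟩
  filter_upwards [hs.filter_mono nhdsWithin_le_nhds, hC.filter_mono nhdsWithin_le_nhds] with β b1 b2
  refine ⟨(Real.sqrt_le_sqrt b2).trans (le_max_left _ _), fun d t =>
    (Real.sqrt_le_sqrt ?_).trans (le_max_right _ _)⟩
  exact (b1.integral_mCell_sq_le hc (hY β) d t).trans
    (mul_le_mul_of_nonneg_left b2 (inv_nonneg.2 hc.le))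

/-- `(-1)^(d+t)`. -/
def sgn (d t : Fin 2) : ℝ := (-1 : ℝ) ^ ((d : ℕ) + (t : ℕ))

lemma mY_eq_sum (P : ProbabilityMeasure (Obs 𝒳)) (x : 𝒳) :
    mY P x = ∑ d : Fin 2, ∑ t : Fin 2, sgn d t * mCell P d t x := rfl

lemma integral_mul_G_residual {P : ProbabilityMeasure (Obs 𝒳)}
    (hY : MemLp Y 2 (P : Measure (Obs 𝒳))) (d t : Fin 2) {u : 𝒳 → ℝ} (hu : Measurable u) {M : ℝ}
    (hM : ∀ x, |u x| ≤ M) :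
    Integrable (fun w => u (X w) * G d t w * Y w) (P : Measure (Obs 𝒳)) ∧
    Integrable (fun w => u (X w) * G d t w * mCell P d t (X w)) (P : Measure (Obs 𝒳)) ∧
    ∫ w, u (X w) * G d t w * (Y w - mCell P d t (X w)) ∂(P : Measure (Obs 𝒳)) = 0 := by
  have hYi : Integrable Y (P : Measure (Obs 𝒳)) := hY.integrable (by norm_num)
  have i1 : Integrable (fun w => u (X w) * G d t w * Y w) (P : Measure (Obs 𝒳)) := by
    refine hYi.bdd_mul (c := M) ((hu.comp measurable_X).mul (measurable_G d t)).aestronglyMeasurable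
      (ae_of_all _ fun w => ?_)
    rw [norm_mul]
    exact (mul_le_of_le_one_right (norm_nonneg _) (abs_G_le d t w)).trans (hM _)
  obtain ⟨i2, e⟩ := integral_mul_mCell hYi d t hu i1
  refine ⟨i1, i2, ?_⟩
  simp only [mul_sub]
  rw [integral_sub i1 i2, e, sub_self]

namespace RegularFamily
variable {P : ℝ → ProbabilityMeasure (Obs 𝒳)} {S : Obs 𝒳 → ℝ} {ν : Measure (Obs 𝒳)}
  {r : ℝ → Obs 𝒳 → ℝ} {c K : ℝ} {A : ℝ → Set 𝒳}

lemma memLp_mCell (h : RegularFamily P S ν r c K) : ∀ᶠ β in 𝓝[≠] (0 : ℝ), ∀ d t,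
    MemLp (fun w => mCell (P β) d t (X w)) 2 (P β : Measure (Obs 𝒳)) := by
  filter_upwards [h.support] with β hβ d t using hβ.memLp_mCell h.c_pos (h.memLp β) d t

lemma memLp_mCell_zero (h : RegularFamily P S ν r c K) (d t : Fin 2) :
    MemLp (fun w => mCell (P 0) d t (X w)) 2 (P 0 : Measure (Obs 𝒳)) :=
  h.support_zero.memLp_mCell h.c_pos (h.memLp 0) d t

/-- The cell indicator plays the role of χ in `Overlap.tendsto_regression`; common support at P 0
supplies the lower bound that removes it. -/
lemma tendsto_mCell (h : RegularFamily P S ν r c K) (hA : Overlap P A) (d t : Fin 2) :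
    Tendsto (fun β => ∫ w, |ov A β (X w) * (mCell (P β) d t (X w) - mCell (P 0) d t (X w))|
      ∂(P 0 : Measure (Obs 𝒳))) (𝓝[≠] 0) (𝓝 0) := by
  have he : ∀ β, ∀ u : 𝒳 → ℝ, Measurable u → (∀ x, |u x| ≤ 1) →
      ∫ w, u (X w) * G d t w * Y w ∂(P β : Measure (Obs 𝒳))
        = ∫ w, u (X w) * G d t w * mCell (P β) d t (X w) ∂(P β : Measure (Obs 𝒳)) := by
    intro β u hu hub
    obtain ⟨i1, i2, e⟩ := integral_mul_G_residual (h.memLp β) d t hu hub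
    simp only [mul_sub] at e
    rw [integral_sub i1 i2] at e
    linarith
  refine hA.tendsto_regression h.root (measurable_G d t) (abs_G_le d t) measurable_Y
    (K := K) (ρ := fun β => mCell (P β) d t) (fun β => measurable_mCell _ d t) ?_ (h.memLp 0) ?_
    (h.memLp_mCell_zero d t) (Eventually.of_forall he) (he 0) h.c_pos ?_
  · filter_upwards [h.bound] with β hβ using ⟨h.memLp β, hβ.1⟩
  · filter_upwards [h.bound, h.memLp_mCell] with β hβ h2 using ⟨h2 d t, hβ.2 d t⟩
  · exact fun u hu hu0 iu => h.support_zero.integral_le h.c_pos d t hu hu0 iu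

/-- The weight of the residual in cell `(d,t)`: a bounded version of `p_{1,1}/p_{d,t}`. -/
def ratio (P : ProbabilityMeasure (Obs 𝒳)) (c : ℝ) (d t : Fin 2) (x : 𝒳) : ℝ :=
  pDTx P 1 1 x / max (pDTx P d t x) c

lemma measurable_ratio (P : ProbabilityMeasure (Obs 𝒳)) (c : ℝ) (d t : Fin 2) :
    Measurable (ratio P c d t) := by unfold ratio; fun_prop

lemma abs_ratio_le (P : ProbabilityMeasure (Obs 𝒳)) {c : ℝ} (hc : 0 < c) (d t : Fin 2) (x : 𝒳) :
    |ratio P c d t x| ≤ c⁻¹ := by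
  have h1 : 0 ≤ pDTx P 1 1 x := condProb_nonneg _ _
  have h2 : pDTx P 1 1 x ≤ 1 := condProb_le_one _ _
  have h3 : 0 < max (pDTx P d t x) c := lt_max_of_lt_right hc
  rw [ratio, abs_of_nonneg (div_nonneg h1 h3.le), ← one_div]
  exact div_le_div₀ zero_le_one h2 hc (le_max_right _ _)

/-- Means of weighted cell indicators. -/
lemma integral_ratio_mul {P : ProbabilityMeasure (Obs 𝒳)} {c : ℝ} (hc : 0 < c) (hs : Support P c)
    (d t : Fin 2) {u : 𝒳 → ℝ} (hu : Measurable u)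
    (iu : Integrable (fun w => u (X w)) (P : Measure (Obs 𝒳))) :
    ∫ w, ratio P c d t (X w) * G d t w * u (X w) ∂(P : Measure (Obs 𝒳))
      = ∫ w, G 1 1 w * u (X w) ∂(P : Measure (Obs 𝒳)) := by
  have hm : Measurable (fun x => ratio P c d t x * u x) := (measurable_ratio P c d t).mul hu
  have i1 : Integrable (fun w => ratio P c d t (X w) * u (X w)) (P : Measure (Obs 𝒳)) :=
    iu.bdd_mul (c := c⁻¹) ((measurable_ratio P c d t).comp measurable_X).aestronglyMeasurable
      (ae_of_all _ fun w => abs_ratio_le P hc d t _)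
  have e1 := integral_mul_pDTx (P := P) d t hm i1
  have e2 := integral_mul_pDTx (P := P) 1 1 hu iu
  calc _ = ∫ w, ratio P c d t (X w) * u (X w) * G d t w ∂(P : Measure (Obs 𝒳)) := by
        congr 1; ext w; ring
    _ = ∫ w, u (X w) * pDTx P 1 1 (X w) ∂(P : Measure (Obs 𝒳)) := by
        rw [← e1]
        refine integral_congr_ae ?_
        -- The floor c in `ratio` only serves to bound the weight everywhere; common support makes
        -- it inactive almost surely, and the propensity score of the cell cancels.
        filter_upwards [ae_lawX_iff P (hs d t)] with w hw
        have : pDTx P d t (X w) ≠ 0 := (hc.trans_le hw).ne'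
        rw [ratio, max_eq_left hw]
        field_simp
    _ = _ := by rw [e2]; congr 1; ext w; ring

lemma tendsto_integral_abs_compl_mul (h : RegularFamily P S ν r c K) (hA : Overlap P A)
    {f : Obs 𝒳 → ℝ} (hf : MemLp f 2 (P 0 : Measure (Obs 𝒳))) :
    Tendsto (fun β => ∫ w, |(1 - ov A β (X w)) * f w| ∂(P 0 : Measure (Obs 𝒳)))
      (𝓝[≠] 0) (𝓝 0) := by
  have l := (hA.tendsto_nrm_compl h.root).mul_const (nrm (P 0 : Measure (Obs 𝒳)) f)
  rw [zero_mul] at l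
  refine squeeze_zero (fun β => integral_nonneg fun _ => abs_nonneg _) (fun β => ?_) l
  have hm : MemLp (fun w => 1 - ov A β (X w)) 2 (P 0 : Measure (Obs 𝒳)) :=
    MemLp_of_abs_le (measurable_const.sub ((hA.measurable_ov β).comp
      measurable_X)).aestronglyMeasurable 1 (fun w => Overlap.abs_one_sub_ov_le A β (X w))
  exact integral_abs_mul_le hm hf

/-- The residual part of the expansion of the doubly robust moment. -/
lemma tendsto_residual (h : RegularFamily P S ν r c K) (hA : Overlap P A) (d t : Fin 2) :
    Tendsto (fun β => (∫ w, ov A β (X w) * (G 1 1 w * (mCell (P β) d t (X w)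
        - mCell (P 0) d t (X w))) ∂(P 0 : Measure (Obs 𝒳))) / β) (𝓝[≠] 0)
      (𝓝 (∫ w, ratio (P 0) c d t (X w) * G d t w * (Y w - mCell (P 0) d t (X w)) * S w
        ∂(P 0 : Measure (Obs 𝒳)))) := by
  set R := ratio (P 0) c d t with hR
  have hRm : Measurable R := measurable_ratio _ _ _ _
  have hc0 : 0 < c⁻¹ := inv_pos.2 h.c_pos
  have hRb : ∀ x, |R x| ≤ c⁻¹ := abs_ratio_le _ h.c_pos d t
  have hgm : ∀ β, Measurable (fun w : Obs 𝒳 => ov A β (X w) * R (X w) * G d t w) := fun β =>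
    (((hA.measurable_ov β).comp measurable_X).mul (hRm.comp measurable_X)).mul (measurable_G d t)
  have hgb : ∀ β (w : Obs 𝒳), |ov A β (X w) * R (X w) * G d t w| ≤ c⁻¹ := fun β w => by
    rw [abs_mul, abs_mul]
    calc _ ≤ 1 * c⁻¹ * 1 := by
          gcongr
          · exact Overlap.abs_ov_le A β _
          · exact hRb _
          · exact abs_G_le d t w
      _ = _ := by ring
  -- The weight is frozen at P 0 while the regression moves. The residual has mean zero under P β,
  -- and under P 0 its mean is minus the drift of the regression on the treated cell. The quotient
  -- sought is therefore the slope of the means of φ.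
  set φ : ℝ → Obs 𝒳 → ℝ := fun β w =>
    ov A β (X w) * R (X w) * G d t w * (Y w - mCell (P β) d t (X w)) with hφ
  have hφm : ∀ β, Measurable (φ β) := fun β => (hgm β).mul (by fun_prop)
  have φ0 : ∀ w, φ 0 w = R (X w) * G d t w * (Y w - mCell (P 0) d t (X w)) := fun w => by
    simp [hφ, hA.ov_zero]
  have hφ0 : MemLp (φ 0) 2 (P 0 : Measure (Obs 𝒳)) :=
    MemLp.bdd_mul_two (hgm 0) (hgb 0) ((h.memLp 0).sub (h.memLp_mCell_zero d t))
  have e0 : ∀ β, MemLp (fun w => mCell (P β) d t (X w)) 2 (P β : Measure (Obs 𝒳)) →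
      (MemLp (φ β) 2 (P 0 : Measure (Obs 𝒳)) ∧ nrm (P 0 : Measure (Obs 𝒳)) (φ β)
        ≤ c⁻¹ * (nrm (P 0 : Measure (Obs 𝒳)) Y
          + 2 * nrm (P β : Measure (Obs 𝒳)) (fun w => mCell (P β) d t (X w)))) := by
    intro β hm
    obtain ⟨o1, o2⟩ := hA.memLp (measurable_mCell (P β) d t) hm
    have hd : MemLp (fun w => Y w - ov A β (X w) * mCell (P β) d t (X w)) 2
        (P 0 : Measure (Obs 𝒳)) := (h.memLp 0).sub o1
    -- As an indicator, `ov` equals its square; the second copy truncates the regression at β, which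
    -- is what brings it into L² of P 0.
    have e : φ β = fun w => ov A β (X w) * R (X w) * G d t w *
        (Y w - ov A β (X w) * mCell (P β) d t (X w)) := by
      ext w
      simp only [hφ]
      linear_combination (R (X w) * G d t w * mCell (P β) d t (X w)) * Overlap.ov_mul_self A β (X w)
    rw [e]
    refine ⟨MemLp.bdd_mul_two (hgm β) (hgb β) hd, (nrm_bdd_mul_le (hgb β) hc0.le hd).trans ?_⟩
    refine mul_le_mul_of_nonneg_left ((nrm_sub_le (h.memLp 0) o1).trans ?_) hc0.le
    exact add_le_add le_rfl o2
  have lim := h.root.tendsto_slope (φ := φ)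
    (K := c⁻¹ * (K + nrm (P 0 : Measure (Obs 𝒳)) Y + 2 * K)) hφm ?_ ?_ hφ0 ?_
  · have : ∫ w, R (X w) * G d t w * (Y w - mCell (P 0) d t (X w)) * S w ∂(P 0 : Measure (Obs 𝒳))
        = ∫ w, φ 0 w * S w ∂(P 0 : Measure (Obs 𝒳)) := by simp only [φ0]
    rw [this]
    refine lim.congr' ?_
    filter_upwards [h.memLp_mCell] with β hβ
    have hb1 : ∀ x, |ov A β x * R x| ≤ c⁻¹ := fun x => by
      rw [abs_mul]
      exact (mul_le_of_le_one_left (abs_nonneg _) (Overlap.abs_ov_le A β x)).trans (hRb x)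
    have z1 := (integral_mul_G_residual (h.memLp β) d t
      (u := fun x => ov A β x * R x) ((hA.measurable_ov β).mul hRm) hb1).2.2
    have z2 := (integral_mul_G_residual (h.memLp 0) d t
      (u := fun x => ov A β x * R x) ((hA.measurable_ov β).mul hRm) hb1)
    obtain ⟨o1, -⟩ := hA.memLp (measurable_mCell (P β) d t) (hβ d t)
    have o3 : MemLp (fun w => ov A β (X w) * mCell (P 0) d t (X w)) 2 (P 0 : Measure (Obs 𝒳)) :=
      MemLp.bdd_mul_two ((hA.measurable_ov β).comp measurable_X)
        (fun w => Overlap.abs_ov_le A β (X w)) (h.memLp_mCell_zero d t)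
    have od : Integrable (fun w => ov A β (X w) * (mCell (P 0) d t (X w) - mCell (P β) d t (X w)))
        (P 0 : Measure (Obs 𝒳)) := by
      refine ((o3.sub o1).integrable (by norm_num)).congr (ae_of_all _ fun w => ?_)
      simp only [Pi.sub_apply]; ring
    have z3 := integral_ratio_mul h.c_pos h.support_zero d t
      (u := fun x => ov A β x * (mCell (P 0) d t x - mCell (P β) d t x))
      ((hA.measurable_ov β).mul (by fun_prop)) od
    have z4 : ∫ w, φ β w ∂(P 0 : Measure (Obs 𝒳))
        = ∫ w, G 1 1 w * (ov A β (X w) * (mCell (P 0) d t (X w) - mCell (P β) d t (X w)))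
          ∂(P 0 : Measure (Obs 𝒳)) := by
      rw [← z3]
      have ia : Integrable (fun w => ov A β (X w) * R (X w) * G d t w *
          (Y w - mCell (P 0) d t (X w))) (P 0 : Measure (Obs 𝒳)) := by
        refine (z2.1.sub z2.2.1).congr (ae_of_all _ fun w => ?_)
        simp only [Pi.sub_apply]; ring
      have ib : Integrable (fun w => R (X w) * G d t w *
          (ov A β (X w) * (mCell (P 0) d t (X w) - mCell (P β) d t (X w))))
          (P 0 : Measure (Obs 𝒳)) := by
        refine od.bdd_mul (c := c⁻¹) ((hRm.comp measurable_X).mul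
          (measurable_G d t)).aestronglyMeasurable (ae_of_all _ fun w => ?_)
        rw [norm_mul]
        exact (mul_le_of_le_one_right (norm_nonneg _) (abs_G_le d t w)).trans (hRb _)
      calc _ = ∫ w, (ov A β (X w) * R (X w) * G d t w * (Y w - mCell (P 0) d t (X w))
            + R (X w) * G d t w *
              (ov A β (X w) * (mCell (P 0) d t (X w) - mCell (P β) d t (X w))))
            ∂(P 0 : Measure (Obs 𝒳)) := by
            congr 1; ext w; simp only [hφ]; ring
        _ = _ := by rw [integral_add ia ib, z2.2.2, zero_add]
    have z5 : ∫ w, φ β w ∂(P β : Measure (Obs 𝒳)) = 0 := z1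
    rw [z5, z4, zero_sub, ← integral_neg]
    congr 2; ext w; ring
  · filter_upwards [h.memLp_mCell, h.bound] with β hβ hb
    have hd := (h.memLp β).sub (hβ d t)
    refine ⟨MemLp.bdd_mul_two (hgm β) (hgb β) hd, (nrm_bdd_mul_le (hgb β) hc0.le hd).trans ?_⟩
    refine mul_le_mul_of_nonneg_left ((nrm_sub_le (h.memLp β) (hβ d t)).trans ?_) hc0.le
    have := hb.2 d t
    have := nrm_nonneg (μ := (P 0 : Measure (Obs 𝒳))) Y
    have := (nrm_nonneg _).trans hb.1
    linarith [hb.1]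
  · filter_upwards [h.memLp_mCell, h.bound] with β hβ hb
    obtain ⟨m1, m2⟩ := e0 β (hβ d t)
    refine ⟨m1, m2.trans (mul_le_mul_of_nonneg_left ?_ hc0.le)⟩
    have := hb.2 d t
    have := (nrm_nonneg _).trans hb.1
    linarith
  · have l1 := h.tendsto_integral_abs_compl_mul hA hφ0
    have l2 := (h.tendsto_mCell hA d t).const_mul c⁻¹
    have l3 := l1.add l2
    rw [mul_zero, add_zero] at l3
    refine squeeze_zero' (Eventually.of_forall fun β => integral_nonneg fun _ => abs_nonneg _) ?_ l3
    filter_upwards [h.memLp_mCell] with β hβ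
    obtain ⟨o1, -⟩ := hA.memLp (measurable_mCell (P β) d t) (hβ d t)
    have o3 : MemLp (fun w => ov A β (X w) * mCell (P 0) d t (X w)) 2 (P 0 : Measure (Obs 𝒳)) :=
      MemLp.bdd_mul_two ((hA.measurable_ov β).comp measurable_X)
        (fun w => Overlap.abs_ov_le A β (X w)) (h.memLp_mCell_zero d t)
    have od : Integrable (fun w => ov A β (X w) * (mCell (P β) d t (X w) - mCell (P 0) d t (X w)))
        (P 0 : Measure (Obs 𝒳)) := by
      refine ((o1.sub o3).integrable (by norm_num)).congr (ae_of_all _ fun w => ?_)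
      simp only [Pi.sub_apply]; ring
    have oc : Integrable (fun w => (1 - ov A β (X w)) * φ 0 w) (P 0 : Measure (Obs 𝒳)) :=
      (MemLp.bdd_mul_two (measurable_const.sub ((hA.measurable_ov β).comp measurable_X))
        (fun w => Overlap.abs_one_sub_ov_le A β (X w)) hφ0).integrable (by norm_num)
    rw [← integral_const_mul, ← integral_add oc.abs (od.abs.const_mul _)]
    refine integral_mono (((e0 β (hβ d t)).1.sub hφ0).integrable (by norm_num)).abs
      (oc.abs.add (od.abs.const_mul _)) fun w => ?_
    -- The first term is small because the complement of the overlap set is, the second because the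
    -- regressions converge in L¹ on the overlap set.
    have e : φ β w - φ 0 w = -((1 - ov A β (X w)) * φ 0 w) - (R (X w) * G d t w) *
        (ov A β (X w) * (mCell (P β) d t (X w) - mCell (P 0) d t (X w))) := by
      rw [φ0]; simp only [hφ]; ring
    simp only
    rw [e]
    refine (abs_sub _ _).trans ?_
    rw [abs_neg]
    refine add_le_add le_rfl ?_
    rw [abs_mul (R (X w) * G d t w)]
    refine mul_le_mul_of_nonneg_right ?_ (abs_nonneg _)
    rw [abs_mul]
    exact (mul_le_of_le_one_right (abs_nonneg _) (abs_G_le d t w)).trans (hRb _)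

end RegularFamily
end Gradient
end DiD

namespace DiD

/-! ### Adjustment weights and differentiability of the ATET functional. -/

section Gradient
variable {𝒳 : Type*} [MeasurableSpace 𝒳]

/-- Weights `b β` of the conditional effect whose conditional mean given the covariates is
proportional to `Pr(D = 1, T = 1 | X)` both under `P β` and under `P 0`. -/
structure Adjustment (P : ℝ → ProbabilityMeasure (Obs 𝒳)) (A : ℝ → Set 𝒳) (b : ℝ → Obs 𝒳 → ℝ)
    (κ : ℝ → ℝ) (B : ℝ) : Prop where
  meas : ∀ β, Measurable (b β)
  bound : ∀ᶠ β in 𝓝[≠] (0 : ℝ), ∀ w, |b β w| ≤ B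
  bound_zero : ∀ w, |b 0 w| ≤ B
  mean : ∀ᶠ β in 𝓝[≠] (0 : ℝ), ∀ g : 𝒳 → ℝ, Measurable g →
    Integrable (fun w => g (X w)) (P β : Measure (Obs 𝒳)) →
    ∫ w, b β w * g (X w) ∂(P β : Measure (Obs 𝒳))
      = κ β * ∫ w, G 1 1 w * g (X w) ∂(P β : Measure (Obs 𝒳))
  mean_zero : ∀ᶠ β in 𝓝[≠] (0 : ℝ), ∀ g : 𝒳 → ℝ, Measurable g →
    Integrable (fun w => g (X w)) (P 0 : Measure (Obs 𝒳)) →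
    ∫ w, b β w * g (X w) ∂(P 0 : Measure (Obs 𝒳))
      = κ 0 * ∫ w, G 1 1 w * g (X w) ∂(P 0 : Measure (Obs 𝒳))
  tendsto_scale : Tendsto κ (𝓝[≠] 0) (𝓝 (κ 0))
  scale_ne : κ 0 ≠ 0
  tendsto : Tendsto (fun β => ∫ w, |ov A β (X w) * (b β w - b 0 w)| ∂(P 0 : Measure (Obs 𝒳)))
    (𝓝[≠] 0) (𝓝 0)

/-- The influence function of the ATET obtained from a weight `b` with scale `k`. -/
def influence (P : ProbabilityMeasure (Obs 𝒳)) (c : ℝ) (b : Obs 𝒳 → ℝ) (k θ : ℝ) (w : Obs 𝒳) : ℝ :=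
  (k * ∑ d : Fin 2, ∑ t : Fin 2, sgn d t *
      (RegularFamily.ratio P c d t (X w) * G d t w * (Y w - mCell P d t (X w)))
    + b w * (mY P (X w) - θ)) / (k * pDT P)

lemma Support.pDT_pos {P : ProbabilityMeasure (Obs 𝒳)} {c : ℝ} (hc : 0 < c) (h : Support P c) :
    0 < pDT P := by
  rw [pDT_eq_integral]; exact hc.trans_le (h.le_integral_G hc 1 1)

lemma abs_sgn (d t : Fin 2) : |sgn d t| = 1 := by simp [sgn, abs_pow]

lemma nrm_mY_le {P : ProbabilityMeasure (Obs 𝒳)} {K : ℝ}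
    (hm : ∀ d t, MemLp (fun w => mCell P d t (X w)) 2 (P : Measure (Obs 𝒳)))
    (hK : ∀ d t, nrm (P : Measure (Obs 𝒳)) (fun w => mCell P d t (X w)) ≤ K) :
    MemLp (fun w => mY P (X w)) 2 (P : Measure (Obs 𝒳)) ∧
    nrm (P : Measure (Obs 𝒳)) (fun w => mY P (X w)) ≤ 4 * K := by
  have h1 : MemLp (fun w => mCell P 0 1 (X w) - mCell P 0 0 (X w)) 2 (P : Measure (Obs 𝒳)) :=
    (hm 0 1).sub (hm 0 0)
  have h2 : MemLp (fun w => mCell P 0 1 (X w) - mCell P 0 0 (X w) + mCell P 1 0 (X w)) 2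
    (P : Measure (Obs 𝒳)) := h1.add (hm 1 0)
  have e : (fun w : Obs 𝒳 => mY P (X w)) = fun w => mCell P 1 1 (X w)
      - (mCell P 0 1 (X w) - mCell P 0 0 (X w) + mCell P 1 0 (X w)) := by
    ext w; simp only [mY, Fin.sum_univ_two]; simp; ring
  rw [e]
  refine ⟨(hm 1 1).sub h2, ?_⟩
  have := nrm_sub_le (hm 1 1) h2
  have := nrm_add_le h1 (hm 1 0)
  have := nrm_sub_le (hm 0 1) (hm 0 0)
  linarith [hK 0 0, hK 0 1, hK 1 0, hK 1 1]

namespace RegularFamily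
variable {P : ℝ → ProbabilityMeasure (Obs 𝒳)} {S : Obs 𝒳 → ℝ} {ν : Measure (Obs 𝒳)}
  {r : ℝ → Obs 𝒳 → ℝ} {c K : ℝ} {A : ℝ → Set 𝒳}

lemma integrable_ov_sub_mCell (h : RegularFamily P S ν r c K) (hA : Overlap P A) {β : ℝ}
    (hβ : ∀ d t, MemLp (fun w => mCell (P β) d t (X w)) 2 (P β : Measure (Obs 𝒳))) (d t : Fin 2) :
    Integrable (fun w => ov A β (X w) * (mCell (P β) d t (X w) - mCell (P 0) d t (X w)))
      (P 0 : Measure (Obs 𝒳)) := by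
  obtain ⟨o1, -⟩ := hA.memLp (measurable_mCell (P β) d t) (hβ d t)
  have o3 : MemLp (fun w => ov A β (X w) * mCell (P 0) d t (X w)) 2 (P 0 : Measure (Obs 𝒳)) :=
    MemLp.bdd_mul_two ((hA.measurable_ov β).comp measurable_X)
      (fun w => Overlap.abs_ov_le A β (X w)) (h.memLp_mCell_zero d t)
  refine ((o1.sub o3).integrable (by norm_num)).congr (ae_of_all _ fun w => ?_)
  simp only [Pi.sub_apply]; ring

lemma ov_sub_mY_eq (P : ℝ → ProbabilityMeasure (Obs 𝒳)) (A : ℝ → Set 𝒳) (β : ℝ) (x : 𝒳) :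
    ov A β x * (mY (P β) x - mY (P 0) x) = ∑ d : Fin 2, ∑ t : Fin 2,
      sgn d t * (ov A β x * (mCell (P β) d t x - mCell (P 0) d t x)) := by
  rw [mY_eq_sum, mY_eq_sum]
  simp only [Fin.sum_univ_two]; ring

lemma tendsto_mY (h : RegularFamily P S ν r c K) (hA : Overlap P A) :
    Tendsto (fun β => ∫ w, |ov A β (X w) * (mY (P β) (X w) - mY (P 0) (X w))|
      ∂(P 0 : Measure (Obs 𝒳))) (𝓝[≠] 0) (𝓝 0) := by
  have l := tendsto_finsetSum (Finset.univ : Finset (Fin 2)) fun d _ =>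
    tendsto_finsetSum (Finset.univ : Finset (Fin 2)) fun t _ => h.tendsto_mCell hA d t
  simp only [Finset.sum_const_zero] at l
  refine squeeze_zero' (Eventually.of_forall fun β => integral_nonneg fun _ => abs_nonneg _) ?_ l
  filter_upwards [h.memLp_mCell] with β hβ
  have hi := h.integrable_ov_sub_mCell hA hβ
  have hi2 : ∀ d : Fin 2, Integrable (fun w => ∑ t : Fin 2,
      |ov A β (X w) * (mCell (P β) d t (X w) - mCell (P 0) d t (X w))|) (P 0 : Measure (Obs 𝒳)) :=
    fun d => integrable_finsetSum _ fun t _ => (hi d t).abs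
  have e : ∑ d : Fin 2, ∑ t : Fin 2,
      ∫ w, |ov A β (X w) * (mCell (P β) d t (X w) - mCell (P 0) d t (X w))| ∂(P 0 : Measure (Obs 𝒳))
      = ∫ w, ∑ d : Fin 2, ∑ t : Fin 2,
        |ov A β (X w) * (mCell (P β) d t (X w) - mCell (P 0) d t (X w))|
        ∂(P 0 : Measure (Obs 𝒳)) := by
    rw [integral_finsetSum _ fun d _ => hi2 d]
    refine Finset.sum_congr rfl fun d _ => ?_
    rw [integral_finsetSum _ fun t _ => (hi d t).abs]
  rw [e]
  refine integral_mono_of_nonneg (ae_of_all _ fun _ => abs_nonneg _)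
    (integrable_finsetSum _ fun d _ => hi2 d) (ae_of_all _ fun w => ?_)
  simp only
  rw [ov_sub_mY_eq]
  refine (Finset.abs_sum_le_sum_abs _ _).trans (Finset.sum_le_sum fun d _ => ?_)
  refine (Finset.abs_sum_le_sum_abs _ _).trans (Finset.sum_le_sum fun t _ => ?_)
  rw [abs_mul, abs_sgn, one_mul]

lemma bound_mY (h : RegularFamily P S ν r c K) : ∀ᶠ β in 𝓝[≠] (0 : ℝ),
    MemLp (fun w => mY (P β) (X w)) 2 (P β : Measure (Obs 𝒳)) ∧
    nrm (P β : Measure (Obs 𝒳)) (fun w => mY (P β) (X w)) ≤ 4 * K := by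
  filter_upwards [h.memLp_mCell, h.bound] with β h1 h2 using nrm_mY_le h1 h2.2

variable {b : ℝ → Obs 𝒳 → ℝ} {κ : ℝ → ℝ} {B : ℝ}

/-- The part of the expansion of the doubly robust moment that concerns the conditional effect. -/
lemma tendsto_adjustment (h : RegularFamily P S ν r c K) (hA : Overlap P A)
    (hb : Adjustment P A b κ B) (θ : ℝ) :
    Tendsto (fun β => (κ β * ∫ w, G 1 1 w * (ov A β (X w) * (mY (P β) (X w) - θ))
        ∂(P β : Measure (Obs 𝒳)) - κ 0 * ∫ w, G 1 1 w * (ov A β (X w) * (mY (P β) (X w) - θ))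
        ∂(P 0 : Measure (Obs 𝒳))) / β) (𝓝[≠] 0)
      (𝓝 (∫ w, b 0 w * (mY (P 0) (X w) - θ) * S w ∂(P 0 : Measure (Obs 𝒳)))) := by
  have hB : 0 ≤ B := by
    obtain ⟨w⟩ := (P 0).nonempty
    exact (abs_nonneg _).trans (hb.bound_zero w)
  have hm0 : MemLp (fun w => mY (P 0) (X w) - θ) 2 (P 0 : Measure (Obs 𝒳)) :=
    (h.support_zero.memLp_mY h.c_pos (h.memLp 0)).sub (memLp_const θ)
  -- By the two mean properties of the weight, the means of φ β under P β and under P 0 are the two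
  -- terms of the numerator.
  set φ : ℝ → Obs 𝒳 → ℝ := fun β w => b β w * (ov A β (X w) * (mY (P β) (X w) - θ)) with hφ
  have hgm : ∀ β, Measurable (fun x : 𝒳 => ov A β x * (mY (P β) x - θ)) := fun β =>
    (hA.measurable_ov β).mul (by fun_prop)
  have hφm : ∀ β, Measurable (φ β) := fun β => (hb.meas β).mul ((hgm β).comp measurable_X)
  have φ0 : ∀ w, φ 0 w = b 0 w * (mY (P 0) (X w) - θ) := fun w => by simp [hφ, hA.ov_zero]
  have hφ0 : MemLp (φ 0) 2 (P 0 : Measure (Obs 𝒳)) := by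
    have := MemLp.bdd_mul_two (hb.meas 0) hb.bound_zero hm0
    exact this.ae_eq (ae_of_all _ fun w => (φ0 w).symm)
  have e1 : ∀ᶠ β in 𝓝[≠] (0 : ℝ),
      MemLp (fun w => ov A β (X w) * (mY (P β) (X w) - θ)) 2 (P β : Measure (Obs 𝒳)) ∧
      nrm (P β : Measure (Obs 𝒳)) (fun w => ov A β (X w) * (mY (P β) (X w) - θ))
        ≤ 4 * K + |θ| := by
    filter_upwards [h.bound_mY] with β hβ
    have hs : MemLp (fun w => mY (P β) (X w) - θ) 2 (P β : Measure (Obs 𝒳)) :=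
      hβ.1.sub (memLp_const θ)
    refine ⟨MemLp.bdd_mul_two ((hA.measurable_ov β).comp measurable_X)
      (fun w => Overlap.abs_ov_le A β (X w)) hs, ?_⟩
    refine (nrm_bdd_mul_le (fun w => Overlap.abs_ov_le A β (X w)) zero_le_one hs).trans ?_
    rw [one_mul]
    refine (nrm_sub_le hβ.1 (memLp_const θ)).trans ?_
    rw [nrm_const_le]
    linarith [hβ.2]
  have e0 : ∀ᶠ β in 𝓝[≠] (0 : ℝ),
      MemLp (fun w => ov A β (X w) * (mY (P β) (X w) - θ)) 2 (P 0 : Measure (Obs 𝒳)) ∧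
      nrm (P 0 : Measure (Obs 𝒳)) (fun w => ov A β (X w) * (mY (P β) (X w) - θ))
        ≤ 2 * (4 * K + |θ|) := by
    filter_upwards [h.bound_mY] with β hβ
    have hs : MemLp (fun w => mY (P β) (X w) - θ) 2 (P β : Measure (Obs 𝒳)) :=
      hβ.1.sub (memLp_const θ)
    obtain ⟨o1, o2⟩ := hA.memLp (u := fun x => mY (P β) x - θ) (by fun_prop) hs
    refine ⟨o1, o2.trans (mul_le_mul_of_nonneg_left ?_ two_pos.le)⟩
    refine (nrm_sub_le hβ.1 (memLp_const θ)).trans ?_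
    rw [nrm_const_le]
    linarith [hβ.2]
  have hKθ : 0 ≤ 4 * K + |θ| := by
    obtain ⟨β, hβ⟩ := e1.exists
    exact (nrm_nonneg _).trans hβ.2
  have lim := h.root.tendsto_slope (φ := φ) (K := B * (2 * (4 * K + |θ|))) hφm ?_ ?_ hφ0 ?_
  · simp only [φ0] at lim
    refine lim.congr' ?_
    filter_upwards [e1, e0, hb.mean, hb.mean_zero] with β b1 b0 m1 m0
    rw [m1 _ (hgm β) (b1.1.integrable (by norm_num)), m0 _ (hgm β) (b0.1.integrable (by norm_num))]
  · filter_upwards [e1, hb.bound] with β b1 hβ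
    refine ⟨MemLp.bdd_mul_two (hb.meas β) hβ b1.1, (nrm_bdd_mul_le hβ hB b1.1).trans ?_⟩
    exact mul_le_mul_of_nonneg_left (by linarith [b1.2]) hB
  · filter_upwards [e0, hb.bound] with β b0 hβ
    refine ⟨MemLp.bdd_mul_two (hb.meas β) hβ b0.1, (nrm_bdd_mul_le hβ hB b0.1).trans ?_⟩
    exact mul_le_mul_of_nonneg_left b0.2 hB
  · set M := nrm (P 0 : Measure (Obs 𝒳)) (fun w => mY (P 0) (X w) - θ)
    have l1 := (h.tendsto_mY hA).const_mul B
    -- The centered effect is only in L², so L² convergence of the weights is needed. They are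
    -- bounded by B, hence the square of their difference is at most 2B times its absolute value,
    -- and L¹ convergence suffices.
    have l2 : Tendsto (fun β => √(2 * B * ∫ w, |ov A β (X w) * (b β w - b 0 w)|
        ∂(P 0 : Measure (Obs 𝒳))) * M) (𝓝[≠] 0) (𝓝 0) := by
      have := ((Real.continuous_sqrt.tendsto _).comp (hb.tendsto.const_mul (2 * B))).mul_const M
      simpa using this
    have l3 := h.tendsto_integral_abs_compl_mul hA hφ0
    have l := (l1.add l2).add l3
    simp only [mul_zero, add_zero] at l
    refine squeeze_zero' (Eventually.of_forall fun β => integral_nonneg fun _ => abs_nonneg _) ?_ l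
    filter_upwards [h.memLp_mCell, e0, hb.bound] with β hβ b0 bB
    have i1 : Integrable (fun w => ov A β (X w) * (mY (P β) (X w) - mY (P 0) (X w)))
        (P 0 : Measure (Obs 𝒳)) := by
      simp only [ov_sub_mY_eq]
      exact integrable_finsetSum _ fun d _ => integrable_finsetSum _ fun t _ =>
        (h.integrable_ov_sub_mCell hA hβ d t).const_mul _
    have hdm : Measurable (fun w => ov A β (X w) * (b β w - b 0 w)) :=
      ((hA.measurable_ov β).comp measurable_X).mul ((hb.meas β).sub (hb.meas 0))
    have hdb : ∀ w, |ov A β (X w) * (b β w - b 0 w)| ≤ 2 * B := fun w => by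
      rw [abs_mul]
      refine (mul_le_of_le_one_left (abs_nonneg _) (Overlap.abs_ov_le A β _)).trans ?_
      refine (abs_sub _ _).trans ?_
      linarith [bB w, hb.bound_zero w]
    have hdL : MemLp (fun w => ov A β (X w) * (b β w - b 0 w)) 2 (P 0 : Measure (Obs 𝒳)) :=
      MemLp_of_abs_le hdm.aestronglyMeasurable _ hdb
    have i2 : Integrable (fun w => ov A β (X w) * (b β w - b 0 w) * (mY (P 0) (X w) - θ))
        (P 0 : Measure (Obs 𝒳)) := integrable_mul_of_memLp hdL hm0
    have i3 : Integrable (fun w => (1 - ov A β (X w)) * φ 0 w) (P 0 : Measure (Obs 𝒳)) :=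
      (MemLp.bdd_mul_two (measurable_const.sub ((hA.measurable_ov β).comp measurable_X))
        (fun w => Overlap.abs_one_sub_ov_le A β (X w)) hφ0).integrable (by norm_num)
    have c2 : ∫ w, |ov A β (X w) * (b β w - b 0 w) * (mY (P 0) (X w) - θ)| ∂(P 0 : Measure (Obs 𝒳))
        ≤ √(2 * B * ∫ w, |ov A β (X w) * (b β w - b 0 w)| ∂(P 0 : Measure (Obs 𝒳))) * M := by
      refine (integral_abs_mul_le hdL hm0).trans
        (mul_le_mul_of_nonneg_right (Real.sqrt_le_sqrt ?_) (nrm_nonneg _))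
      rw [← integral_const_mul]
      refine integral_mono_of_nonneg (ae_of_all _ fun _ => sq_nonneg _)
        ((hdL.integrable (by norm_num)).abs.const_mul _) (ae_of_all _ fun w => ?_)
      simp only
      rw [← sq_abs, sq]
      exact mul_le_mul_of_nonneg_right (hdb w) (abs_nonneg _)
    have i12 : Integrable (fun w => B * |ov A β (X w) * (mY (P β) (X w) - mY (P 0) (X w))|
        + |ov A β (X w) * (b β w - b 0 w) * (mY (P 0) (X w) - θ)|) (P 0 : Measure (Obs 𝒳)) :=
      (i1.abs.const_mul B).add i2.abs
    have hint : Integrable (fun w => B * |ov A β (X w) * (mY (P β) (X w) - mY (P 0) (X w))|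
        + |ov A β (X w) * (b β w - b 0 w) * (mY (P 0) (X w) - θ)|
        + |(1 - ov A β (X w)) * φ 0 w|) (P 0 : Measure (Obs 𝒳)) :=
      i12.add i3.abs
    calc _ ≤ ∫ w, (B * |ov A β (X w) * (mY (P β) (X w) - mY (P 0) (X w))|
        + |ov A β (X w) * (b β w - b 0 w) * (mY (P 0) (X w) - θ)|
        + |(1 - ov A β (X w)) * φ 0 w|) ∂(P 0 : Measure (Obs 𝒳)) := by
          refine integral_mono_of_nonneg (ae_of_all _ fun _ => abs_nonneg _) hint
            (ae_of_all _ fun w => ?_)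
          have e : φ β w - φ 0 w = b β w * (ov A β (X w) * (mY (P β) (X w) - mY (P 0) (X w)))
              + ov A β (X w) * (b β w - b 0 w) * (mY (P 0) (X w) - θ)
              - (1 - ov A β (X w)) * φ 0 w := by
            rw [φ0]; simp only [hφ]; ring
          simp only
          rw [e]
          refine (abs_sub _ _).trans (add_le_add ((abs_add_le _ _).trans (add_le_add ?_ le_rfl))
            le_rfl)
          rw [abs_mul]
          exact mul_le_mul_of_nonneg_right (bB w) (abs_nonneg _)
      _ ≤ _ := by
          rw [integral_add i12 i3.abs,
            integral_add (i1.abs.const_mul B) i2.abs, integral_const_mul]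
          linarith

/-- The mean of a square-integrable function off the overlap set is `o(β)`. -/
lemma tendsto_compl_div {μ : ℝ → ProbabilityMeasure (Obs 𝒳)} (hA : Overlap P A)
    {f : ℝ → Obs 𝒳 → ℝ} {M : ℝ}
    (hf : ∀ᶠ β in 𝓝[≠] (0 : ℝ), MemLp (f β) 2 (μ β : Measure (Obs 𝒳)) ∧
      nrm (μ β : Measure (Obs 𝒳)) (f β) ≤ M)
    (hμ : Tendsto (fun β => nrm (μ β : Measure (Obs 𝒳)) (fun w => 1 - ov A β (X w)) / |β|)
      (𝓝[≠] 0) (𝓝 0)) :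
    Tendsto (fun β => (∫ w, (1 - ov A β (X w)) * f β w ∂(μ β : Measure (Obs 𝒳))) / β)
      (𝓝[≠] 0) (𝓝 0) := by
  have l := hμ.mul_const M
  rw [zero_mul] at l
  refine squeeze_zero_norm' ?_ l
  filter_upwards [hf] with β hβ
  rw [norm_div, Real.norm_eq_abs, Real.norm_eq_abs, div_mul_eq_mul_div]
  refine div_le_div_of_nonneg_right ?_ (abs_nonneg _)
  have hm : MemLp (fun w => 1 - ov A β (X w)) 2 (μ β : Measure (Obs 𝒳)) :=
    MemLp_of_abs_le (measurable_const.sub ((hA.measurable_ov β).comp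
      measurable_X)).aestronglyMeasurable 1 (fun w => Overlap.abs_one_sub_ov_le A β (X w))
  exact (abs_integral_mul_le hm hβ.1).trans (mul_le_mul_of_nonneg_left hβ.2 (nrm_nonneg _))

lemma memLp_residual {P : ProbabilityMeasure (Obs 𝒳)} {c : ℝ} (hc : 0 < c) (hs : Support P c)
    (hY : MemLp Y 2 (P : Measure (Obs 𝒳))) (d t : Fin 2) :
    MemLp (fun w => ratio P c d t (X w) * G d t w * (Y w - mCell P d t (X w))) 2
      (P : Measure (Obs 𝒳)) := by
  refine MemLp.bdd_mul_two (M := c⁻¹)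
    (((measurable_ratio P c d t).comp measurable_X).mul (measurable_G d t)) (fun w => ?_)
    (hY.sub (hs.memLp_mCell hc hY d t))
  rw [abs_mul]
  exact (mul_le_of_le_one_right (abs_nonneg _) (abs_G_le d t w)).trans (abs_ratio_le P hc d t _)

/-- Pathwise differentiability of the ATET. -/
theorem hasDerivAt_theta (h : RegularFamily P S ν r c K) (hA : Overlap P A)
    (hb : Adjustment P A b κ B) :
    HasDerivAt (fun β => theta (P β))
      (∫ w, influence (P 0) c (b 0) (κ 0) (theta (P 0)) w * S w ∂(P 0 : Measure (Obs 𝒳))) 0 := by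
  set θ := theta (P 0) with hθ
  have hB : 0 ≤ B := by
    obtain ⟨w⟩ := (P 0).nonempty
    exact (abs_nonneg _).trans (hb.bound_zero w)
  have hm0 : MemLp (fun w => mY (P 0) (X w) - θ) 2 (P 0 : Measure (Obs 𝒳)) :=
    (h.support_zero.memLp_mY h.c_pos (h.memLp 0)).sub (memLp_const θ)
  have hSL := h.root.score_memLp
  have hp0 : 0 < pDT (P 0) := h.support_zero.pDT_pos h.c_pos
  -- centered conditional effects on the treated cell
  have hcent : ∀ β, 0 < pDT (P β) →
      Integrable (fun w => mY (P β) (X w)) (P β : Measure (Obs 𝒳)) →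
      ∫ w, G 1 1 w * (mY (P β) (X w) - θ) ∂(P β : Measure (Obs 𝒳))
        = pDT (P β) * (theta (P β) - θ) := by
    intro β hp hi
    have i1 : Integrable (fun w => G 1 1 w * mY (P β) (X w)) (P β : Measure (Obs 𝒳)) :=
      hi.bdd_mul (c := 1) (measurable_G 1 1).aestronglyMeasurable (ae_of_all _ fun w => abs_G_le 1 1 w)
    simp only [mul_sub]
    rw [integral_sub i1 ((integrable_G 1 1).mul_const θ), integral_mul_const, ← pDT_eq_integral,
      theta]
    field_simp
  have L1 : Tendsto (fun β => (κ 0 * ∫ w, ov A β (X w) * (G 1 1 w * (mY (P β) (X w)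
      - mY (P 0) (X w))) ∂(P 0 : Measure (Obs 𝒳))) / β) (𝓝[≠] 0)
      (𝓝 (κ 0 * ∑ d : Fin 2, ∑ t : Fin 2, sgn d t * ∫ w, ratio (P 0) c d t (X w) * G d t w *
        (Y w - mCell (P 0) d t (X w)) * S w ∂(P 0 : Measure (Obs 𝒳)))) := by
    have l := (tendsto_finsetSum (Finset.univ : Finset (Fin 2)) fun d _ =>
      tendsto_finsetSum (Finset.univ : Finset (Fin 2)) fun t _ =>
        (h.tendsto_residual hA d t).const_mul (sgn d t)).const_mul (κ 0)
    refine l.congr' ?_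
    filter_upwards [h.memLp_mCell] with β hβ
    have hi : ∀ d t, Integrable (fun w => ov A β (X w) * (G 1 1 w * (mCell (P β) d t (X w)
        - mCell (P 0) d t (X w)))) (P 0 : Measure (Obs 𝒳)) := fun d t => by
      refine ((h.integrable_ov_sub_mCell hA hβ d t).bdd_mul (c := 1)
        (measurable_G 1 1).aestronglyMeasurable (ae_of_all _ fun w => abs_G_le 1 1 w)).congr
        (ae_of_all _ fun w => ?_)
      simp only; ring
    rw [mul_div_assoc]
    congr 1
    have e : ∀ w, ov A β (X w) * (G 1 1 w * (mY (P β) (X w) - mY (P 0) (X w)))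
        = ∑ d : Fin 2, ∑ t : Fin 2, sgn d t * (ov A β (X w) * (G 1 1 w * (mCell (P β) d t (X w)
        - mCell (P 0) d t (X w)))) := fun w => by
      rw [mY_eq_sum, mY_eq_sum]; simp only [Fin.sum_univ_two]; ring
    simp only [e]
    rw [integral_finsetSum _ fun d _ => integrable_finsetSum _ fun t _ => (hi d t).const_mul _,
      Finset.sum_div]
    refine Finset.sum_congr rfl fun d _ => ?_
    rw [integral_finsetSum _ fun t _ => (hi d t).const_mul _, Finset.sum_div]
    refine Finset.sum_congr rfl fun t _ => ?_
    rw [integral_const_mul, mul_div_assoc]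
  have L2 := h.tendsto_adjustment hA hb θ
  have L3 := tendsto_compl_div (μ := fun _ => P 0) hA
    (f := fun _ w => G 1 1 w * (mY (P 0) (X w) - θ))
    (M := nrm (P 0 : Measure (Obs 𝒳)) fun w => G 1 1 w * (mY (P 0) (X w) - θ))
    (Eventually.of_forall fun _ => ⟨MemLp.bdd_mul_two (measurable_G 1 1) (abs_G_le 1 1) hm0, le_rfl⟩)
    (hA.tendsto_compl h.root).1
  have L4 := tendsto_compl_div (μ := P) hA (f := fun β w => G 1 1 w * (mY (P β) (X w) - θ))
    (M := 1 * (4 * K + |θ|))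
    (by
      filter_upwards [h.bound_mY] with β hβ
      have hs : MemLp (fun w => mY (P β) (X w) - θ) 2 (P β : Measure (Obs 𝒳)) :=
        hβ.1.sub (memLp_const θ)
      refine ⟨MemLp.bdd_mul_two (measurable_G 1 1) (abs_G_le 1 1) hs,
        (nrm_bdd_mul_le (abs_G_le 1 1) zero_le_one hs).trans ?_⟩
      rw [one_mul, one_mul]
      refine (nrm_sub_le hβ.1 (memLp_const θ)).trans ?_
      rw [nrm_const_le]
      linarith [hβ.2])
    (hA.tendsto_compl h.root).2
  have Lp : Tendsto (fun β => pDT (P β)) (𝓝[≠] 0) (𝓝 (pDT (P 0))) := by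
    simp only [pDT_eq_integral]
    exact h.root.tendsto_integral (measurable_G 1 1) (abs_G_le 1 1)
  have Lκ := hb.tendsto_scale.mul Lp
  have hden : κ 0 * pDT (P 0) ≠ 0 := mul_ne_zero hb.scale_ne hp0.ne'
  -- The four terms are the drift of the regression on the overlap set, the change of law on the
  -- overlap set, and the contributions of its complement under P 0 and under P β. Their sum is κ_β
  -- p_DT(P_β) times the difference quotient of θ, which is why the limit is divided by the limit of
  -- that factor.
  have L := ((L1.add L2).sub (L3.const_mul (κ 0))).add (hb.tendsto_scale.mul L4)
  have L' := L.div Lκ hden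
  rw [hasDerivAt_iff_tendsto_slope]
  have hlim : ∫ w, influence (P 0) c (b 0) (κ 0) θ w * S w ∂(P 0 : Measure (Obs 𝒳))
      = (κ 0 * ∑ d : Fin 2, ∑ t : Fin 2, sgn d t * ∫ w, ratio (P 0) c d t (X w) * G d t w *
        (Y w - mCell (P 0) d t (X w)) * S w ∂(P 0 : Measure (Obs 𝒳))
        + ∫ w, b 0 w * (mY (P 0) (X w) - θ) * S w ∂(P 0 : Measure (Obs 𝒳))
        - κ 0 * 0 + κ 0 * 0) / (κ 0 * pDT (P 0)) := by
    have hr := fun d t => memLp_residual h.c_pos h.support_zero (h.memLp 0) d t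
    have hi : ∀ d t, Integrable (fun w => sgn d t * (ratio (P 0) c d t (X w) * G d t w *
        (Y w - mCell (P 0) d t (X w)) * S w)) (P 0 : Measure (Obs 𝒳)) := fun d t =>
      (integrable_mul_of_memLp (hr d t) hSL).const_mul _
    have hib : Integrable (fun w => b 0 w * (mY (P 0) (X w) - θ) * S w) (P 0 : Measure (Obs 𝒳)) :=
      integrable_mul_of_memLp (MemLp.bdd_mul_two (hb.meas 0) hb.bound_zero hm0) hSL
    have e : ∀ w, influence (P 0) c (b 0) (κ 0) θ w * S w = (κ 0 * pDT (P 0))⁻¹ *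
        (κ 0 * (∑ d : Fin 2, ∑ t : Fin 2, sgn d t * (ratio (P 0) c d t (X w) * G d t w *
        (Y w - mCell (P 0) d t (X w)) * S w)) + b 0 w * (mY (P 0) (X w) - θ) * S w) := fun w => by
      rw [influence]; simp only [Fin.sum_univ_two]; ring
    simp only [e]
    rw [integral_const_mul, integral_add ((integrable_finsetSum _ fun d _ =>
      integrable_finsetSum _ fun t _ => hi d t).const_mul _) hib, integral_const_mul,
      integral_finsetSum _ fun d _ => integrable_finsetSum _ fun t _ => hi d t]
    simp only [integral_finsetSum _ fun t _ => hi _ t, integral_const_mul]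
    rw [div_eq_inv_mul]; ring
  rw [hlim]
  refine L'.congr' ?_
  filter_upwards [h.memLp_mCell, h.bound_mY, h.support, self_mem_nhdsWithin,
    Lκ.eventually_ne hden] with β hβ hmβ hs hne hk
  have hne : β ≠ 0 := hne
  have hpβ : 0 < pDT (P β) := hs.pDT_pos h.c_pos
  have hsβ : MemLp (fun w => mY (P β) (X w) - θ) 2 (P β : Measure (Obs 𝒳)) :=
    hmβ.1.sub (memLp_const θ)
  obtain ⟨oY, -⟩ := hA.memLp (measurable_mY (P β)) hmβ.1
  have hovm : Measurable (fun w : Obs 𝒳 => ov A β (X w)) := (hA.measurable_ov β).comp measurable_X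
  have hovb : ∀ w : Obs 𝒳, |ov A β (X w)| ≤ 1 := fun w => Overlap.abs_ov_le A β (X w)
  have hovb' : ∀ w : Obs 𝒳, |1 - ov A β (X w)| ≤ 1 := fun w => Overlap.abs_one_sub_ov_le A β (X w)
  -- decompositions of the means over the overlap set and its complement
  have dβ : ∫ w, G 1 1 w * (mY (P β) (X w) - θ) ∂(P β : Measure (Obs 𝒳))
      = ∫ w, G 1 1 w * (ov A β (X w) * (mY (P β) (X w) - θ)) ∂(P β : Measure (Obs 𝒳))
        + ∫ w, (1 - ov A β (X w)) * (G 1 1 w * (mY (P β) (X w) - θ))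
          ∂(P β : Measure (Obs 𝒳)) := by
    rw [← integral_add]
    · congr 1; ext w; ring
    · exact (MemLp.bdd_mul_two (measurable_G 1 1) (abs_G_le 1 1)
        (MemLp.bdd_mul_two hovm hovb hsβ)).integrable (by norm_num)
    · exact (MemLp.bdd_mul_two (measurable_const.sub hovm) hovb'
        (MemLp.bdd_mul_two (measurable_G 1 1) (abs_G_le 1 1) hsβ)).integrable (by norm_num)
  have d0 : ∫ w, ov A β (X w) * (G 1 1 w * (mY (P β) (X w) - mY (P 0) (X w)))
        ∂(P 0 : Measure (Obs 𝒳))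
      - ∫ w, G 1 1 w * (ov A β (X w) * (mY (P β) (X w) - θ)) ∂(P 0 : Measure (Obs 𝒳))
      - ∫ w, (1 - ov A β (X w)) * (G 1 1 w * (mY (P 0) (X w) - θ)) ∂(P 0 : Measure (Obs 𝒳))
      = - ∫ w, G 1 1 w * (mY (P 0) (X w) - θ) ∂(P 0 : Measure (Obs 𝒳)) := by
    have j1 : Integrable (fun w => ov A β (X w) * (G 1 1 w * (mY (P β) (X w) - mY (P 0) (X w))))
        (P 0 : Measure (Obs 𝒳)) := by
      have := (MemLp.bdd_mul_two (measurable_G 1 1) (abs_G_le 1 1)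
        (oY.sub (MemLp.bdd_mul_two hovm hovb (h.support_zero.memLp_mY h.c_pos (h.memLp 0))))
        ).integrable (q := 2) (by norm_num)
      refine this.congr (ae_of_all _ fun w => ?_)
      simp only [Pi.sub_apply]; ring
    have j2 : Integrable (fun w => G 1 1 w * (ov A β (X w) * (mY (P β) (X w) - θ)))
        (P 0 : Measure (Obs 𝒳)) := by
      have := (MemLp.bdd_mul_two (measurable_G 1 1) (abs_G_le 1 1)
        (oY.sub (MemLp.bdd_mul_two hovm hovb (memLp_const θ)))
        ).integrable (q := 2) (by norm_num)
      refine this.congr (ae_of_all _ fun w => ?_)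
      simp only [Pi.sub_apply]; ring
    have j3 : Integrable (fun w => (1 - ov A β (X w)) * (G 1 1 w * (mY (P 0) (X w) - θ)))
        (P 0 : Measure (Obs 𝒳)) :=
      (MemLp.bdd_mul_two (measurable_const.sub hovm) hovb'
        (MemLp.bdd_mul_two (measurable_G 1 1) (abs_G_le 1 1) hm0)).integrable (by norm_num)
    have j12 : Integrable (fun w => ov A β (X w) * (G 1 1 w * (mY (P β) (X w) - mY (P 0) (X w)))
        - G 1 1 w * (ov A β (X w) * (mY (P β) (X w) - θ))) (P 0 : Measure (Obs 𝒳)) := j1.sub j2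
    rw [← integral_sub j1 j2, ← integral_sub j12 j3, ← integral_neg]
    congr 1; ext w; ring
  have z0 := hcent 0 hp0 ((h.support_zero.memLp_mY h.c_pos (h.memLp 0)).integrable (by norm_num))
  rw [hθ, sub_self, mul_zero, ← hθ] at z0
  have zβ := hcent β hpβ (hmβ.1.integrable (by norm_num))
  rw [z0, neg_zero] at d0
  simp only [Pi.div_apply]
  rw [slope_def_field, sub_zero, ← hθ, div_eq_iff hk]
  have key : theta (P β) - θ = (∫ w, G 1 1 w * (mY (P β) (X w) - θ) ∂(P β : Measure (Obs 𝒳)))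
      / pDT (P β) := by rw [zβ]; field_simp
  have e : ∀ J : ℝ, J / pDT (P β) / β * (κ β * pDT (P β)) = κ β * J / β := fun J => by
    field_simp
  -- What remains is the bookkeeping identity `d0`: the three P 0-terms add up to minus the centered
  -- effect on the treated, which is zero by the choice of θ.
  rw [key, dβ, e]
  linear_combination (κ 0 / β) * d0

end RegularFamily
end Gradient
end DiD

namespace DiD

/-! ### Identities between conditional probabilities. -/

section CondProbIdentities
variable {𝒳 : Type*} [MeasurableSpace 𝒳] {P : ProbabilityMeasure (Obs 𝒳)}

lemma integrable_of_abs_le {f : Obs 𝒳 → ℝ} (hf : Measurable f) {M : ℝ} (h : ∀ w, |f w| ≤ M) :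
    Integrable f (P : Measure (Obs 𝒳)) :=
  (MemLp_of_abs_le (p := 2) hf.aestronglyMeasurable M h).integrable (by norm_num)

lemma integrable_of_abs_le_X {u : 𝒳 → ℝ} (hu : Measurable u) {M : ℝ} (h : ∀ x, |u x| ≤ M) :
    Integrable (fun w => u (X w)) (P : Measure (Obs 𝒳)) :=
  integrable_of_abs_le (f := fun w => u (X w)) (hu.comp measurable_X) (fun w => h (X w))

/-- Functions of the covariates are determined by their integrals against bounded functions. -/
lemma ae_eq_of_integral_mul {a b : 𝒳 → ℝ} (ha : Measurable a) (hb : Measurable b)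
    (ia : Integrable (fun w => a (X w)) (P : Measure (Obs 𝒳)))
    (ib : Integrable (fun w => b (X w)) (P : Measure (Obs 𝒳)))
    (h : ∀ u : 𝒳 → ℝ, Measurable u → (∀ x, |u x| ≤ 1) →
      ∫ w, u (X w) * a (X w) ∂(P : Measure (Obs 𝒳)) = ∫ w, u (X w) * b (X w) ∂(P : Measure (Obs 𝒳))) :
    ∀ᵐ w ∂(P : Measure (Obs 𝒳)), a (X w) = b (X w) :=
  ae_lawX_iff P (integral_comp_eq_of_bounded measurable_X ha hb ia ib h)

lemma abs_pDTx_le (d t : Fin 2) (x : 𝒳) : |pDTx P d t x| ≤ 1 := abs_condProb_le _ _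
lemma abs_pDx_le (d : Fin 2) (x : 𝒳) : |pDx P d x| ≤ 1 := abs_condProb_le _ _
lemma abs_pTx_le (t : Fin 2) (x : 𝒳) : |pTx P t x| ≤ 1 := abs_condProb_le _ _
lemma abs_pDtx_le (d t : Fin 2) (x : 𝒳) : |pDtx P d t x| ≤ 1 := abs_condProb_le _ _

lemma abs_mul_le_one {a b : ℝ} (ha : |a| ≤ 1) (hb : |b| ≤ 1) : |a * b| ≤ 1 := by
  rw [abs_mul]; exact mul_le_one₀ ha (abs_nonneg _) hb

lemma ae_eq_pDTx {a : 𝒳 → ℝ} (ha : Measurable a)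
    (ia : Integrable (fun w => a (X w)) (P : Measure (Obs 𝒳))) (d t : Fin 2)
    (h : ∀ u : 𝒳 → ℝ, Measurable u → (∀ x, |u x| ≤ 1) →
      ∫ w, u (X w) * G d t w ∂(P : Measure (Obs 𝒳)) = ∫ w, u (X w) * a (X w) ∂(P : Measure (Obs 𝒳))) :
    ∀ᵐ w ∂(P : Measure (Obs 𝒳)), pDTx P d t (X w) = a (X w) := by
  refine ae_eq_of_integral_mul (measurable_pDTx P d t) ha
    (integrable_of_abs_le_X (measurable_pDTx P d t) (abs_pDTx_le d t)) ia fun u hu hub => ?_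
  rw [integral_mul_pDTx d t hu (integrable_of_abs_le_X hu hub), h u hu hub]

lemma ae_eq_pTx {a : 𝒳 → ℝ} (ha : Measurable a)
    (ia : Integrable (fun w => a (X w)) (P : Measure (Obs 𝒳))) (t : Fin 2)
    (h : ∀ u : 𝒳 → ℝ, Measurable u → (∀ x, |u x| ≤ 1) →
      ∫ w, u (X w) * iT t w ∂(P : Measure (Obs 𝒳)) = ∫ w, u (X w) * a (X w) ∂(P : Measure (Obs 𝒳))) :
    ∀ᵐ w ∂(P : Measure (Obs 𝒳)), pTx P t (X w) = a (X w) := by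
  refine ae_eq_of_integral_mul (measurable_pTx P t) ha
    (integrable_of_abs_le_X (measurable_pTx P t) (abs_pTx_le t)) ia fun u hu hub => ?_
  rw [integral_mul_pTx t hu (integrable_of_abs_le_X hu hub), h u hu hub]

lemma ae_eq_pDx {a : 𝒳 → ℝ} (ha : Measurable a)
    (ia : Integrable (fun w => a (X w)) (P : Measure (Obs 𝒳))) (d : Fin 2)
    (h : ∀ u : 𝒳 → ℝ, Measurable u → (∀ x, |u x| ≤ 1) →
      ∫ w, u (X w) * iD d w ∂(P : Measure (Obs 𝒳)) = ∫ w, u (X w) * a (X w) ∂(P : Measure (Obs 𝒳))) :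
    ∀ᵐ w ∂(P : Measure (Obs 𝒳)), pDx P d (X w) = a (X w) := by
  refine ae_eq_of_integral_mul (measurable_pDx P d) ha
    (integrable_of_abs_le_X (measurable_pDx P d) (abs_pDx_le d)) ia fun u hu hub => ?_
  rw [integral_mul_pDx d hu (integrable_of_abs_le_X hu hub), h u hu hub]

lemma iD_eq_sum_G (d : Fin 2) (w : Obs 𝒳) : iD d w = G d 0 w + G d 1 w := by
  rw [G_eq_mul, G_eq_mul, iT_zero]; ring

lemma iT_eq_sum_G (t : Fin 2) (w : Obs 𝒳) : iT t w = G 0 t w + G 1 t w := by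
  rw [G_eq_mul, G_eq_mul, iD_zero]; ring

lemma pDx_eq_sum (d : Fin 2) : ∀ᵐ w ∂(P : Measure (Obs 𝒳)),
    pDx P d (X w) = pDTx P d 0 (X w) + pDTx P d 1 (X w) := by
  have i := fun t => integrable_of_abs_le_X (P := P) (measurable_pDTx P d t) (abs_pDTx_le d t)
  refine ae_eq_pDx (a := fun x => pDTx P d 0 x + pDTx P d 1 x) (by fun_prop)
    ((i 0).add (i 1)) d fun u hu hub => ?_
  have iu := integrable_of_abs_le_X (P := P) hu hub
  have j : ∀ t, Integrable (fun w => u (X w) * pDTx P d t (X w)) (P : Measure (Obs 𝒳)) := fun t =>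
    (i t).bdd_mul (c := 1) (hu.comp measurable_X).aestronglyMeasurable (ae_of_all _ fun w => hub _)
  have k : ∀ t, Integrable (fun w => u (X w) * G d t w) (P : Measure (Obs 𝒳)) := fun t =>
    (integrable_G d t).bdd_mul (c := 1) (hu.comp measurable_X).aestronglyMeasurable
      (ae_of_all _ fun w => hub _)
  simp only [iD_eq_sum_G, mul_add]
  rw [integral_add (k 0) (k 1), integral_add (j 0) (j 1), integral_mul_pDTx d 0 hu iu,
    integral_mul_pDTx d 1 hu iu]

lemma pTx_eq_sum (t : Fin 2) : ∀ᵐ w ∂(P : Measure (Obs 𝒳)),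
    pTx P t (X w) = pDTx P 0 t (X w) + pDTx P 1 t (X w) := by
  have i := fun d => integrable_of_abs_le_X (P := P) (measurable_pDTx P d t) (abs_pDTx_le d t)
  refine ae_eq_pTx (a := fun x => pDTx P 0 t x + pDTx P 1 t x) (by fun_prop)
    ((i 0).add (i 1)) t fun u hu hub => ?_
  have iu := integrable_of_abs_le_X (P := P) hu hub
  have j : ∀ d, Integrable (fun w => u (X w) * pDTx P d t (X w)) (P : Measure (Obs 𝒳)) := fun t =>
    (i t).bdd_mul (c := 1) (hu.comp measurable_X).aestronglyMeasurable (ae_of_all _ fun w => hub _)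
  have k : ∀ d, Integrable (fun w => u (X w) * G d t w) (P : Measure (Obs 𝒳)) := fun d =>
    (integrable_G d t).bdd_mul (c := 1) (hu.comp measurable_X).aestronglyMeasurable
      (ae_of_all _ fun w => hub _)
  simp only [iT_eq_sum_G, mul_add]
  rw [integral_add (k 0) (k 1), integral_add (j 0) (j 1), integral_mul_pDTx 0 t hu iu,
    integral_mul_pDTx 1 t hu iu]

lemma integrable_iD (d : Fin 2) : Integrable (iD d) (P : Measure (Obs 𝒳)) :=
  integrable_of_abs_le (measurable_iD d) (abs_iD_le d)

lemma integrable_iT (t : Fin 2) : Integrable (iT t) (P : Measure (Obs 𝒳)) :=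
  integrable_of_abs_le (measurable_iT t) (abs_iT_le t)

/-- `Pr(D = d, T = t | X) = Pr(D = d | T = t, X) Pr(T = t | X)`. -/
lemma pDTx_eq_mul (d t : Fin 2) : ∀ᵐ w ∂(P : Measure (Obs 𝒳)),
    pDTx P d t (X w) = pDtx P d t (X w) * pTx P t (X w) := by
  have hm : Measurable (fun x => pDtx P d t x * pTx P t x) := by fun_prop
  refine ae_eq_pDTx (a := fun x => pDtx P d t x * pTx P t x) hm
    (integrable_of_abs_le_X hm fun x => abs_mul_le_one (abs_pDtx_le d t x) (abs_pTx_le t x)) d t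
    fun u hu hub => ?_
  have iu := integrable_of_abs_le_X (P := P) hu hub
  have hum : Measurable (fun x => u x * pDtx P d t x) := by fun_prop
  have h := integral_mul_pTx (P := P) t (u := fun x => u x * pDtx P d t x) hum
    (integrable_of_abs_le_X hum fun x => abs_mul_le_one (hub x) (abs_pDtx_le d t x))
  rw [← integral_mul_pDtx d t hu iu]
  simp only [← mul_assoc]
  rw [h]
  congr 1; ext w; ring

lemma pT_eq_integral (t : Fin 2) : pT P t = ∫ w, iT t w ∂(P : Measure (Obs 𝒳)) := by
  have : (iT t : Obs 𝒳 → ℝ) = {w : Obs 𝒳 | T w = t}.indicator (fun _ => 1) := by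
    ext w; simp [iT, Set.indicator]
  have hs : MeasurableSet {w : Obs 𝒳 | T w = t} := measurable_T (measurableSet_singleton t)
  rw [this, integral_indicator hs]
  simp [pT]

lemma pD_eq_integral (d : Fin 2) : pD P d = ∫ w, iD d w ∂(P : Measure (Obs 𝒳)) := by
  have : (iD d : Obs 𝒳 → ℝ) = {w : Obs 𝒳 | D w = d}.indicator (fun _ => 1) := by
    ext w; simp [iD, Set.indicator]
  have hs : MeasurableSet {w : Obs 𝒳 | D w = d} := measurable_D (measurableSet_singleton d)
  rw [this, integral_indicator hs]
  simp [pD]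

lemma pT_nonneg (t : Fin 2) : 0 ≤ pT P t := measureReal_nonneg
lemma pT_le_one (t : Fin 2) : pT P t ≤ 1 := measureReal_le_one
lemma abs_pT_le (t : Fin 2) : |pT P t| ≤ 1 := by
  rw [abs_of_nonneg (pT_nonneg t)]; exact pT_le_one t
lemma pD_nonneg (d : Fin 2) : 0 ≤ pD P d := measureReal_nonneg
lemma pD_le_one (d : Fin 2) : pD P d ≤ 1 := measureReal_le_one
lemma abs_pD_le (d : Fin 2) : |pD P d| ≤ 1 := by
  rw [abs_of_nonneg (pD_nonneg d)]; exact pD_le_one d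

lemma integral_mul_G_of_ae {d t : Fin 2} {a : 𝒳 → ℝ}
    (h : ∀ᵐ w ∂(P : Measure (Obs 𝒳)), pDTx P d t (X w) = a (X w)) {u : 𝒳 → ℝ} (hu : Measurable u)
    (iu : Integrable (fun w => u (X w)) (P : Measure (Obs 𝒳))) :
    ∫ w, u (X w) * G d t w ∂(P : Measure (Obs 𝒳))
      = ∫ w, u (X w) * a (X w) ∂(P : Measure (Obs 𝒳)) := by
  rw [← integral_mul_pDTx d t hu iu]
  exact integral_congr_ae (h.mono fun w hw => by simp only [hw])

end CondProbIdentities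

/-! ### The relations of the settings as identities of propensity scores. -/

section Relation
variable {𝒳 : Type*} [MeasurableSpace 𝒳] {P : ProbabilityMeasure (Obs 𝒳)}

/-- The relation of a setting in terms of the conditional probabilities given the covariates. -/
def CondProbRelation (s : Setting) (P : ProbabilityMeasure (Obs 𝒳)) : Prop :=
  match s with
  | .cs1 => True
  | .cs2 => ∀ d t, ∀ᵐ w ∂(P : Measure (Obs 𝒳)), pDTx P d t (X w) = pDx P d (X w) * pTx P t (X w)
  | .cs3 => ∀ t, ∀ᵐ w ∂(P : Measure (Obs 𝒳)), pTx P t (X w) = pT P t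
  | .cs4 => ∀ d t, ∀ᵐ w ∂(P : Measure (Obs 𝒳)), pDTx P d t (X w) = pDx P d (X w) * pT P t
  | .cs5 => ∀ d t, ∀ᵐ w ∂(P : Measure (Obs 𝒳)), pDTx P d t (X w) = pD P d * pT P t

lemma indicator_D_eq (a : Set (Fin 2)) (w : Obs 𝒳) :
    (D ⁻¹' a).indicator (fun _ => (1 : ℝ)) w = ∑ d : Fin 2, a.indicator (fun _ => 1) d * iD d w := by
  rw [Finset.sum_eq_single (D w)]
  · by_cases h : D w ∈ a <;> simp [iD, h]
  · intro d _ hd; simp [iD, Ne.symm hd]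
  · simp

lemma indicator_T_eq (a : Set (Fin 2)) (w : Obs 𝒳) :
    (T ⁻¹' a).indicator (fun _ => (1 : ℝ)) w = ∑ t : Fin 2, a.indicator (fun _ => 1) t * iT t w := by
  rw [Finset.sum_eq_single (T w)]
  · by_cases h : T w ∈ a <;> simp [iT, h]
  · intro d _ hd; simp [iT, Ne.symm hd]
  · simp

lemma real_eq_integral {A : Set (Obs 𝒳)} (hA : MeasurableSet A) :
    (P : Measure (Obs 𝒳)).real A = ∫ w, A.indicator (fun _ => (1 : ℝ)) w ∂(P : Measure (Obs 𝒳)) := by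
  rw [integral_indicator hA]; simp

lemma abs_indicator_le {α : Type*} (A : Set α) (x : α) : |A.indicator (fun _ => (1 : ℝ)) x| ≤ 1 := by
  by_cases h : x ∈ A <;> simp [h]

lemma measure_eq_of_real {A : Set (Obs 𝒳)} {a b : ENNReal} (ha : a ≠ ⊤) (hb : b ≠ ⊤)
    (h : (P : Measure (Obs 𝒳)).real A = a.toReal * b.toReal) :
    (P : Measure (Obs 𝒳)) A = a * b := by
  rw [← ENNReal.toReal_eq_toReal_iff' (measure_ne_top _ _) (ENNReal.mul_ne_top ha hb),
    ENNReal.toReal_mul]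
  exact h

lemma real_preimage_T (a : Set (Fin 2)) :
    (P : Measure (Obs 𝒳)).real (T ⁻¹' a) = ∑ t : Fin 2, a.indicator (fun _ => 1) t * pT P t := by
  rw [real_eq_integral (measurable_T (MeasurableSet.of_discrete))]
  simp only [indicator_T_eq]
  rw [integral_finsetSum _ fun t _ => (integrable_iT t).const_mul _]
  simp only [integral_const_mul, pT_eq_integral]

lemma real_preimage_D (a : Set (Fin 2)) :
    (P : Measure (Obs 𝒳)).real (D ⁻¹' a) = ∑ d : Fin 2, a.indicator (fun _ => 1) d * pD P d := by
  rw [real_eq_integral (measurable_D (MeasurableSet.of_discrete))]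
  simp only [indicator_D_eq]
  rw [integral_finsetSum _ fun t _ => (integrable_iD t).const_mul _]
  simp only [integral_const_mul, pD_eq_integral]

/-- Since T has finitely many values, the indicator of any event of T is a combination of the `iT
t`, so the product formula needs checking only against these. -/
lemma indepFun_T_iff {B : Type*} [MeasurableSpace B] {V : Obs 𝒳 → B} (hV : Measurable V) :
    IndepFun V T (P : Measure (Obs 𝒳)) ↔ ∀ t, ∀ u : B → ℝ, Measurable u → (∀ x, |u x| ≤ 1) →
      ∫ w, u (V w) * iT t w ∂(P : Measure (Obs 𝒳))
        = (∫ w, u (V w) ∂(P : Measure (Obs 𝒳))) * pT P t := by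
  constructor
  · intro h t u hu _
    have hψ : Measurable (fun e : Fin 2 => if e = t then (1 : ℝ) else 0) := measurable_of_finite _
    have := (h.comp hu hψ).integral_fun_mul_eq_mul_integral
      (hu.comp hV).aestronglyMeasurable (hψ.comp measurable_T).aestronglyMeasurable
    simp only [Function.comp] at this
    rw [pT_eq_integral]
    exact this
  · intro h
    refine indepFun_iff_measure_inter_preimage_eq_mul.2 fun A B hA _ => ?_
    refine measure_eq_of_real (measure_ne_top _ _) (measure_ne_top _ _) ?_
    change _ = (P : Measure (Obs 𝒳)).real _ * (P : Measure (Obs 𝒳)).real _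
    have hB : MeasurableSet (T ⁻¹' B : Set (Obs 𝒳)) := measurable_T (MeasurableSet.of_discrete)
    have hu : Measurable (A.indicator (fun _ => (1 : ℝ))) := measurable_const.indicator hA
    rw [real_eq_integral ((hV hA).inter hB), real_eq_integral (hV hA), real_preimage_T]
    have e : ∀ w : Obs 𝒳, (V ⁻¹' A ∩ T ⁻¹' B).indicator (fun _ => (1 : ℝ)) w
        = ∑ t : Fin 2, B.indicator (fun _ => 1) t * (A.indicator (fun _ => (1 : ℝ)) (V w) * iT t w) := by
      intro w
      have h1 := indicator_T_eq B w
      have h2 : (V ⁻¹' A ∩ T ⁻¹' B).indicator (fun _ => (1 : ℝ)) w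
          = A.indicator (fun _ => (1 : ℝ)) (V w) * (T ⁻¹' B).indicator (fun _ => (1 : ℝ)) w := by
        by_cases ha : V w ∈ A <;> by_cases hb : T w ∈ B <;> simp [ha, hb]
      rw [h2, h1, Finset.mul_sum]
      exact Finset.sum_congr rfl fun t _ => by ring
    simp only [e]
    have i : ∀ t : Fin 2, Integrable (fun w => A.indicator (fun _ => (1 : ℝ)) (V w) * iT t w)
        (P : Measure (Obs 𝒳)) := fun t =>
      integrable_of_abs_le (M := 1) ((hu.comp hV).mul (measurable_iT t))
        fun w => abs_mul_le_one (abs_indicator_le A _) (abs_iT_le t w)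
    rw [integral_finsetSum _ fun t _ => (i t).const_mul _]
    simp only [integral_const_mul]
    rw [Finset.mul_sum]
    refine Finset.sum_congr rfl fun t _ => ?_
    rw [h t _ hu (abs_indicator_le A)]
    have : ∀ w, (V ⁻¹' A).indicator (fun _ => (1 : ℝ)) w = A.indicator (fun _ => (1 : ℝ)) (V w) :=
      fun w => rfl
    simp only [this, mul_left_comm]

lemma indepFun_X_T_iff : IndepFun X T (P : Measure (Obs 𝒳)) ↔ CondProbRelation .cs3 P := by
  rw [indepFun_T_iff measurable_X]
  constructor
  · intro h t
    refine ae_eq_pTx (a := fun _ => pT P t) measurable_const (integrable_const _) t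
      fun u hu hub => ?_
    rw [h t u hu hub, integral_mul_const]
  · intro h t u hu hub
    rw [← integral_mul_pTx t hu (integrable_of_abs_le_X hu hub), ← integral_mul_const]
    exact integral_congr_ae ((h t).mono fun w hw => by simp only [hw])

lemma eval_DX_eq_sum (u : Fin 2 × 𝒳 → ℝ) (w : Obs 𝒳) :
    u (D w, X w) = ∑ d : Fin 2, u (d, X w) * iD d w := by
  rw [Finset.sum_eq_single (D w)]
  · simp [iD]
  · intro d _ hd; simp [iD, Ne.symm hd]
  · simp

/-- A function of (D,X) is the sum over d of u(d,X) times the indicator of D = d, which reduces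
independence from T to one identity for each cell. -/
lemma indepFun_DX_T_iff :
    IndepFun (fun w : Obs 𝒳 => (D w, X w)) T (P : Measure (Obs 𝒳)) ↔ CondProbRelation .cs4 P := by
  rw [indepFun_T_iff (measurable_D.prodMk measurable_X)]
  constructor
  · intro h d t
    have hm : Measurable (fun x => pDx P d x * pT P t) := (measurable_pDx P d).mul_const _
    refine ae_eq_pDTx (a := fun x => pDx P d x * pT P t) hm
      (integrable_of_abs_le_X hm fun x => abs_mul_le_one (abs_pDx_le d x) (abs_pT_le t)) d t
      fun u hu hub => ?_
    have hψ : Measurable (fun e : Fin 2 => if e = d then (1 : ℝ) else 0) := measurable_of_finite _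
    have := h t (fun v => u v.2 * if v.1 = d then 1 else 0)
      ((hu.comp measurable_snd).mul (hψ.comp measurable_fst))
      (fun v => abs_mul_le_one (hub _) (by split_ifs <;> simp))
    have e : ∀ w, u (X w) * G d t w = u (X w) * (if D w = d then 1 else 0) * iT t w := fun w => by
      rw [G_eq_mul, iD]; ring
    simp only [e]
    have h2 := integral_mul_pDx (P := P) d hu (integrable_of_abs_le_X hu hub)
    simp only [← mul_assoc]
    rw [this, integral_mul_const, h2]
    rfl
  · intro h t u hu hub
    have hm : ∀ d, Measurable fun x => u (d, x) := fun d => hu.comp measurable_prodMk_left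
    have iu := fun d => integrable_of_abs_le_X (P := P) (hm d) fun x => hub (d, x)
    have iuG : ∀ d, Integrable (fun w => u (d, X w) * G d t w) (P : Measure (Obs 𝒳)) := fun d =>
      (integrable_G d t).bdd_mul (c := 1) ((hm d).comp measurable_X).aestronglyMeasurable
        (ae_of_all _ fun w => hub _)
    have iuD : ∀ d, Integrable (fun w => u (d, X w) * iD d w) (P : Measure (Obs 𝒳)) := fun d =>
      (integrable_iD d).bdd_mul (c := 1) ((hm d).comp measurable_X).aestronglyMeasurable
        (ae_of_all _ fun w => hub _)
    have e : ∀ w : Obs 𝒳, u (D w, X w) * iT t w = ∑ d : Fin 2, u (d, X w) * G d t w := fun w => by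
      rw [eval_DX_eq_sum u, Finset.sum_mul]
      exact Finset.sum_congr rfl fun d _ => by rw [G_eq_mul]; ring
    simp only [e]
    simp only [eval_DX_eq_sum u]
    rw [integral_finsetSum _ fun d _ => iuG d, integral_finsetSum _ fun d _ => iuD d,
      Finset.sum_mul]
    refine Finset.sum_congr rfl fun d _ => ?_
    rw [integral_mul_G_of_ae (a := fun x => pDx P d x * pT P t) (h d t) (hm d) (iu d)]
    simp only [← mul_assoc]
    rw [integral_mul_const, integral_mul_pDx d (hm d) (iu d)]

/-- The integral of the propensity score over {X ∈ C} is the mass of the cell within that event, and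
such integrals determine it. -/
lemma ae_eq_pDTx_of_measure {d t : Fin 2} {k : ℝ}
    (h : ∀ C : Set 𝒳, MeasurableSet C → (P : Measure (Obs 𝒳)).real
      (D ⁻¹' {d} ∩ T ⁻¹' {t} ∩ X ⁻¹' C) = k * (P : Measure (Obs 𝒳)).real (X ⁻¹' C)) :
    ∀ᵐ w ∂(P : Measure (Obs 𝒳)), pDTx P d t (X w) = k := by
  have ip : Integrable (pDTx P d t) (lawX P) :=
    (integrable_map_measure (measurable_pDTx P d t).aestronglyMeasurable
      measurable_X.aemeasurable).2 (integrable_of_abs_le_X (measurable_pDTx P d t) (abs_pDTx_le d t))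
  have : IsFiniteMeasure (lawX P) := Measure.isFiniteMeasure_map _ _
  refine ae_lawX_iff P (p := fun x => pDTx P d t x = k) ?_
  refine Integrable.ae_eq_of_forall_setIntegral_eq _ (fun _ => k) ip (integrable_const k)
    fun C hC _ => ?_
  have hu : Measurable (C.indicator (fun _ => (1 : ℝ))) := measurable_const.indicator hC
  have h1 := integral_mul_pDTx (P := P) d t hu (integrable_of_abs_le_X hu (abs_indicator_le C))
  have hcell : MeasurableSet (D ⁻¹' {d} ∩ T ⁻¹' {t} ∩ X ⁻¹' C : Set (Obs 𝒳)) :=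
    ((measurable_D (measurableSet_singleton d)).inter (measurable_T (measurableSet_singleton t))).inter
      (measurable_X hC)
  have h2 := h C hC
  rw [real_eq_integral hcell] at h2
  have e1 : ∀ w : Obs 𝒳, (D ⁻¹' {d} ∩ T ⁻¹' {t} ∩ X ⁻¹' C).indicator (fun _ => (1 : ℝ)) w
      = C.indicator (fun _ => 1) (X w) * G d t w := by
    intro w
    by_cases hc : X w ∈ C <;> by_cases hd : D w = d <;> by_cases ht : T w = t <;>
      simp [G, hc, hd, ht]
  simp only [e1] at h2
  unfold lawX at ip ⊢
  rw [setIntegral_map hC (measurable_pDTx P d t).aestronglyMeasurable measurable_X.aemeasurable,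
    ← integral_indicator (measurable_X hC)]
  have e2 : (fun w => (X ⁻¹' C).indicator (fun w => pDTx P d t (X w)) w)
      = fun w : Obs 𝒳 => C.indicator (fun _ => 1) (X w) * pDTx P d t (X w) := by
    ext w; by_cases hc : X w ∈ C <;> simp [hc]
  rw [e2, h1, h2, setIntegral_const, smul_eq_mul, mul_comm, measureReal_def, measureReal_def,
    Measure.map_apply measurable_X hC]

lemma iIndep_DTX_iff :
    iIndep ![MeasurableSpace.comap D inferInstance, MeasurableSpace.comap T inferInstance,
      MeasurableSpace.comap X inferInstance] (P : Measure (Obs 𝒳)) ↔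
    ∀ (a b : Set (Fin 2)) (C : Set 𝒳), MeasurableSet C →
      (P : Measure (Obs 𝒳)).real (D ⁻¹' a ∩ T ⁻¹' b ∩ X ⁻¹' C)
        = (P : Measure (Obs 𝒳)).real (D ⁻¹' a) * (P : Measure (Obs 𝒳)).real (T ⁻¹' b)
          * (P : Measure (Obs 𝒳)).real (X ⁻¹' C) := by
  constructor
  · intro h a b C hC
    have := h.meas_iInter (s := ![D ⁻¹' a, T ⁻¹' b, X ⁻¹' C]) (by
      intro i
      fin_cases i
      · exact ⟨a, MeasurableSet.of_discrete, rfl⟩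
      · exact ⟨b, MeasurableSet.of_discrete, rfl⟩
      · exact ⟨C, hC, rfl⟩)
    have e : (⋂ i, (![D ⁻¹' a, T ⁻¹' b, X ⁻¹' C] : Fin 3 → Set (Obs 𝒳)) i)
        = D ⁻¹' a ∩ T ⁻¹' b ∩ X ⁻¹' C := by
      ext w; simp [Fin.forall_fin_succ, and_assoc]
    rw [e, Fin.prod_univ_three] at this
    simp only [measureReal_def, this, ENNReal.toReal_mul]
    rfl
  · intro h
    rw [iIndep_iff]
    intro S f hf
    -- Indices outside S are filled with the whole space, which reduces every finite subfamily to
    -- the formula with three factors.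
    have key : ∀ i, ∃ g : Set (Obs 𝒳),
        MeasurableSet[(![MeasurableSpace.comap D inferInstance, MeasurableSpace.comap T inferInstance,
          MeasurableSpace.comap X inferInstance] : Fin 3 → MeasurableSpace (Obs 𝒳)) i] g ∧
        g = if i ∈ S then f i else Set.univ := by
      intro i
      by_cases hi : i ∈ S
      · exact ⟨f i, hf i hi, by simp [hi]⟩
      · exact ⟨Set.univ, MeasurableSet.univ, by simp [hi]⟩
    choose g hg hgf using key
    obtain ⟨a, _, ha⟩ := hg 0
    obtain ⟨b, _, hb⟩ := hg 1
    obtain ⟨C, hC, hc⟩ := hg 2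
    have e : (⋂ i ∈ S, f i) = D ⁻¹' a ∩ T ⁻¹' b ∩ X ⁻¹' C := by
      have : (⋂ i ∈ S, f i) = ⋂ i, g i := by
        ext w
        simp only [Set.mem_iInter, hgf]
        refine forall_congr' fun i => ?_
        by_cases hi : i ∈ S <;> simp [hi]
      rw [this, ha, hb, hc]
      ext w; simp [Fin.forall_fin_succ, and_assoc]
    have e' : ∏ i ∈ S, (P : Measure (Obs 𝒳)) (f i) = ∏ i, (P : Measure (Obs 𝒳)) (g i) := by
      rw [← Finset.prod_subset (Finset.subset_univ S) fun i _ hi => by simp [hgf, hi]]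
      exact Finset.prod_congr rfl fun i hi => by simp [hgf, hi]
    rw [e, e', Fin.prod_univ_three]
    have := h a b C hC
    rw [← ha, ← hb, ← hc]
    refine measure_eq_of_real (ENNReal.mul_ne_top (measure_ne_top _ _) (measure_ne_top _ _))
      (measure_ne_top _ _) ?_
    rw [ENNReal.toReal_mul]
    exact this

lemma relation_cs5_iff [StandardBorelSpace 𝒳] : Relation .cs5 P ↔ CondProbRelation .cs5 P := by
  unfold Relation
  rw [iIndep_DTX_iff]
  constructor
  · exact fun h d t => ae_eq_pDTx_of_measure fun C hC => h {d} {t} C hC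
  · intro h a b C hC
    have hu : Measurable (C.indicator (fun _ => (1 : ℝ))) := measurable_const.indicator hC
    have iu := integrable_of_abs_le_X (P := P) hu (abs_indicator_le C)
    have hset : MeasurableSet (D ⁻¹' a ∩ T ⁻¹' b ∩ X ⁻¹' C : Set (Obs 𝒳)) :=
      ((measurable_D MeasurableSet.of_discrete).inter (measurable_T MeasurableSet.of_discrete)).inter
        (measurable_X hC)
    rw [real_eq_integral hset, real_preimage_D, real_preimage_T, real_eq_integral (measurable_X hC)]
    have e1 : ∀ w : Obs 𝒳, (D ⁻¹' a ∩ T ⁻¹' b ∩ X ⁻¹' C).indicator (fun _ => (1 : ℝ)) w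
        = ∑ d : Fin 2, ∑ t : Fin 2, a.indicator (fun _ => 1) d * b.indicator (fun _ => 1) t *
          (C.indicator (fun _ => 1) (X w) * G d t w) := by
      intro w
      have h1 : (D ⁻¹' a ∩ T ⁻¹' b ∩ X ⁻¹' C).indicator (fun _ => (1 : ℝ)) w
          = (D ⁻¹' a).indicator (fun _ => (1 : ℝ)) w * (T ⁻¹' b).indicator (fun _ => (1 : ℝ)) w
            * C.indicator (fun _ => 1) (X w) := by
        by_cases hc : X w ∈ C <;> by_cases hd : D w ∈ a <;> by_cases ht : T w ∈ b <;>
          simp [hc, hd, ht]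
      rw [h1, indicator_D_eq, indicator_T_eq, Finset.sum_mul_sum, Finset.sum_mul]
      refine Finset.sum_congr rfl fun d _ => ?_
      rw [Finset.sum_mul]
      refine Finset.sum_congr rfl fun t _ => ?_
      rw [G_eq_mul]; ring
    have i1 : ∀ d t, Integrable (fun w => a.indicator (fun _ => 1) d * b.indicator (fun _ => 1) t *
          (C.indicator (fun _ => 1) (X w) * G d t w)) (P : Measure (Obs 𝒳)) := fun d t =>
      ((integrable_G d t).bdd_mul (c := 1) (hu.comp measurable_X).aestronglyMeasurable
        (ae_of_all _ fun w => abs_indicator_le C _)).const_mul _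
    have e2 : ∀ w : Obs 𝒳, (X ⁻¹' C).indicator (fun _ => (1 : ℝ)) w
        = C.indicator (fun _ => (1 : ℝ)) (X w) := fun w => rfl
    simp only [e1, e2]
    rw [integral_finsetSum _ fun d _ => integrable_finsetSum _ fun t _ => i1 d t,
      Finset.sum_mul_sum, Finset.sum_mul]
    refine Finset.sum_congr rfl fun d _ => ?_
    rw [integral_finsetSum _ fun t _ => i1 d t, Finset.sum_mul]
    refine Finset.sum_congr rfl fun t _ => ?_
    rw [integral_const_mul, integral_mul_G_of_ae (a := fun _ => pD P d * pT P t) (h d t) hu iu,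
      integral_mul_const]
    ring

lemma measureReal_eq_sum {α : Type*} [Fintype α] [MeasurableSpace α] [MeasurableSingletonClass α]
    (ρ : Measure α) [IsFiniteMeasure ρ] (s : Set α) :
    ρ.real s = ∑ a, s.indicator (fun _ => (1 : ℝ)) a * ρ.real {a} := by
  classical
  have h := sum_measureReal_singleton (μ := ρ) (Finset.univ.filter (· ∈ s))
  have e : ((Finset.univ.filter (· ∈ s) : Finset α) : Set α) = s := by ext; simp
  rw [e] at h
  rw [← h, Finset.sum_filter]
  refine Finset.sum_congr rfl fun a _ => ?_
  by_cases ha : a ∈ s <;> simp [ha]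

/-- Conditional independence is the product formula for conditional probabilities of arbitrary
events of D and T; given X these laws live on finite sets and are determined by their atoms. -/
lemma relation_cs2_iff [StandardBorelSpace 𝒳] : Relation .cs2 P ↔ CondProbRelation .cs2 P := by
  unfold Relation
  simp only
  rw [condIndepFun_iff_condExp_inter_preimage_eq_mul measurable_D measurable_T]
  have hDT : ∀ a b : Set (Fin 2), (fun w => (condDistrib (fun w : Obs 𝒳 => (D w, T w)) X
      (P : Measure (Obs 𝒳)) (X w)).real (a ×ˢ b)) =ᵐ[(P : Measure (Obs 𝒳))]
      (P : Measure (Obs 𝒳))⟦D ⁻¹' a ∩ T ⁻¹' b | MeasurableSpace.comap X inferInstance⟧ := fun a b =>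
    condDistrib_ae_eq_condExp measurable_X (measurable_D.prodMk measurable_T)
      (s := a ×ˢ b) MeasurableSet.of_discrete
  have hD : ∀ a : Set (Fin 2), (fun w => (condDistrib D X
      (P : Measure (Obs 𝒳)) (X w)).real a) =ᵐ[(P : Measure (Obs 𝒳))]
      (P : Measure (Obs 𝒳))⟦D ⁻¹' a | MeasurableSpace.comap X inferInstance⟧ := fun a =>
    condDistrib_ae_eq_condExp measurable_X measurable_D MeasurableSet.of_discrete
  have hT : ∀ a : Set (Fin 2), (fun w => (condDistrib T X
      (P : Measure (Obs 𝒳)) (X w)).real a) =ᵐ[(P : Measure (Obs 𝒳))]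
      (P : Measure (Obs 𝒳))⟦T ⁻¹' a | MeasurableSpace.comap X inferInstance⟧ := fun a =>
    condDistrib_ae_eq_condExp measurable_X measurable_T MeasurableSet.of_discrete
  constructor
  · intro h d t
    filter_upwards [h {d} {t} (measurableSet_singleton d) (measurableSet_singleton t),
      hDT {d} {t}, hD {d}, hT {t}] with w e1 e2 e3 e4
    rw [← e2, ← e3, ← e4, Set.singleton_prod_singleton] at e1
    exact e1
  · intro h a b _ _
    have h' : ∀ᵐ w ∂(P : Measure (Obs 𝒳)), ∀ d t,
        pDTx P d t (X w) = pDx P d (X w) * pTx P t (X w) :=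
      ae_all_iff.2 fun d => ae_all_iff.2 fun t => h d t
    filter_upwards [h', hDT a b, hD a, hT b] with w e1 e2 e3 e4
    rw [← e2, ← e3, ← e4, measureReal_eq_sum _ (a ×ˢ b), measureReal_eq_sum _ a,
      measureReal_eq_sum _ b, Fintype.sum_prod_type, Finset.sum_mul_sum]
    refine Finset.sum_congr rfl fun d _ => Finset.sum_congr rfl fun t _ => ?_
    have := e1 d t
    unfold pDTx pDx pTx condProb at this
    rw [this]
    by_cases hd : d ∈ a <;> by_cases ht : t ∈ b <;> simp [hd, ht]

/-- Each relation is a statement on the conditional probabilities given the covariates. -/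
lemma relation_iff [StandardBorelSpace 𝒳] (s : Setting) : Relation s P ↔ CondProbRelation s P := by
  cases s with
  | cs1 => exact Iff.rfl
  | cs2 => exact relation_cs2_iff
  | cs3 => exact indepFun_X_T_iff
  | cs4 => exact indepFun_DX_T_iff
  | cs5 => exact relation_cs5_iff

end Relation
end DiD

namespace DiD

/-! ### Regression calculus, and the common form of q in the five settings. -/

section Regression
variable {𝒳 : Type*} [MeasurableSpace 𝒳] {P : ProbabilityMeasure (Obs 𝒳)}

/-- `ρ(X)` is the conditional mean of `f` given `X`, as tested on integrable functions of `X`. -/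
def RegressesTo (P : ProbabilityMeasure (Obs 𝒳)) (f : Obs 𝒳 → ℝ) (ρ : 𝒳 → ℝ) : Prop :=
  ∀ g : 𝒳 → ℝ, Measurable g → Integrable (fun w => g (X w)) (P : Measure (Obs 𝒳)) →
    Integrable (fun w => f w * g (X w)) (P : Measure (Obs 𝒳)) ∧
    Integrable (fun w => ρ (X w) * g (X w)) (P : Measure (Obs 𝒳)) ∧
    ∫ w, f w * g (X w) ∂(P : Measure (Obs 𝒳)) = ∫ w, ρ (X w) * g (X w) ∂(P : Measure (Obs 𝒳))

namespace RegressesTo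
variable {f f' : Obs 𝒳 → ℝ} {ρ ρ' a : 𝒳 → ℝ}

lemma of_bounded {M : ℝ} (hf : Measurable f) (hM : ∀ w, |f w| ≤ M) {N : ℝ} (hρ : Measurable ρ)
    (hN : ∀ x, |ρ x| ≤ N)
    (h : ∀ u : 𝒳 → ℝ, Measurable u → Integrable (fun w => u (X w)) (P : Measure (Obs 𝒳)) →
      ∫ w, u (X w) * ρ (X w) ∂(P : Measure (Obs 𝒳)) = ∫ w, u (X w) * f w ∂(P : Measure (Obs 𝒳))) :
    RegressesTo P f ρ := by
  intro g hg ig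
  refine ⟨ig.bdd_mul (c := M) hf.aestronglyMeasurable (ae_of_all _ hM),
    ig.bdd_mul (c := N) (hρ.comp measurable_X).aestronglyMeasurable (ae_of_all _ fun w => hN _), ?_⟩
  simp only [mul_comm _ (g _)]
  exact (h g hg ig).symm

lemma cell (d t : Fin 2) : RegressesTo P (G d t) (pDTx P d t) :=
  of_bounded (measurable_G d t) (abs_G_le d t) (measurable_pDTx P d t) (abs_pDTx_le d t)
    fun _ hu iu => integral_mul_pDTx d t hu iu

lemma group (d : Fin 2) : RegressesTo P (iD d) (pDx P d) :=
  of_bounded (measurable_iD d) (abs_iD_le d) (measurable_pDx P d) (abs_pDx_le d)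
    fun _ hu iu => integral_mul_pDx d hu iu

lemma period (t : Fin 2) : RegressesTo P (iT t) (pTx P t) :=
  of_bounded (measurable_iT t) (abs_iT_le t) (measurable_pTx P t) (abs_pTx_le t)
    fun _ hu iu => integral_mul_pTx t hu iu

lemma of_X {M : ℝ} (ha : Measurable a) (hM : ∀ x, |a x| ≤ M) :
    RegressesTo P (fun w => a (X w)) a :=
  of_bounded (ha.comp measurable_X) (fun w => hM (X w)) ha hM fun _ _ _ => rfl

lemma add (h : RegressesTo P f ρ) (h' : RegressesTo P f' ρ') :
    RegressesTo P (fun w => f w + f' w) (fun x => ρ x + ρ' x) := by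
  intro g hg ig
  obtain ⟨i1, i2, e⟩ := h g hg ig
  obtain ⟨j1, j2, e'⟩ := h' g hg ig
  simp only [add_mul]
  exact ⟨i1.add j1, i2.add j2, by rw [integral_add i1 j1, integral_add i2 j2, e, e']⟩

lemma sub (h : RegressesTo P f ρ) (h' : RegressesTo P f' ρ') :
    RegressesTo P (fun w => f w - f' w) (fun x => ρ x - ρ' x) := by
  intro g hg ig
  obtain ⟨i1, i2, e⟩ := h g hg ig
  obtain ⟨j1, j2, e'⟩ := h' g hg ig
  simp only [sub_mul]
  exact ⟨i1.sub j1, i2.sub j2, by rw [integral_sub i1 j1, integral_sub i2 j2, e, e']⟩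

lemma mul_X (h : RegressesTo P f ρ) {M : ℝ} (ha : Measurable a) (hM : ∀ x, |a x| ≤ M) :
    RegressesTo P (fun w => a (X w) * f w) (fun x => a x * ρ x) := by
  intro g hg ig
  have := h (fun x => a x * g x) (ha.mul hg)
    (ig.bdd_mul (c := M) (ha.comp measurable_X).aestronglyMeasurable (ae_of_all _ fun w => hM _))
  simp only [mul_left_comm _ (a _), ← mul_assoc] at this
  exact this

lemma congr (h : RegressesTo P f ρ) (e : ∀ᵐ w ∂(P : Measure (Obs 𝒳)), ρ (X w) = ρ' (X w)) :
    RegressesTo P f ρ' := by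
  intro g hg ig
  obtain ⟨i1, i2, e'⟩ := h g hg ig
  have e2 : (fun w => ρ (X w) * g (X w)) =ᵐ[(P : Measure (Obs 𝒳))] fun w => ρ' (X w) * g (X w) :=
    e.mono fun w hw => by simp only [hw]
  exact ⟨i1, i2.congr e2, e'.trans (integral_congr_ae e2)⟩

/-- The form in which the mean properties of `Adjustment` are verified: it remains to compute the
regression of the weight on X. -/
lemma integral_eq (h : RegressesTo P f ρ) {k : ℝ}
    (e : ∀ᵐ w ∂(P : Measure (Obs 𝒳)), ρ (X w) = k * pDTx P 1 1 (X w)) {g : 𝒳 → ℝ}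
    (hg : Measurable g) (ig : Integrable (fun w => g (X w)) (P : Measure (Obs 𝒳))) :
    ∫ w, f w * g (X w) ∂(P : Measure (Obs 𝒳))
      = k * ∫ w, G 1 1 w * g (X w) ∂(P : Measure (Obs 𝒳)) := by
  rw [(h.congr (ρ' := fun x => k * pDTx P 1 1 x) e g hg ig).2.2, (cell 1 1 g hg ig).2.2,
    ← integral_const_mul]
  simp only [mul_assoc]

end RegressesTo

lemma Support.le_pT {c : ℝ} (hc : 0 < c) (h : Support P c) (t : Fin 2) : c ≤ pT P t := by
  rw [pT_eq_integral]
  refine (h.le_integral_G hc 0 t).trans (integral_mono (integrable_G 0 t) (integrable_iT t) fun w => ?_)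
  simp only [iT_eq_sum_G]
  linarith [G_nonneg 1 t w]

lemma Support.le_pD {c : ℝ} (hc : 0 < c) (h : Support P c) (d : Fin 2) : c ≤ pD P d := by
  rw [pD_eq_integral]
  refine (h.le_integral_G hc d 0).trans (integral_mono (integrable_G d 0) (integrable_iD d) fun w => ?_)
  simp only [iD_eq_sum_G]
  linarith [G_nonneg d 1 w]

lemma pDT_eq_of_ae {k : ℝ} {a : 𝒳 → ℝ}
    (h : ∀ᵐ w ∂(P : Measure (Obs 𝒳)), pDTx P 1 1 (X w) = a (X w) * k) :
    pDT P = (∫ w, a (X w) ∂(P : Measure (Obs 𝒳))) * k := by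
  have := integral_mul_G_of_ae (P := P) (a := fun x => a x * k) h (u := fun _ => 1)
    measurable_const (integrable_const _)
  simp only [one_mul] at this
  rw [pDT_eq_integral, this, integral_mul_const]

lemma pDT_eq_mul_of_cs4 (h : CondProbRelation .cs4 P) : pDT P = pD P 1 * pT P 1 := by
  rw [pDT_eq_of_ae (h 1 1), pD_eq_integral]
  congr 1
  have := integral_mul_pDx (P := P) 1 (u := fun _ => 1) measurable_const (integrable_const _)
  simpa only [one_mul] using this

lemma pDT_eq_mul_of_cs5 (h : CondProbRelation .cs5 P) : pDT P = pD P 1 * pT P 1 := by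
  rw [pDT_eq_of_ae (a := fun _ => pD P 1) (h 1 1)]
  simp

lemma pD1_mul_pT (h : pT P 1 ≠ 0) : pD1 P * pT P 1 = pDT P := by
  have hs : MeasurableSet {w : Obs 𝒳 | T w = 1} := measurable_T (measurableSet_singleton 1)
  unfold pD1 pT pDT at *
  rw [measureReal_def, cond_apply hs, ENNReal.toReal_mul, ENNReal.toReal_inv, mul_comm, ← mul_assoc]
  change _ * ((P : Measure (Obs 𝒳)).real _)⁻¹ * (P : Measure (Obs 𝒳)).real _ = _
  rw [mul_inv_cancel₀ h, one_mul]
  congr 1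
  ext w
  simp [and_comm]

/-- The denominator of the influence function is `Pr(D = 1, T = 1)` in every setting. -/
lemma q_eq_pDT {s : Setting} {c : ℝ} (hc : 0 < c) (hs : Support P c) (h : CondProbRelation s P) :
    q s P = pDT P := by
  cases s with
  | cs1 => rfl
  | cs2 => rfl
  | cs3 => exact pD1_mul_pT (hc.trans_le (hs.le_pT hc 1)).ne'
  | cs4 => exact (pDT_eq_mul_of_cs4 h).symm
  | cs5 => exact (pDT_eq_mul_of_cs5 h).symm

/-- The weights of the influence function are the cell propensity scores in every setting. -/
lemma qx_ae_eq {s : Setting} (h : CondProbRelation s P) (d t : Fin 2) :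
    ∀ᵐ w ∂(P : Measure (Obs 𝒳)), qx s P d t (X w) = pDTx P d t (X w) := by
  cases s with
  | cs1 => exact ae_of_all _ fun _ => rfl
  | cs2 => exact (h d t).mono fun w hw => hw.symm
  | cs3 =>
    filter_upwards [pDTx_eq_mul (P := P) d t, h t] with w e1 e2
    rw [e1, e2]; rfl
  | cs4 => exact (h d t).mono fun w hw => hw.symm
  | cs5 => exact (h d t).mono fun w hw => hw.symm

end Regression

/-! ### Doubly robust weights of the five settings. -/

section Weights
variable {𝒳 : Type*} [MeasurableSpace 𝒳]

/-- The weight whose conditional mean given `X` under `R` is proportional to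
`Pr_R(D = 1, T = 1 | X)`, built from nuisance functions at `P` and at `R`. -/
def weight (s : Setting) (P R : ProbabilityMeasure (Obs 𝒳)) (w : Obs 𝒳) : ℝ :=
  match s with
  | .cs1 => G 1 1 w
  -- Given X, the terms with `pDx P` cancel under R and leave the product of the two scores at R;
  -- under P the terms with `pTx R` cancel and leave the product at P.
  | .cs2 => pTx R 1 (X w) * iD 1 w + pDx P 1 (X w) * iT 1 w - pDx P 1 (X w) * pTx R 1 (X w)
  -- Given X, the score `pDtx P` cancels under R because Pr(T=1|X) is `pT R 1`; under P the bracket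
  -- has mean zero and only `pDtx P` is left. In both cases this is the treated score divided by
  -- Pr(T=1).
  | .cs3 => (pT R 1)⁻¹ * (G 1 1 w - pDtx P 1 1 (X w) * iT 1 w) + pDtx P 1 1 (X w)
  | .cs4 => iD 1 w
  | .cs5 => 1

/-- The proportionality constant of `weight`. -/
def weightScale (s : Setting) (R : ProbabilityMeasure (Obs 𝒳)) : ℝ :=
  match s with
  | .cs1 => 1
  | .cs2 => 1
  | .cs3 => (pT R 1)⁻¹
  | .cs4 => (pT R 1)⁻¹
  | .cs5 => (pD R 1 * pT R 1)⁻¹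

variable {P R : ProbabilityMeasure (Obs 𝒳)}

lemma measurable_weight (s : Setting) : Measurable (weight s P R) := by
  have := @measurable_X 𝒳 _
  have h1 := (measurable_pTx R 1).comp this
  have h2 := (measurable_pDx P 1).comp this
  have h3 := (measurable_pDtx P 1 1).comp this
  have h4 := @measurable_iD 𝒳 _ 1
  have h5 := @measurable_iT 𝒳 _ 1
  have h6 := @measurable_G 𝒳 _ 1 1
  cases s with
  | cs1 => exact h6
  | cs2 => exact ((h1.mul h4).add (h2.mul h5)).sub (h2.mul h1)
  | cs3 => exact ((h6.sub (h3.mul h5)).const_mul _).add h3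
  | cs4 => exact h4
  | cs5 => exact measurable_const

/-- The 3 comes from the three terms in (CS-2); in (CS-3) the inverse of Pr(T=1) is at most 1/c and
multiplies a difference of size at most 2. -/
lemma abs_weight_le {c : ℝ} (hc : 0 < c) (hs : Support R c) (s : Setting) (w : Obs 𝒳) :
    |weight s P R w| ≤ 3 + 2 * c⁻¹ := by
  have hc' : 0 < c⁻¹ := inv_pos.2 hc
  cases s with
  | cs1 => exact (abs_G_le 1 1 w).trans (by linarith)
  | cs2 =>
    have h1 := abs_mul_le_one (abs_pTx_le (P := R) 1 (X w)) (abs_iD_le 1 w)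
    have h2 := abs_mul_le_one (abs_pDx_le (P := P) 1 (X w)) (abs_iT_le 1 w)
    have h3 := abs_mul_le_one (abs_pDx_le (P := P) 1 (X w)) (abs_pTx_le (P := R) 1 (X w))
    have := (abs_sub _ _).trans (add_le_add ((abs_add_le _ _).trans (add_le_add h1 h2)) h3)
    exact this.trans (by linarith)
  | cs3 =>
    have h1 : |(pT R 1)⁻¹| ≤ c⁻¹ := by
      rw [abs_of_nonneg (inv_nonneg.2 (pT_nonneg 1))]
      exact inv_anti₀ hc (hs.le_pT hc 1)
    have h2 := abs_mul_le_one (abs_pDtx_le (P := P) 1 1 (X w)) (abs_iT_le 1 w)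
    have h3 := (abs_sub _ _).trans (add_le_add (abs_G_le 1 1 w) h2)
    have h4 : |(pT R 1)⁻¹ * (G 1 1 w - pDtx P 1 1 (X w) * iT 1 w)| ≤ c⁻¹ * (1 + 1) := by
      rw [abs_mul]; exact mul_le_mul h1 h3 (abs_nonneg _) hc'.le
    exact ((abs_add_le _ _).trans (add_le_add h4 (abs_pDtx_le 1 1 (X w)))).trans (by linarith)
  | cs4 => exact (abs_iD_le 1 w).trans (by linarith)
  | cs5 => 
    change |(1 : ℝ)| ≤ _
    rw [abs_one]; linarith

/-- Mean of the weight under the law `R` of the nuisance functions that vary. -/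
lemma integral_weight_mul {s : Setting} {c : ℝ} (hc : 0 < c) (hs : Support R c)
    (h : CondProbRelation s R) {g : 𝒳 → ℝ} (hg : Measurable g)
    (ig : Integrable (fun w => g (X w)) (R : Measure (Obs 𝒳))) :
    ∫ w, weight s P R w * g (X w) ∂(R : Measure (Obs 𝒳))
      = weightScale s R * ∫ w, G 1 1 w * g (X w) ∂(R : Measure (Obs 𝒳)) := by
  have hT := (hc.trans_le (hs.le_pT hc 1)).ne'
  have hD := (hc.trans_le (hs.le_pD hc 1)).ne'
  cases s with
  | cs1 => simp [weight, weightScale]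
  | cs2 =>
    refine RegressesTo.integral_eq ((((RegressesTo.group 1).mul_X (measurable_pTx R 1)
      (abs_pTx_le 1)).add ((RegressesTo.period 1).mul_X (measurable_pDx P 1) (abs_pDx_le 1))).sub
      (RegressesTo.of_X ((measurable_pDx P 1).mul (measurable_pTx R 1))
        fun x => abs_mul_le_one (abs_pDx_le 1 x) (abs_pTx_le 1 x))) ?_ hg ig
    filter_upwards [h 1 1] with w hw
    simp only [weightScale, hw, Pi.mul_apply]; ring
  | cs3 =>
    refine RegressesTo.integral_eq ((((RegressesTo.cell 1 1).sub ((RegressesTo.period 1).mul_X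
      (measurable_pDtx P 1 1) (abs_pDtx_le 1 1))).mul_X (a := fun _ => (pT R 1)⁻¹)
      measurable_const fun _ => le_rfl).add (RegressesTo.of_X (measurable_pDtx P 1 1)
        (abs_pDtx_le 1 1))) ?_ hg ig
    filter_upwards [h 1] with w hw
    simp only [weightScale, hw]
    field_simp
    ring
  | cs4 =>
    refine RegressesTo.integral_eq (RegressesTo.group 1) ?_ hg ig
    filter_upwards [h 1 1] with w hw
    simp only [weightScale, hw]
    field_simp
  | cs5 =>
    refine RegressesTo.integral_eq (RegressesTo.of_X (a := fun _ => 1) measurable_const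
      fun _ => le_rfl) ?_ hg ig
    filter_upwards [h 1 1] with w hw
    simp only [weightScale, hw]
    field_simp

/-- Mean of the weight under the law `P` of the nuisance functions that are kept. -/
lemma integral_weight_mul_base {s : Setting} {c : ℝ} (hc : 0 < c) (hs : Support P c)
    (h : CondProbRelation s P) {g : 𝒳 → ℝ} (hg : Measurable g)
    (ig : Integrable (fun w => g (X w)) (P : Measure (Obs 𝒳))) :
    ∫ w, weight s P R w * g (X w) ∂(P : Measure (Obs 𝒳))
      = weightScale s P * ∫ w, G 1 1 w * g (X w) ∂(P : Measure (Obs 𝒳)) := by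
  have hT := (hc.trans_le (hs.le_pT hc 1)).ne'
  cases s with
  | cs1 => simp [weight, weightScale]
  | cs2 =>
    refine RegressesTo.integral_eq ((((RegressesTo.group 1).mul_X (measurable_pTx R 1)
      (abs_pTx_le 1)).add ((RegressesTo.period 1).mul_X (measurable_pDx P 1) (abs_pDx_le 1))).sub
      (RegressesTo.of_X ((measurable_pDx P 1).mul (measurable_pTx R 1))
        fun x => abs_mul_le_one (abs_pDx_le 1 x) (abs_pTx_le 1 x))) ?_ hg ig
    filter_upwards [h 1 1] with w hw
    simp only [weightScale, hw, Pi.mul_apply]; ring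
  | cs3 =>
    refine RegressesTo.integral_eq ((((RegressesTo.cell 1 1).sub ((RegressesTo.period 1).mul_X
      (measurable_pDtx P 1 1) (abs_pDtx_le 1 1))).mul_X (a := fun _ => (pT R 1)⁻¹)
      measurable_const fun _ => le_rfl).add (RegressesTo.of_X (measurable_pDtx P 1 1)
        (abs_pDtx_le 1 1))) ?_ hg ig
    filter_upwards [h 1, pDTx_eq_mul (P := P) 1 1] with w hw e
    simp only [weightScale, e, hw, sub_self, mul_zero, zero_add]
    field_simp
  | cs4 => exact integral_weight_mul (P := P) hc hs h hg ig
  | cs5 => exact integral_weight_mul (P := P) hc hs h hg ig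

end Weights

/-! ### Pathwise differentiability of the ATET with gradient ψ*. -/

section Gradient
variable {𝒳 : Type*} [MeasurableSpace 𝒳] {P : ℝ → ProbabilityMeasure (Obs 𝒳)} {S : Obs 𝒳 → ℝ}
  {ν : Measure (Obs 𝒳)} {r : ℝ → Obs 𝒳 → ℝ} {c K : ℝ} {A : ℝ → Set 𝒳}

lemma RegularFamily.tendsto_pT (h : RegularFamily P S ν r c K) (t : Fin 2) :
    Tendsto (fun β => pT (P β) t) (𝓝[≠] 0) (𝓝 (pT (P 0) t)) := by
  simp only [pT_eq_integral]
  exact h.root.tendsto_integral (measurable_iT t) (abs_iT_le t)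

lemma RegularFamily.tendsto_pD (h : RegularFamily P S ν r c K) (d : Fin 2) :
    Tendsto (fun β => pD (P β) d) (𝓝[≠] 0) (𝓝 (pD (P 0) d)) := by
  simp only [pD_eq_integral]
  exact h.root.tendsto_integral (measurable_iD d) (abs_iD_le d)

lemma nrm_le_one {R : ProbabilityMeasure (Obs 𝒳)} {f : Obs 𝒳 → ℝ} (hf : Measurable f)
    (h : ∀ w, |f w| ≤ 1) : MemLp f 2 (R : Measure (Obs 𝒳)) ∧ nrm (R : Measure (Obs 𝒳)) f ≤ 1 :=
  ⟨MemLp_of_abs_le hf.aestronglyMeasurable 1 h, nrm_le_of_abs_le h zero_le_one⟩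

lemma RegularFamily.tendsto_pTx (h : RegularFamily P S ν r c K) (hA : Overlap P A) :
    Tendsto (fun β => ∫ w, |ov A β (X w) * (pTx (P β) 1 (X w) - pTx (P 0) 1 (X w))|
      ∂(P 0 : Measure (Obs 𝒳))) (𝓝[≠] 0) (𝓝 0) := by
  have e : ∀ (R : ProbabilityMeasure (Obs 𝒳)) (u : 𝒳 → ℝ), Measurable u → (∀ x, |u x| ≤ 1) →
      ∫ w, u (X w) * 1 * iT 1 w ∂(R : Measure (Obs 𝒳))
        = ∫ w, u (X w) * 1 * pTx R 1 (X w) ∂(R : Measure (Obs 𝒳)) := fun R u hu hub => by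
    simp only [mul_one]
    exact (integral_mul_pTx 1 hu (integrable_of_abs_le_X hu hub)).symm
  have hp := fun R : ProbabilityMeasure (Obs 𝒳) => nrm_le_one (R := R)
    ((measurable_pTx R 1).comp measurable_X) fun w => abs_pTx_le 1 (X w)
  refine hA.tendsto_regression h.root (χ := fun _ => 1) (Z := iT 1) (K := 1)
    (ρ := fun β => pTx (P β) 1) measurable_const (fun _ => by simp) (measurable_iT 1)
    (fun β => measurable_pTx (P β) 1)
    (Eventually.of_forall fun β => nrm_le_one (measurable_iT 1) (abs_iT_le 1))
    (nrm_le_one (measurable_iT 1) (abs_iT_le 1)).1 (Eventually.of_forall fun β => hp _) (hp _).1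
    (Eventually.of_forall fun β => e _) (e _) one_pos fun u _ _ _ => by simp

/-- Only (CS-2) and (CS-3) have weights that move. There the difference of weights factors into the
change of one nuisance function, `pTx` or the inverse of `pT`, and a bounded factor. -/
lemma RegularFamily.tendsto_weight (h : RegularFamily P S ν r c K) (hA : Overlap P A)
    (s : Setting) : Tendsto (fun β => ∫ w, |ov A β (X w) *
      (weight s (P 0) (P β) w - weight s (P 0) (P 0) w)| ∂(P 0 : Measure (Obs 𝒳)))
    (𝓝[≠] 0) (𝓝 0) := by
  have hT := (h.c_pos.trans_le (h.support_zero.le_pT h.c_pos 1)).ne'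
  cases s with
  | cs1 => simp [weight]
  | cs2 =>
    refine squeeze_zero (fun β => integral_nonneg fun w => abs_nonneg _) (fun β => ?_)
      (h.tendsto_pTx hA)
    have hi : Integrable (fun w => |ov A β (X w) * (pTx (P β) 1 (X w) - pTx (P 0) 1 (X w))|)
        (P 0 : Measure (Obs 𝒳)) := by
      refine Integrable.abs (integrable_of_abs_le_X (u := fun x =>
        ov A β x * (pTx (P β) 1 x - pTx (P 0) 1 x)) (M := 2) ((hA.measurable_ov β).mul
          ((measurable_pTx _ 1).sub (measurable_pTx _ 1))) fun x => ?_)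
      have h1 := (abs_sub _ _).trans (add_le_add (abs_pTx_le (P := P β) 1 x)
        (abs_pTx_le (P := P 0) 1 x))
      rw [abs_mul]
      have := mul_le_mul (Overlap.abs_ov_le (A := A) β x) h1 (abs_nonneg _) zero_le_one
      linarith
    refine integral_mono_of_nonneg (ae_of_all _ fun w => abs_nonneg _) hi (ae_of_all _ fun w => ?_)
    have e : weight .cs2 (P 0) (P β) w - weight .cs2 (P 0) (P 0) w
        = (pTx (P β) 1 (X w) - pTx (P 0) 1 (X w)) * (iD 1 w - pDx (P 0) 1 (X w)) := by
      simp only [weight]; ring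
    have h1 : |iD 1 w - pDx (P 0) 1 (X w)| ≤ 1 := by
      have a1 := abs_iD_le 1 w
      have a2 := abs_pDx_le (P := P 0) 1 (X w)
      have a3 := iD_nonneg 1 w
      have a4 : 0 ≤ pDx (P 0) 1 (X w) := condProb_nonneg _ _
      rw [abs_le] at *
      constructor <;> linarith
    simp only [e, ← mul_assoc]
    rw [abs_mul _ (iD 1 w - _)]
    exact mul_le_of_le_one_right (abs_nonneg _) h1
  | cs3 =>
    have lim : Tendsto (fun β => 2 * |(pT (P β) 1)⁻¹ - (pT (P 0) 1)⁻¹|) (𝓝[≠] 0) (𝓝 0) := by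
      have := (((h.tendsto_pT 1).inv₀ hT).sub_const (pT (P 0) 1)⁻¹).abs.const_mul 2
      simpa using this
    refine squeeze_zero (fun β => integral_nonneg fun w => abs_nonneg _) (fun β => ?_) lim
    have := integral_mono_of_nonneg (μ := (P 0 : Measure (Obs 𝒳)))
      (f := fun w => |ov A β (X w) * (weight .cs3 (P 0) (P β) w - weight .cs3 (P 0) (P 0) w)|)
      (g := fun _ => 2 * |(pT (P β) 1)⁻¹ - (pT (P 0) 1)⁻¹|)
      (ae_of_all _ fun w => abs_nonneg _) (integrable_const _) (ae_of_all _ fun w => ?_)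
    · simpa using this
    have e : weight .cs3 (P 0) (P β) w - weight .cs3 (P 0) (P 0) w
        = (G 1 1 w - pDtx (P 0) 1 1 (X w) * iT 1 w) * ((pT (P β) 1)⁻¹ - (pT (P 0) 1)⁻¹) := by
      simp only [weight]; ring
    have h2 := abs_mul_le_one (abs_pDtx_le (P := P 0) 1 1 (X w)) (abs_iT_le 1 w)
    have h3 := (abs_sub _ _).trans (add_le_add (abs_G_le 1 1 w) h2)
    have h4 := mul_le_mul (Overlap.abs_ov_le (A := A) β (X w)) h3 (abs_nonneg _) zero_le_one
    simp only [e, ← mul_assoc]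
    rw [abs_mul, abs_mul]
    exact mul_le_mul_of_nonneg_right (by linarith) (abs_nonneg _)
  | cs4 => simp [weight]
  | cs5 => simp [weight]

lemma RegularFamily.adjustment (h : RegularFamily P S ν r c K) (hA : Overlap P A) {s : Setting}
    (hrel : ∀ β, CondProbRelation s (P β)) :
    Adjustment P A (fun β => weight s (P 0) (P β)) (fun β => weightScale s (P β))
      (3 + 2 * c⁻¹) where
  meas β := measurable_weight s
  bound := h.support.mono fun β hβ w => abs_weight_le h.c_pos hβ s w
  bound_zero := abs_weight_le h.c_pos h.support_zero s
  mean := h.support.mono fun β hβ g hg ig => integral_weight_mul h.c_pos hβ (hrel β) hg ig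
  mean_zero := Eventually.of_forall fun β g hg ig =>
    integral_weight_mul_base h.c_pos h.support_zero (hrel 0) hg ig
  tendsto_scale := by
    have hT := (h.c_pos.trans_le (h.support_zero.le_pT h.c_pos 1)).ne'
    have hD := (h.c_pos.trans_le (h.support_zero.le_pD h.c_pos 1)).ne'
    cases s with
    | cs1 => exact tendsto_const_nhds
    | cs2 => exact tendsto_const_nhds
    | cs3 => exact (h.tendsto_pT 1).inv₀ hT
    | cs4 => exact (h.tendsto_pT 1).inv₀ hT
    | cs5 => exact ((h.tendsto_pD 1).mul (h.tendsto_pT 1)).inv₀ (mul_ne_zero hD hT)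
  scale_ne := by
    have hT := (h.c_pos.trans_le (h.support_zero.le_pT h.c_pos 1)).ne'
    have hD := (h.c_pos.trans_le (h.support_zero.le_pD h.c_pos 1)).ne'
    cases s with
    | cs1 => exact one_ne_zero
    | cs2 => exact one_ne_zero
    | cs3 => exact inv_ne_zero hT
    | cs4 => exact inv_ne_zero hT
    | cs5 => exact inv_ne_zero (mul_ne_zero hD hT)
  tendsto := h.tendsto_weight hA s

/-- With both laws equal to P, the normalized weight is ψ^b; this is where the adjustment term of
each setting comes from. -/
lemma psiB_eq_weight {s : Setting} {P : ProbabilityMeasure (Obs 𝒳)} (hc : 0 < c) (hs : Support P c)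
    (h : CondProbRelation s P) (w : Obs 𝒳) :
    psiB s P w = weight s P P w / (weightScale s P * pDT P) := by
  have hT := (hc.trans_le (hs.le_pT hc 1)).ne'
  have hD := (hc.trans_le (hs.le_pD hc 1)).ne'
  have hDT := (hs.pDT_pos hc).ne'
  cases s with
  | cs1 => simp only [psiB, weight, weightScale, G_eq_mul, D_eq_iD, T_eq_iT, one_mul]
  | cs2 =>
    simp only [psiB, weight, weightScale, D_eq_iD, T_eq_iT, one_mul]
    ring
  | cs3 =>
    have e : pD1 P * pT P 1 = pDT P := pD1_mul_pT hT
    simp only [psiB, weight, weightScale, G_eq_mul, D_eq_iD, T_eq_iT, e]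
    field_simp
  | cs4 =>
    simp only [psiB, weight, weightScale, D_eq_iD, pDT_eq_mul_of_cs4 h]
    field_simp
  | cs5 =>
    simp only [psiB, weight, weightScale, pDT_eq_mul_of_cs5 h]
    field_simp

lemma weightScale_ne {s : Setting} {P : ProbabilityMeasure (Obs 𝒳)} (hc : 0 < c)
    (hs : Support P c) : weightScale s P ≠ 0 := by
  have hT := (hc.trans_le (hs.le_pT hc 1)).ne'
  have hD := (hc.trans_le (hs.le_pD hc 1)).ne'
  cases s with
  | cs1 => exact one_ne_zero
  | cs2 => exact one_ne_zero
  | cs3 => exact inv_ne_zero hT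
  | cs4 => exact inv_ne_zero hT
  | cs5 => exact inv_ne_zero (mul_ne_zero hD hT)

/-- `ψ*` in terms of the cell propensity scores and of the weight of the setting. -/
lemma influence_ae_eq_psi {s : Setting} {P : ProbabilityMeasure (Obs 𝒳)} (hc : 0 < c)
    (hs : Support P c) (h : CondProbRelation s P) (θ : ℝ) :
    influence P c (weight s P P) (weightScale s P) θ =ᵐ[(P : Measure (Obs 𝒳))] psi s P θ := by
  have hq : ∀ᵐ w ∂(P : Measure (Obs 𝒳)), ∀ d t, qx s P d t (X w) = pDTx P d t (X w) :=
    ae_all_iff.2 fun d => ae_all_iff.2 fun t => qx_ae_eq h d t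
  have hp : ∀ᵐ w ∂(P : Measure (Obs 𝒳)), ∀ d t, c ≤ pDTx P d t (X w) :=
    ae_all_iff.2 fun d => ae_all_iff.2 fun t => ae_lawX_iff P (hs d t)
  filter_upwards [hq, hp] with w e1 e2
  have hk := weightScale_ne (s := s) hc hs
  have hDT := (hs.pDT_pos hc).ne'
  rw [psi, influence, psiB_eq_weight hc hs h, q_eq_pDT hc hs h, psiA, e1, add_div, mul_div_mul_left _ _ hk,
    div_mul_eq_mul_div, div_mul_eq_mul_div]
  congr 2
  rw [Finset.mul_sum]
  refine Finset.sum_congr rfl fun d _ => ?_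
  rw [Finset.mul_sum]
  refine Finset.sum_congr rfl fun t _ => ?_
  rw [e1, RegularFamily.ratio, max_eq_left (e2 d t), sgn]
  ring

/-- Pathwise differentiability of the ATET along every regular parametric submodel. -/
theorem RegularSubmodel.hasDerivAt_atet [StandardBorelSpace 𝒳] {s : Setting}
    {P : ProbabilityMeasure (Obs 𝒳)} {Q : ℝ → ProbabilityMeasure (Full 𝒳)} {S : Obs 𝒳 → ℝ}
    (h : RegularSubmodel s P Q S) :
    HasDerivAt (fun β => atet (Q β)) (∫ w, psi s P (theta P) w * S w ∂(P : Measure (Obs 𝒳))) 0 := by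
  obtain ⟨hmem, hzero, ⟨c, hc, hs⟩, ⟨C, hC⟩, hS, hscore⟩ := h
  subst hzero
  obtain ⟨S', ν, r, hSS', hr⟩ := hscore.exists_rootExpansion hS
  obtain ⟨K, hF⟩ := hr.regularFamily hc (fun β => (hmem β).memLp) hs hC
  obtain ⟨A, hA⟩ := exists_overlap fun β => obsLaw (Q β)
  have hrel : ∀ β, CondProbRelation s (obsLaw (Q β)) := fun β => (relation_iff s).1 (hmem β).relation
  have hd := hF.hasDerivAt_theta hA (hF.adjustment hA hrel)
  have e : (fun β => atet (Q β)) = fun β => theta (obsLaw (Q β)) :=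
    funext fun β => (hmem β).atet_eq
  rw [e]
  convert hd using 1
  refine integral_congr_ae ?_
  filter_upwards [hSS', influence_ae_eq_psi hc hF.support_zero (hrel 0) (theta (obsLaw (Q 0)))]
    with w e1 e2
  rw [e1, e2]

end Gradient
end DiD

namespace DiD

/-! ### Laws with bounded densities and their scores. -/

section Tilt
variable {W : Type*} [MeasurableSpace W]

/-- `R` has the bounded density `f` with respect to `P`. -/
structure IsTilt (P R : ProbabilityMeasure W) (f : W → ℝ) : Prop where
  meas : Measurable f
  nonneg : ∀ w, 0 ≤ f w
  le_two : ∀ w, f w ≤ 2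
  eq : (R : Measure W) = (P : Measure W).withDensity fun w => ENNReal.ofReal (f w)

lemma exists_isTilt {P : ProbabilityMeasure W} {f : W → ℝ} (hf : Measurable f) (h0 : ∀ w, 0 ≤ f w)
    (h2 : ∀ w, f w ≤ 2) (h1 : ∫ w, f w ∂(P : Measure W) = 1) : ∃ R, IsTilt P R f := by
  have hi : Integrable f (P : Measure W) :=
    (MemLp_of_abs_le (p := 2) hf.aestronglyMeasurable 2 fun w => by
      rw [abs_of_nonneg (h0 w)]; exact h2 w).integrable (by norm_num)
  have : IsProbabilityMeasure ((P : Measure W).withDensity fun w => ENNReal.ofReal (f w)) := by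
    refine ⟨?_⟩
    rw [withDensity_apply _ MeasurableSet.univ, Measure.restrict_univ,
      ← ofReal_integral_eq_lintegral_ofReal hi (ae_of_all _ h0), h1, ENNReal.ofReal_one]
  exact ⟨⟨_, this⟩, hf, h0, h2, rfl⟩

namespace IsTilt
variable {P R : ProbabilityMeasure W} {f : W → ℝ}

lemma abs_le (h : IsTilt P R f) (w : W) : |f w| ≤ 2 := by
  rw [abs_of_nonneg (h.nonneg w)]; exact h.le_two w

lemma integral_eq (h : IsTilt P R f) (φ : W → ℝ) :
    ∫ w, φ w ∂(R : Measure W) = ∫ w, f w * φ w ∂(P : Measure W) := by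
  rw [h.eq, integral_withDensity_eq_integral_toReal_smul h.meas.ennreal_ofReal
    (ae_of_all _ fun _ => ENNReal.ofReal_lt_top)]
  simp only [ENNReal.toReal_ofReal (h.nonneg _), smul_eq_mul]

lemma integrable (h : IsTilt P R f) {φ : W → ℝ} (hφ : Integrable φ (P : Measure W)) :
    Integrable φ (R : Measure W) := by
  rw [h.eq, integrable_withDensity_iff_integrable_smul' h.meas.ennreal_ofReal
    (ae_of_all _ fun _ => ENNReal.ofReal_lt_top)]
  simp only [ENNReal.toReal_ofReal (h.nonneg _), smul_eq_mul]
  exact hφ.bdd_mul (c := 2) h.meas.aestronglyMeasurable (ae_of_all _ h.abs_le)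

lemma absolutelyContinuous (h : IsTilt P R f) : (R : Measure W) ≪ (P : Measure W) := by
  rw [h.eq]; exact withDensity_absolutelyContinuous _ _

lemma ae (h : IsTilt P R f) {p : W → Prop} (hp : ∀ᵐ w ∂(P : Measure W), p w) :
    ∀ᵐ w ∂(R : Measure W), p w := h.absolutelyContinuous.ae_le hp

lemma rnDeriv (h : IsTilt P R f) :
    ∀ᵐ w ∂(P : Measure W), ((R : Measure W).rnDeriv (P : Measure W) w).toReal = f w := by
  rw [h.eq]
  filter_upwards [Measure.rnDeriv_withDensity (P : Measure W) h.meas.ennreal_ofReal] with w hw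
  rw [hw, ENNReal.toReal_ofReal (h.nonneg w)]

lemma eq_of_one (h : IsTilt P R fun _ => 1) : R = P := by
  apply Subtype.ext
  change (R : Measure W) = P
  rw [h.eq]
  simp

end IsTilt

/-- With s = √(1 + x), the error is -(s - 1)²/2, while x² = (s - 1)²(s + 1)² and s + 1 ≥ 1. -/
lemma abs_sqrt_one_add_sub_le {x : ℝ} (hx : -1 ≤ x) : |√(1 + x) - 1 - x / 2| ≤ x ^ 2 / 2 := by
  set s := √(1 + x) with hs
  have h0 : 0 ≤ s := Real.sqrt_nonneg _
  have h1 : s ^ 2 = 1 + x := Real.sq_sqrt (by linarith)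
  have e : s - 1 - x / 2 = -((s - 1) ^ 2 / 2) := by linarith [h1, sq_nonneg (s - 1), (by ring : (s-1)^2 = s^2 - 2*s + 1)]
  have e2 : x ^ 2 = (s - 1) ^ 2 * (s + 1) ^ 2 := by
    rw [show x = s ^ 2 - 1 by linarith]; ring
  rw [e, abs_neg, abs_of_nonneg (by positivity), e2]
  nlinarith [sq_nonneg (s - 1), mul_nonneg (sq_nonneg (s - 1)) h0,
    mul_nonneg (sq_nonneg (s - 1)) (mul_nonneg h0 h0)]

/-- A smooth bounded density path is differentiable in quadratic mean. -/
lemma hasScore_of_isTilt {P : ProbabilityMeasure W} {R : ℝ → ProbabilityMeasure W} {g h : W → ℝ}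
    {M : ℝ} (hg : ∀ w, |g w| ≤ M) (hh : ∀ w, |h w| ≤ M) (h0 : R 0 = P)
    (hac : ∀ β, (R β : Measure W) ≪ (P : Measure W))
    (hR : ∀ᶠ β in 𝓝 (0 : ℝ), IsTilt P (R β) fun w => 1 + (β * g w + β ^ 2 * h w)) :
    HasScore R g := by
  refine ⟨P, inferInstance, hac, ?_⟩
  have hM : 0 ≤ M := by
    obtain ⟨w⟩ := P.nonempty
    exact (abs_nonneg _).trans (hg w)
  have lim : Tendsto (fun β : ℝ => ENNReal.ofReal ((|β| * (2 * M ^ 2 + M)) ^ 2)) (𝓝[≠] 0) (𝓝 0) := by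
    have : Continuous (fun β : ℝ => ENNReal.ofReal ((|β| * (2 * M ^ 2 + M)) ^ 2)) :=
      ENNReal.continuous_ofReal.comp (by fun_prop)
    simpa using (this.tendsto 0).mono_left nhdsWithin_le_nhds
  refine tendsto_of_tendsto_of_tendsto_of_le_of_le' tendsto_const_nhds lim
    (Eventually.of_forall fun _ => zero_le) ?_
  have hsmall : ∀ᶠ β in 𝓝[≠] (0 : ℝ), |β| ≤ 1 := by
    refine nhdsWithin_le_nhds ?_
    filter_upwards [Metric.closedBall_mem_nhds (0 : ℝ) one_pos] with β hβ
    simpa using hβ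
  filter_upwards [hR.filter_mono nhdsWithin_le_nhds, hsmall, self_mem_nhdsWithin] with β hβ h1 hne
  have hne : β ≠ 0 := hne
  have e0 : ∀ᵐ w ∂(P : Measure W), ((R 0 : Measure W).rnDeriv (P : Measure W) w).toReal = 1 := by
    rw [h0]
    filter_upwards [Measure.rnDeriv_self (P : Measure W)] with w hw
    rw [hw]; rfl
  calc _ ≤ ∫⁻ _, ENNReal.ofReal ((|β| * (2 * M ^ 2 + M)) ^ 2) ∂(P : Measure W) := by
        refine lintegral_mono_ae ?_
        filter_upwards [hβ.rnDeriv, e0] with w e1 e2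
        refine ENNReal.ofReal_le_ofReal ?_
        rw [e1, e2, Real.sqrt_one, mul_one, ← sq_abs]
        refine pow_le_pow_left₀ (abs_nonneg _) ?_ 2
        set x := β * g w + β ^ 2 * h w with hx
        have hx1 : -1 ≤ x := by have := hβ.nonneg w; linarith
        have hb := abs_sqrt_one_add_sub_le hx1
        have hxa : |x| ≤ |β| * (2 * M) := by
          have a1 : |β * g w| ≤ |β| * M := by
            rw [abs_mul]; exact mul_le_mul_of_nonneg_left (hg w) (abs_nonneg _)
          have a2 : |β ^ 2 * h w| ≤ |β| * M := by
            rw [abs_mul, abs_pow, sq]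
            refine mul_le_mul ?_ (hh w) (abs_nonneg _) (abs_nonneg _)
            exact mul_le_of_le_one_left (abs_nonneg _) h1
          have := abs_add_le (β * g w) (β ^ 2 * h w)
          linarith
        -- Second-order error of the square root plus the quadratic term of the density; both are
        -- O(β) uniformly in w.
        have e : (√(1 + x) - 1) / β - g w / 2 = (√(1 + x) - 1 - x / 2) / β + β * h w / 2 := by
          rw [hx]; field_simp; ring
        rw [e]
        have b1 : |(√(1 + x) - 1 - x / 2) / β| ≤ |β| * (2 * M ^ 2) := by
          rw [abs_div, div_le_iff₀ (abs_pos.2 hne)]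
          have : x ^ 2 ≤ (|β| * (2 * M)) ^ 2 := by
            rw [← sq_abs x]; exact pow_le_pow_left₀ (abs_nonneg _) hxa 2
          calc _ ≤ x ^ 2 / 2 := hb
            _ ≤ (|β| * (2 * M)) ^ 2 / 2 := by linarith
            _ = _ := by ring
        have b2 : |β * h w / 2| ≤ |β| * M := by
          rw [abs_div, abs_mul, abs_two]
          have := mul_le_mul_of_nonneg_left (hh w) (abs_nonneg β)
          have := mul_nonneg (abs_nonneg β) (abs_nonneg (h w))
          linarith
        calc _ ≤ _ := abs_add_le _ _
          _ ≤ |β| * (2 * M ^ 2) + |β| * M := add_le_add b1 b2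
          _ = _ := by ring
    _ = _ := by simp

end Tilt

/-! ### Total probability, and functions of (D,T,X). -/

section Sums
variable {𝒳 : Type*} [MeasurableSpace 𝒳] {P : ProbabilityMeasure (Obs 𝒳)}

lemma pDTx_sum (x : 𝒳) : pDTx P 0 0 x + pDTx P 0 1 x + (pDTx P 1 0 x + pDTx P 1 1 x) = 1 := by
  have := measureReal_eq_sum
    (condDistrib (fun w : Obs 𝒳 => (D w, T w)) X (P : Measure (Obs 𝒳)) x) Set.univ
  simp only [probReal_univ, Set.indicator_univ, one_mul, Fintype.sum_prod_type,
    Fin.sum_univ_two] at this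
  exact this.symm

lemma pDx_zero (x : 𝒳) : pDx P 0 x = 1 - pDx P 1 x := by
  have := measureReal_eq_sum (condDistrib (D : Obs 𝒳 → Fin 2) X (P : Measure (Obs 𝒳)) x) Set.univ
  simp only [probReal_univ, Set.indicator_univ, one_mul, Fin.sum_univ_two] at this
  exact eq_sub_of_add_eq this.symm

lemma pTx_zero (x : 𝒳) : pTx P 0 x = 1 - pTx P 1 x := by
  have := measureReal_eq_sum (condDistrib (T : Obs 𝒳 → Fin 2) X (P : Measure (Obs 𝒳)) x) Set.univ
  simp only [probReal_univ, Set.indicator_univ, one_mul, Fin.sum_univ_two] at this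
  exact eq_sub_of_add_eq this.symm

lemma pDtx_zero (t : Fin 2) (x : 𝒳) : pDtx P 0 t x = 1 - pDtx P 1 t x := by
  have := measureReal_eq_sum
    (condDistrib (D : Obs 𝒳 → Fin 2) (fun w => (T w, X w)) (P : Measure (Obs 𝒳)) (t, x)) Set.univ
  simp only [probReal_univ, Set.indicator_univ, one_mul, Fin.sum_univ_two] at this
  exact eq_sub_of_add_eq this.symm

lemma pT_zero : pT P 0 = 1 - pT P 1 := by
  simp only [pT_eq_integral, iT_zero]
  rw [integral_sub (integrable_const _) (integrable_iT 1)]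
  simp

lemma pD_zero : pD P 0 = 1 - pD P 1 := by
  simp only [pD_eq_integral, iD_zero]
  rw [integral_sub (integrable_const _) (integrable_iD 1)]
  simp

/-- A function of `(D, T, X)`. -/
def evalDTX (u : Fin 2 → Fin 2 → 𝒳 → ℝ) (w : Obs 𝒳) : ℝ := u (D w) (T w) (X w)

lemma evalDTX_eq_sum (u : Fin 2 → Fin 2 → 𝒳 → ℝ) (w : Obs 𝒳) :
    evalDTX u w = ∑ d : Fin 2, ∑ t : Fin 2, u d t (X w) * G d t w := by
  unfold evalDTX
  generalize hd : D w = d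
  generalize ht : T w = t
  fin_cases d <;> fin_cases t <;> simp [Fin.sum_univ_two, G, hd, ht]

lemma evalDTX_mul_G (u : Fin 2 → Fin 2 → 𝒳 → ℝ) (d t : Fin 2) (w : Obs 𝒳) :
    evalDTX u w * G d t w = u d t (X w) * G d t w := by
  by_cases h : D w = d ∧ T w = t
  · simp [evalDTX, h.1, h.2]
  · simp [G, h]

lemma measurable_evalDTX {u : Fin 2 → Fin 2 → 𝒳 → ℝ} (hu : ∀ d t, Measurable (u d t)) :
    Measurable (evalDTX u) := by
  have : evalDTX u = fun w => ∑ d : Fin 2, ∑ t : Fin 2, u d t (X w) * G d t w :=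
    funext (evalDTX_eq_sum u)
  rw [this]
  exact Finset.measurable_sum _ fun d _ => Finset.measurable_sum _ fun t _ =>
    ((hu d t).comp measurable_X).mul (measurable_G d t)

end Sums

/-! ### Density paths that stay inside each setting. -/

section Directions
variable {𝒳 : Type*} [MeasurableSpace 𝒳]

/-- The perturbations of the law of `(D, T, X)` that are compatible with a setting. -/
def Compatible (s : Setting) (P : ProbabilityMeasure (Obs 𝒳)) (γ γ' : Fin 2 → Fin 2 → 𝒳 → ℝ) :
    Prop :=
  match s with
  | .cs1 => γ' = 0 ∧ ∫ w, evalDTX γ w ∂(P : Measure (Obs 𝒳)) = 0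
  -- γ tilts the law of (D,X), γ' the law of T given X. The product of the tilts keeps the cell
  -- scores in product form.
  | .cs2 => ∃ (a : Fin 2 → 𝒳 → ℝ) (v : 𝒳 → ℝ), (γ = fun d _ => a d) ∧
      (γ' = fun (_ t : Fin 2) (x : 𝒳) => v x * (((t : ℕ) : ℝ) - pTx P 1 x)) ∧
      ∫ w, evalDTX γ w ∂(P : Measure (Obs 𝒳)) = 0
  -- γ tilts the law of X, γ' the law of D given X in the period T = 1; the law of T is left alone.
  | .cs3 => ∃ a v : 𝒳 → ℝ, (γ = fun _ _ => a) ∧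
      (γ' = fun (d t : Fin 2) (x : 𝒳) => v x * (((t : ℕ) : ℝ) * (((d : ℕ) : ℝ) - pDtx P 1 1 x))) ∧
      ∫ w, evalDTX γ w ∂(P : Measure (Obs 𝒳)) = 0
  | .cs4 => ∃ a : Fin 2 → 𝒳 → ℝ, (γ = fun d _ => a d) ∧ γ' = 0 ∧
      ∫ w, evalDTX γ w ∂(P : Measure (Obs 𝒳)) = 0
  -- γ tilts the law of X, γ' the marginal law of T.
  | .cs5 => ∃ (a : 𝒳 → ℝ) (k : ℝ), (γ = fun _ _ => a) ∧
      (γ' = fun (_ t : Fin 2) (_ : 𝒳) => k * (((t : ℕ) : ℝ) - pT P 1)) ∧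
      ∫ w, evalDTX γ w ∂(P : Measure (Obs 𝒳)) = 0

/-- Bounded directions in which a law can be perturbed within the setting: `g` perturbs the law of
`Y` given `(D, T, X)`, and `γ`, `γ'` perturb the law of `(D, T, X)`. -/
structure Direction (s : Setting) (P : ProbabilityMeasure (Obs 𝒳)) (M : ℝ) (g : Obs 𝒳 → ℝ)
    (γ γ' : Fin 2 → Fin 2 → 𝒳 → ℝ) : Prop where
  meas : Measurable g
  meas_left : ∀ d t, Measurable (γ d t)
  meas_right : ∀ d t, Measurable (γ' d t)
  bound : ∀ w, |g w| ≤ M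
  bound_left : ∀ d t x, |γ d t x| ≤ M
  bound_right : ∀ d t x, |γ' d t x| ≤ M
  residual : ∀ d t (u : 𝒳 → ℝ), Measurable u → (∀ x, |u x| ≤ 1) →
    ∫ w, g w * (u (X w) * G d t w) ∂(P : Measure (Obs 𝒳)) = 0
  compatible : Compatible s P γ γ'

/-- The factor by which the law of `(D, T, X)` is tilted. -/
def tiltDTX (γ γ' : Fin 2 → Fin 2 → 𝒳 → ℝ) (β : ℝ) (d t : Fin 2) (x : 𝒳) : ℝ :=
  (1 + β * γ d t x) * (1 + β * γ' d t x)

/-- The density of the perturbed law. -/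
def pathDensity (g : Obs 𝒳 → ℝ) (γ γ' : Fin 2 → Fin 2 → 𝒳 → ℝ) (β : ℝ) (w : Obs 𝒳) : ℝ :=
  evalDTX (tiltDTX γ γ' β) w + β * g w

/-- Joint cell weights `Pr(D = d, T = t | X = x)` times the tilting factor. -/
def tiltedCell (P : ProbabilityMeasure (Obs 𝒳)) (γ γ' : Fin 2 → Fin 2 → 𝒳 → ℝ) (β : ℝ)
    (d t : Fin 2) (x : 𝒳) : ℝ := pDTx P d t x * tiltDTX γ γ' β d t x

/-- The density of the perturbed law of `X`. -/
def tiltedX (P : ProbabilityMeasure (Obs 𝒳)) (γ γ' : Fin 2 → Fin 2 → 𝒳 → ℝ) (β : ℝ) (x : 𝒳) : ℝ :=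
  tiltedCell P γ γ' β 0 0 x + tiltedCell P γ γ' β 0 1 x
    + (tiltedCell P γ γ' β 1 0 x + tiltedCell P γ γ' β 1 1 x)

variable {P R : ProbabilityMeasure (Obs 𝒳)} {s : Setting} {M : ℝ} {g : Obs 𝒳 → ℝ}
  {γ γ' : Fin 2 → Fin 2 → 𝒳 → ℝ} {β : ℝ}

lemma integral_evalDTX {u : Fin 2 → Fin 2 → 𝒳 → ℝ} (hu : ∀ d t, Measurable (u d t)) {C : ℝ}
    (hC : ∀ d t x, |u d t x| ≤ C) : ∫ w, evalDTX u w ∂(P : Measure (Obs 𝒳))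
      = ∫ w, ∑ d : Fin 2, ∑ t : Fin 2, u d t (X w) * pDTx P d t (X w) ∂(P : Measure (Obs 𝒳)) := by
  have iu := fun d t => integrable_of_abs_le_X (P := P) (hu d t) (hC d t)
  have i1 : ∀ d t, Integrable (fun w => u d t (X w) * G d t w) (P : Measure (Obs 𝒳)) := fun d t =>
    (integrable_G d t).bdd_mul (c := C) ((hu d t).comp measurable_X).aestronglyMeasurable
      (ae_of_all _ fun w => hC _ _ _)
  have i2 : ∀ d t, Integrable (fun w => u d t (X w) * pDTx P d t (X w)) (P : Measure (Obs 𝒳)) :=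
    fun d t => (integrable_of_abs_le_X (measurable_pDTx P d t) (abs_pDTx_le d t)).bdd_mul (c := C)
      ((hu d t).comp measurable_X).aestronglyMeasurable (ae_of_all _ fun w => hC _ _ _)
  simp only [evalDTX_eq_sum]
  rw [integral_finsetSum _ fun d _ => integrable_finsetSum _ fun t _ => i1 d t,
    integral_finsetSum _ fun d _ => integrable_finsetSum _ fun t _ => i2 d t]
  refine Finset.sum_congr rfl fun d _ => ?_
  rw [integral_finsetSum _ fun t _ => i1 d t, integral_finsetSum _ fun t _ => i2 d t]
  exact Finset.sum_congr rfl fun t _ => (integral_mul_pDTx d t (hu d t) (iu d t)).symm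

namespace Direction

lemma measurable_tiltDTX (h : Direction s P M g γ γ') (β : ℝ) (d t : Fin 2) :
    Measurable (tiltDTX γ γ' β d t) :=
  (((h.meas_left d t).const_mul β).const_add 1).mul (((h.meas_right d t).const_mul β).const_add 1)

lemma measurable_tiltedCell (h : Direction s P M g γ γ') (β : ℝ) (d t : Fin 2) :
    Measurable (tiltedCell P γ γ' β d t) :=
  (measurable_pDTx P d t).mul (h.measurable_tiltDTX β d t)

lemma measurable_tiltedX (h : Direction s P M g γ γ') (β : ℝ) :
    Measurable (tiltedX P γ γ' β) :=
  ((h.measurable_tiltedCell β 0 0).add (h.measurable_tiltedCell β 0 1)).add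
    ((h.measurable_tiltedCell β 1 0).add (h.measurable_tiltedCell β 1 1))

lemma measurable_pathDensity (h : Direction s P M g γ γ') (β : ℝ) :
    Measurable (pathDensity g γ γ' β) :=
  (measurable_evalDTX (h.measurable_tiltDTX β)).add (h.meas.const_mul β)

lemma abs_mul_le {a : ℝ} (ha : |a| ≤ M) (hβ : |β| * M ≤ 1 / 4) : |β * a| ≤ 1 / 4 := by
  rw [abs_mul]; exact (mul_le_mul_of_nonneg_left ha (abs_nonneg _)).trans hβ

/-- The bounds are (1 - 1/4)² and (1 + 1/4)². -/
lemma tiltDTX_mem (h : Direction s P M g γ γ') (hβ : |β| * M ≤ 1 / 4) (d t : Fin 2) (x : 𝒳) :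
    9 / 16 ≤ tiltDTX γ γ' β d t x ∧ tiltDTX γ γ' β d t x ≤ 25 / 16 := by
  have h1 := abs_le.1 (abs_mul_le (h.bound_left d t x) hβ)
  have h2 := abs_le.1 (abs_mul_le (h.bound_right d t x) hβ)
  unfold tiltDTX
  constructor <;> nlinarith

lemma abs_tiltDTX_le (h : Direction s P M g γ γ') (hβ : |β| * M ≤ 1 / 4) (d t : Fin 2) (x : 𝒳) :
    |tiltDTX γ γ' β d t x| ≤ 2 := by
  obtain ⟨h1, h2⟩ := h.tiltDTX_mem hβ d t x
  rw [abs_le]; constructor <;> linarith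

/-- The term β g moves the tilt by at most 1/4, and 9/16 - 1/4 and 25/16 + 1/4 still lie between 0
and 2. -/
lemma pathDensity_mem (h : Direction s P M g γ γ') (hβ : |β| * M ≤ 1 / 4) (w : Obs 𝒳) :
    0 ≤ pathDensity g γ γ' β w ∧ pathDensity g γ γ' β w ≤ 2 := by
  obtain ⟨h1, h2⟩ := h.tiltDTX_mem hβ (D w) (T w) (X w)
  have h3 := abs_le.1 (abs_mul_le (h.bound w) hβ)
  unfold pathDensity evalDTX
  constructor <;> linarith

lemma abs_pathDensity_le (h : Direction s P M g γ γ') (hβ : |β| * M ≤ 1 / 4) (w : Obs 𝒳) :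
    |pathDensity g γ γ' β w| ≤ 2 := by
  obtain ⟨h1, h2⟩ := h.pathDensity_mem hβ w
  rw [abs_of_nonneg h1]; exact h2

/-- The density of the tilted law of X averages the tilts with the cell scores as weights, and these
sum to one. -/
lemma tiltedX_mem (h : Direction s P M g γ γ') (hβ : |β| * M ≤ 1 / 4) (x : 𝒳) :
    9 / 16 ≤ tiltedX P γ γ' β x ∧ tiltedX P γ γ' β x ≤ 25 / 16 := by
  have hp : ∀ d t, 0 ≤ pDTx P d t x := fun d t => condProb_nonneg _ _
  have e := pDTx_sum (P := P) x
  have l := fun d t => mul_le_mul_of_nonneg_left (h.tiltDTX_mem hβ d t x).1 (hp d t)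
  have u := fun d t => mul_le_mul_of_nonneg_left (h.tiltDTX_mem hβ d t x).2 (hp d t)
  unfold tiltedX tiltedCell
  constructor
  · linarith [l 0 0, l 0 1, l 1 0, l 1 1]
  · linarith [u 0 0, u 0 1, u 1 0, u 1 1]

lemma abs_tiltedCell_le (h : Direction s P M g γ γ') (hβ : |β| * M ≤ 1 / 4) (d t : Fin 2) (x : 𝒳) :
    |tiltedCell P γ γ' β d t x| ≤ 2 := by
  unfold tiltedCell
  rw [abs_mul]
  have := mul_le_mul (abs_pDTx_le (P := P) d t x) (h.abs_tiltDTX_le hβ d t x) (abs_nonneg _) zero_le_one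
  linarith

/-- Cell masses of the perturbed law. -/
lemma integral_pathDensity_mul (h : Direction s P M g γ γ') (hβ : |β| * M ≤ 1 / 4) (d t : Fin 2)
    {u : 𝒳 → ℝ} (hu : Measurable u) (hub : ∀ x, |u x| ≤ 1) :
    ∫ w, pathDensity g γ γ' β w * (u (X w) * G d t w) ∂(P : Measure (Obs 𝒳))
      = ∫ w, u (X w) * tiltedCell P γ γ' β d t (X w) ∂(P : Measure (Obs 𝒳)) := by
  have hm : Measurable (fun x => u x * tiltDTX γ γ' β d t x) := hu.mul (h.measurable_tiltDTX β d t)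
  have hb : ∀ x, |u x * tiltDTX γ γ' β d t x| ≤ 2 := fun x => by
    rw [abs_mul]
    have := mul_le_mul (hub x) (h.abs_tiltDTX_le hβ d t x) (abs_nonneg _) zero_le_one
    linarith
  have e : ∀ w, pathDensity g γ γ' β w * (u (X w) * G d t w)
      = u (X w) * tiltDTX γ γ' β d t (X w) * G d t w + β * (g w * (u (X w) * G d t w)) := fun w => by
    have := evalDTX_mul_G (tiltDTX γ γ' β) d t w
    unfold pathDensity
    linear_combination u (X w) * this
  have i1 : Integrable (fun w => u (X w) * tiltDTX γ γ' β d t (X w) * G d t w)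
      (P : Measure (Obs 𝒳)) :=
    (integrable_G d t).bdd_mul (c := 2) (hm.comp measurable_X).aestronglyMeasurable
      (ae_of_all _ fun w => hb _)
  have i2 : Integrable (fun w => g w * (u (X w) * G d t w)) (P : Measure (Obs 𝒳)) := by
    refine Integrable.bdd_mul (c := M) ?_ h.meas.aestronglyMeasurable (ae_of_all _ h.bound)
    exact (integrable_G d t).bdd_mul (c := 1) (hu.comp measurable_X).aestronglyMeasurable
      (ae_of_all _ fun w => hub _)
  simp only [e]
  rw [integral_add i1 (i2.const_mul β), integral_const_mul, h.residual d t u hu hub, mul_zero,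
    -- The perturbation g has mean zero in every cell given X, so it does not move the law of
    -- (D,T,X).
    add_zero, ← integral_mul_pDTx d t hm (integrable_of_abs_le_X hm hb)]
  congr 1; ext w; unfold tiltedCell; ring

lemma integral_pathDensity_mul_X (h : Direction s P M g γ γ') (hβ : |β| * M ≤ 1 / 4)
    {u : 𝒳 → ℝ} (hu : Measurable u) (hub : ∀ x, |u x| ≤ 1) :
    ∫ w, pathDensity g γ γ' β w * u (X w) ∂(P : Measure (Obs 𝒳))
      = ∫ w, u (X w) * tiltedX P γ γ' β (X w) ∂(P : Measure (Obs 𝒳)) := by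
  have e : ∀ w, pathDensity g γ γ' β w * u (X w)
      = ∑ d : Fin 2, ∑ t : Fin 2, pathDensity g γ γ' β w * (u (X w) * G d t w) := fun w => by
    have := sum_G w
    simp only [← Finset.mul_sum]
    rw [this, mul_one]
  have e2 : ∀ w : Obs 𝒳, u (X w) * tiltedX P γ γ' β (X w)
      = ∑ d : Fin 2, ∑ t : Fin 2, u (X w) * tiltedCell P γ γ' β d t (X w) := fun w => by
    simp only [Fin.sum_univ_two, tiltedX]; ring
  have i1 : ∀ d t, Integrable (fun w => pathDensity g γ γ' β w * (u (X w) * G d t w))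
      (P : Measure (Obs 𝒳)) := fun d t => by
    refine Integrable.bdd_mul (c := 2) ?_ (h.measurable_pathDensity β).aestronglyMeasurable
      (ae_of_all _ (h.abs_pathDensity_le hβ))
    exact (integrable_G d t).bdd_mul (c := 1) (hu.comp measurable_X).aestronglyMeasurable
      (ae_of_all _ fun w => hub _)
  have i2 : ∀ d t, Integrable (fun w => u (X w) * tiltedCell P γ γ' β d t (X w))
      (P : Measure (Obs 𝒳)) := fun d t =>
    (integrable_of_abs_le_X (h.measurable_tiltedCell β d t) (h.abs_tiltedCell_le hβ d t)).bdd_mul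
      (c := 1) (hu.comp measurable_X).aestronglyMeasurable (ae_of_all _ fun w => hub _)
  simp only [e, e2]
  rw [integral_finsetSum _ fun d _ => integrable_finsetSum _ fun t _ => i1 d t,
    integral_finsetSum _ fun d _ => integrable_finsetSum _ fun t _ => i2 d t]
  refine Finset.sum_congr rfl fun d _ => ?_
  rw [integral_finsetSum _ fun t _ => i1 d t, integral_finsetSum _ fun t _ => i2 d t]
  exact Finset.sum_congr rfl fun t _ => h.integral_pathDensity_mul hβ d t hu hub

/-- The mass of the tilted law of `X` depends on the first perturbation only. -/
lemma tiltedX_ae_eq (h : Direction s P M g γ γ') (hP : CondProbRelation s P) (β : ℝ) :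
    ∀ᵐ w ∂(P : Measure (Obs 𝒳)), tiltedX P γ γ' β (X w)
      = 1 + β * ∑ d : Fin 2, ∑ t : Fin 2, γ d t (X w) * pDTx P d t (X w) := by
  -- Averaged over the cells given X, both γ' and the product γγ' vanish in every setting: γ' is
  -- centered in the factor it tilts and γ does not depend on that factor.
  have hc := h.compatible
  cases s with
  | cs1 =>
    obtain ⟨rfl, -⟩ := hc
    refine ae_of_all _ fun w => ?_
    have := pDTx_sum (P := P) (X w)
    simp only [tiltedX, tiltedCell, tiltDTX, Fin.sum_univ_two, Pi.zero_apply]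
    linear_combination this
  | cs2 =>
    obtain ⟨a, v, rfl, rfl, -⟩ := hc
    filter_upwards [hP 0 0, hP 0 1, hP 1 0, hP 1 1] with w e1 e2 e3 e4
    simp only [tiltedX, tiltedCell, tiltDTX, Fin.sum_univ_two, e1, e2, e3, e4, pDx_zero, pTx_zero,
      Fin.val_zero, Fin.val_one, Nat.cast_zero, Nat.cast_one]
    ring
  | cs3 =>
    obtain ⟨a, v, rfl, rfl, -⟩ := hc
    filter_upwards [hP 0, hP 1, pDTx_eq_mul (P := P) 0 0, pDTx_eq_mul (P := P) 0 1,
      pDTx_eq_mul (P := P) 1 0, pDTx_eq_mul (P := P) 1 1] with w e1 e2 e3 e4 e5 e6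
    simp only [tiltedX, tiltedCell, tiltDTX, Fin.sum_univ_two, e1, e2, e3, e4, e5, e6, pDtx_zero,
      pT_zero, Fin.val_zero, Fin.val_one, Nat.cast_zero, Nat.cast_one]
    ring
  | cs4 =>
    obtain ⟨a, rfl, rfl, -⟩ := hc
    refine ae_of_all _ fun w => ?_
    have := pDTx_sum (P := P) (X w)
    simp only [tiltedX, tiltedCell, tiltDTX, Fin.sum_univ_two, Pi.zero_apply]
    linear_combination this
  | cs5 =>
    obtain ⟨a, k, rfl, rfl, -⟩ := hc
    filter_upwards [hP 0 0, hP 0 1, hP 1 0, hP 1 1] with w e1 e2 e3 e4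
    simp only [tiltedX, tiltedCell, tiltDTX, Fin.sum_univ_two, e1, e2, e3, e4, pD_zero, pT_zero,
      Fin.val_zero, Fin.val_one, Nat.cast_zero, Nat.cast_one]
    ring

lemma integral_left (h : Direction s P M g γ γ') :
    ∫ w, ∑ d : Fin 2, ∑ t : Fin 2, γ d t (X w) * pDTx P d t (X w) ∂(P : Measure (Obs 𝒳)) = 0 := by
  rw [← integral_evalDTX h.meas_left h.bound_left]
  have hc := h.compatible
  cases s with
  | cs1 => exact hc.2
  | cs2 => obtain ⟨_, _, _, _, h⟩ := hc; exact h
  | cs3 => obtain ⟨_, _, _, _, h⟩ := hc; exact h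
  | cs4 => obtain ⟨_, _, _, h⟩ := hc; exact h
  | cs5 => obtain ⟨_, _, _, _, h⟩ := hc; exact h

lemma integral_tiltedX (h : Direction s P M g γ γ') (hP : CondProbRelation s P) (β : ℝ) :
    ∫ w, tiltedX P γ γ' β (X w) ∂(P : Measure (Obs 𝒳)) = 1 := by
  have i : Integrable (fun w => ∑ d : Fin 2, ∑ t : Fin 2, γ d t (X w) * pDTx P d t (X w))
      (P : Measure (Obs 𝒳)) :=
    integrable_finsetSum _ fun d _ => integrable_finsetSum _ fun t _ =>
      (integrable_of_abs_le_X (measurable_pDTx P d t) (abs_pDTx_le d t)).bdd_mul (c := M)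
        ((h.meas_left d t).comp measurable_X).aestronglyMeasurable
        (ae_of_all _ fun w => h.bound_left _ _ _)
  rw [integral_congr_ae (h.tiltedX_ae_eq hP β), integral_add (integrable_const _) (i.const_mul β),
    integral_const_mul, h.integral_left]
  simp

lemma exists_isTilt (h : Direction s P M g γ γ') (hP : CondProbRelation s P)
    (hβ : |β| * M ≤ 1 / 4) : ∃ R, IsTilt P R (pathDensity g γ γ' β) := by
  refine DiD.exists_isTilt (h.measurable_pathDensity β) (fun w => (h.pathDensity_mem hβ w).1)
    (fun w => (h.pathDensity_mem hβ w).2) ?_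
  have := h.integral_pathDensity_mul_X hβ (u := fun _ => 1) measurable_const (fun _ => by simp)
  simp only [mul_one, one_mul] at this
  rw [this, h.integral_tiltedX hP]

variable (hR : IsTilt P R (pathDensity g γ γ' β))
include hR

lemma integral_cell (h : Direction s P M g γ γ') (hβ : |β| * M ≤ 1 / 4) (d t : Fin 2) :
    ∫ w, G d t w ∂(R : Measure (Obs 𝒳))
      = ∫ w, tiltedCell P γ γ' β d t (X w) ∂(P : Measure (Obs 𝒳)) := by
  have := h.integral_pathDensity_mul hβ d t (u := fun _ => 1) measurable_const (fun _ => by simp)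
  simp only [one_mul] at this
  rw [hR.integral_eq, this]

/-- Cell propensity scores of the perturbed law. -/
lemma pDTx_ae_eq (h : Direction s P M g γ γ') (hβ : |β| * M ≤ 1 / 4) (d t : Fin 2) :
    ∀ᵐ w ∂(R : Measure (Obs 𝒳)),
      pDTx R d t (X w) = tiltedCell P γ γ' β d t (X w) / tiltedX P γ γ' β (X w) := by
  have hm : Measurable (fun x => tiltedCell P γ γ' β d t x / tiltedX P γ γ' β x) :=
    (h.measurable_tiltedCell β d t).div (h.measurable_tiltedX β)
  have hpos : ∀ x, 0 < tiltedX P γ γ' β x := fun x => by linarith [(h.tiltedX_mem hβ x).1]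
  have hnn : ∀ d t x, 0 ≤ tiltedCell P γ γ' β d t x := fun d t x =>
    mul_nonneg (condProb_nonneg _ _) (by linarith [(h.tiltDTX_mem hβ d t x).1])
  have hle : ∀ x, |tiltedCell P γ γ' β d t x / tiltedX P γ γ' β x| ≤ 1 := fun x => by
    rw [abs_of_nonneg (div_nonneg (hnn d t x) (hpos x).le), div_le_one (hpos x)]
    have a := hnn 0 0 x
    have b := hnn 0 1 x
    have c := hnn 1 0 x
    have e := hnn 1 1 x
    unfold tiltedX
    fin_cases d <;> fin_cases t <;> simp only [Fin.zero_eta, Fin.mk_one] <;> linarith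
  refine ae_eq_pDTx hm (integrable_of_abs_le_X hm hle) d t fun u hu hub => ?_
  rw [hR.integral_eq, hR.integral_eq, h.integral_pathDensity_mul hβ d t hu hub,
    h.integral_pathDensity_mul_X hβ (u := fun x => u x * (tiltedCell P γ γ' β d t x
      / tiltedX P γ γ' β x)) (hu.mul hm) fun x => abs_mul_le_one (hub x) (hle x)]
  congr 1; ext w
  have := (hpos (X w)).ne'
  field_simp

/-- A cell score is multiplied by its tilt and divided by the average tilt, a factor of at least
(9/16)/(25/16) = 9/25 ≥ 1/3. -/
lemma support (h : Direction s P M g γ γ') (hβ : |β| * M ≤ 1 / 4) {c : ℝ} (hc : 0 < c)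
    (hs : Support P c) : Support R (c / 3) := by
  intro d t
  have : ∀ᵐ w ∂(R : Measure (Obs 𝒳)), c / 3 ≤ pDTx R d t (X w) := by
    filter_upwards [h.pDTx_ae_eq hR hβ d t, hR.ae (ae_lawX_iff P (hs d t))] with w e1 e2
    rw [e1]
    obtain ⟨h1, h2⟩ := h.tiltedX_mem hβ (X w)
    rw [le_div_iff₀ (by linarith)]
    have h3 := (h.tiltDTX_mem hβ d t (X w)).1
    have h4 := mul_le_mul e2 h3 (by norm_num) (hc.le.trans e2)
    unfold tiltedCell
    nlinarith
  exact (ae_map_iff measurable_X.aemeasurable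
    (measurableSet_le measurable_const (measurable_pDTx R d t))).2 this

lemma memLp_Y (hY : MemLp Y 2 (P : Measure (Obs 𝒳))) : MemLp Y 2 (R : Measure (Obs 𝒳)) :=
  memLp_two_of_integrable_sq measurable_Y (hR.integrable hY.integrable_sq)

lemma integral_Y_sq_le (hY : MemLp Y 2 (P : Measure (Obs 𝒳))) :
    ∫ w, Y w ^ 2 ∂(R : Measure (Obs 𝒳)) ≤ 2 * ∫ w, Y w ^ 2 ∂(P : Measure (Obs 𝒳)) := by
  rw [hR.integral_eq, ← integral_const_mul]
  refine integral_mono (hY.integrable_sq.bdd_mul (c := 2) hR.meas.aestronglyMeasurable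
    (ae_of_all _ hR.abs_le)) (hY.integrable_sq.const_mul 2) fun w => ?_
  exact mul_le_mul_of_nonneg_right (hR.le_two w) (sq_nonneg _)

lemma pT_eq (h : Direction s P M g γ γ') (hβ : |β| * M ≤ 1 / 4) (t : Fin 2) :
    pT R t = ∫ w, (tiltedCell P γ γ' β 0 t (X w) + tiltedCell P γ γ' β 1 t (X w))
      ∂(P : Measure (Obs 𝒳)) := by
  have i := fun d => integrable_of_abs_le_X (P := P) (h.measurable_tiltedCell β d t)
    (h.abs_tiltedCell_le hβ d t)
  rw [integral_add (i 0) (i 1), ← h.integral_cell hR hβ, ← h.integral_cell hR hβ,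
    ← integral_add (integrable_G 0 t) (integrable_G 1 t), pT_eq_integral]
  simp only [iT_eq_sum_G]

lemma pD_eq (h : Direction s P M g γ γ') (hβ : |β| * M ≤ 1 / 4) (d : Fin 2) :
    pD R d = ∫ w, (tiltedCell P γ γ' β d 0 (X w) + tiltedCell P γ γ' β d 1 (X w))
      ∂(P : Measure (Obs 𝒳)) := by
  have i := fun t => integrable_of_abs_le_X (P := P) (h.measurable_tiltedCell β d t)
    (h.abs_tiltedCell_le hβ d t)
  rw [integral_add (i 0) (i 1), ← h.integral_cell hR hβ, ← h.integral_cell hR hβ,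
    ← integral_add (integrable_G d 0) (integrable_G d 1), pD_eq_integral]
  simp only [iD_eq_sum_G]

/-- The relation of the setting is preserved. -/
lemma condProbRelation (h : Direction s P M g γ γ') (hβ : |β| * M ≤ 1 / 4)
    (hP : CondProbRelation s P) : CondProbRelation s R := by
  have hc := h.compatible
  have hN := h.integral_tiltedX hP β
  have hpos : ∀ x, tiltedX P γ γ' β x ≠ 0 := fun x =>
    (by linarith [(h.tiltedX_mem hβ x).1] : 0 < tiltedX P γ γ' β x).ne'
  have hcell : ∀ᵐ w ∂(R : Measure (Obs 𝒳)), ∀ d t,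
      pDTx R d t (X w) = tiltedCell P γ γ' β d t (X w) / tiltedX P γ γ' β (X w) :=
    ae_all_iff.2 fun d => ae_all_iff.2 fun t => h.pDTx_ae_eq hR hβ d t
  cases s with
  | cs1 => trivial
  | cs2 =>
    obtain ⟨a, v, hγ, hγ', -⟩ := hc
    intro d t
    filter_upwards [hcell, pDx_eq_sum (P := R) d, pTx_eq_sum (P := R) t,
      hR.ae (ae_all_iff.2 fun d => ae_all_iff.2 fun t => hP d t)] with w e1 e2 e3 e4
    -- The tilted cells still have product form in d and t, so after normalization each cell is the
    -- product of its margins.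
    have f : ∃ A B : Fin 2 → ℝ, ∀ d t, tiltedCell P γ γ' β d t (X w) = A d * B t :=
      ⟨fun d => pDx P d (X w) * (1 + β * a d (X w)),
        fun t => pTx P t (X w) * (1 + β * (v (X w) * (((t : ℕ) : ℝ) - pTx P 1 (X w)))),
        fun d t => by simp only [tiltedCell, tiltDTX, e4, hγ, hγ']; ring⟩
    obtain ⟨A, B, f⟩ := f
    have hp := hpos (X w)
    have eN : tiltedX P γ γ' β (X w) = (A 0 + A 1) * (B 0 + B 1) := by
      simp only [tiltedX, f]; ring
    rw [e2, e3, e1, e1, e1, e1, e1]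
    simp only [f]
    field_simp
    rw [eN]; ring
  | cs3 =>
    obtain ⟨a, v, hγ, hγ', -⟩ := hc
    -- Summed over d, the tilt of D given (T,X) disappears, so Pr(T=t|X) is still the old constant.
    have key : ∀ᵐ w ∂(P : Measure (Obs 𝒳)), ∀ t, tiltedCell P γ γ' β 0 t (X w)
        + tiltedCell P γ γ' β 1 t (X w) = pT P t * tiltedX P γ γ' β (X w) := by
      filter_upwards [hP 0, hP 1, pDTx_eq_mul (P := P) 0 0, pDTx_eq_mul (P := P) 0 1,
        pDTx_eq_mul (P := P) 1 0, pDTx_eq_mul (P := P) 1 1] with w e1 e2 e3 e4 e5 e6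
      rw [Fin.forall_fin_two]
      constructor
      all_goals
        simp only [tiltedX, tiltedCell, tiltDTX, hγ, hγ', e1, e2, e3, e4, e5, e6, pDtx_zero,
          pT_zero, Fin.val_zero, Fin.val_one, Nat.cast_zero, Nat.cast_one]
        ring
    intro t
    have hT : pT R t = pT P t := by
      rw [h.pT_eq hR hβ, integral_congr_ae (key.mono fun w hw => hw t), integral_const_mul, hN,
        mul_one]
    filter_upwards [hcell, pTx_eq_sum (P := R) t, hR.ae key] with w e1 e2 e3
    rw [e2, e1, e1, ← add_div, e3, hT, mul_div_assoc, div_self (hpos (X w)), mul_one]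
  | cs4 =>
    obtain ⟨a, hγ, hγ', -⟩ := hc
    -- The tilt does not depend on t, so the factor `pT P t` splits off and remains the law of T.
    have key : ∀ᵐ w ∂(P : Measure (Obs 𝒳)), ∀ d t, tiltedCell P γ γ' β d t (X w)
        = pT P t * (pDx P d (X w) * (1 + β * a d (X w))) := by
      filter_upwards [ae_all_iff.2 fun d => ae_all_iff.2 fun t => hP d t] with w e d t
      simp only [tiltedCell, tiltDTX, hγ, hγ', e, Pi.zero_apply]
      ring
    have key2 : ∀ᵐ w ∂(P : Measure (Obs 𝒳)), tiltedX P γ γ' β (X w)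
        = pDx P 0 (X w) * (1 + β * a 0 (X w)) + pDx P 1 (X w) * (1 + β * a 1 (X w)) := by
      filter_upwards [key] with w e
      simp only [tiltedX, e, pT_zero]
      ring
    intro d t
    have hT : pT R t = pT P t := by
      have : ∀ᵐ w ∂(P : Measure (Obs 𝒳)), tiltedCell P γ γ' β 0 t (X w)
          + tiltedCell P γ γ' β 1 t (X w) = pT P t * tiltedX P γ γ' β (X w) := by
        filter_upwards [key, key2] with w e1 e2
        rw [e2, e1, e1]; ring
      rw [h.pT_eq hR hβ, integral_congr_ae this, integral_const_mul, hN, mul_one]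
    filter_upwards [hcell, pDx_eq_sum (P := R) d, hR.ae key] with w e1 e2 e3
    rw [e2, hT, e1, e1, e1, e3, e3, e3, pT_zero]
    ring
  | cs5 =>
    obtain ⟨a, k, hγ, hγ', -⟩ := hc
    -- B is the new marginal law of T. The tilted cells are products of the old law of D, of B and
    -- of the tilt of X, so mutual independence persists.
    set B : Fin 2 → ℝ := fun t => pT P t * (1 + β * (k * (((t : ℕ) : ℝ) - pT P 1))) with hB
    have sB : B 0 + B 1 = 1 := by
      simp only [hB, pT_zero, Fin.val_zero, Fin.val_one, Nat.cast_zero, Nat.cast_one]; ring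
    have sD : pD P 0 + pD P 1 = 1 := by rw [pD_zero]; ring
    have key : ∀ᵐ w ∂(P : Measure (Obs 𝒳)), ∀ d t, tiltedCell P γ γ' β d t (X w)
        = pD P d * B t * (1 + β * a (X w)) := by
      filter_upwards [ae_all_iff.2 fun d => ae_all_iff.2 fun t => hP d t] with w e d t
      simp only [tiltedCell, tiltDTX, hγ, hγ', e, hB]
      ring
    have key2 : ∀ᵐ w ∂(P : Measure (Obs 𝒳)), tiltedX P γ γ' β (X w) = 1 + β * a (X w) := by
      filter_upwards [key] with w e
      simp only [tiltedX, e]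
      linear_combination (1 + β * a (X w)) * ((pD P 0 + pD P 1) * sB + sD)
    intro d t
    have hD : pD R d = pD P d := by
      have : ∀ᵐ w ∂(P : Measure (Obs 𝒳)), tiltedCell P γ γ' β d 0 (X w)
          + tiltedCell P γ γ' β d 1 (X w) = pD P d * tiltedX P γ γ' β (X w) := by
        filter_upwards [key, key2] with w e1 e2
        rw [e2, e1, e1]
        linear_combination pD P d * (1 + β * a (X w)) * sB
      rw [h.pD_eq hR hβ, integral_congr_ae this, integral_const_mul, hN, mul_one]
    have hT : pT R t = B t := by
      have : ∀ᵐ w ∂(P : Measure (Obs 𝒳)), tiltedCell P γ γ' β 0 t (X w)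
          + tiltedCell P γ γ' β 1 t (X w) = B t * tiltedX P γ γ' β (X w) := by
        filter_upwards [key, key2] with w e1 e2
        rw [e2, e1, e1]
        linear_combination B t * (1 + β * a (X w)) * sD
      rw [h.pT_eq hR hβ, integral_congr_ae this, integral_const_mul, hN, mul_one]
    filter_upwards [hcell, hR.ae key, hR.ae key2] with w e1 e3 e4
    have hp := hpos (X w)
    rw [e1, e3, ← e4, hD, hT, mul_div_assoc, div_self hp, mul_one]

end Direction

/-- The score of a direction. -/
def Direction.score (g : Obs 𝒳 → ℝ) (γ γ' : Fin 2 → Fin 2 → 𝒳 → ℝ) (w : Obs 𝒳) : ℝ :=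
  g w + evalDTX γ w + evalDTX γ' w

/-- Every direction is the score of a regular parametric submodel. -/
theorem Direction.exists_regularSubmodel [StandardBorelSpace 𝒳] (h : Direction s P M g γ γ')
    (hP : ObsModel s P) : ∃ Q, RegularSubmodel s P Q (Direction.score g γ γ') := by
  have hrel := (relation_iff s).1 hP.relation
  obtain ⟨c, hc, hs⟩ := hP.common_support
  have hM : 0 ≤ M := by
    obtain ⟨w⟩ := P.nonempty
    exact (abs_nonneg _).trans (h.bound w)
  have hε : (0 : ℝ) < 1 / (4 * (M + 1)) := by positivity
  have hsmall : ∀ β : ℝ, |β| ≤ 1 / (4 * (M + 1)) → |β| * M ≤ 1 / 4 := fun β hβ => by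
    have h1 : |β| * (M + 1) ≤ 1 / 4 := by
      rw [le_div_iff₀ (by positivity)] at hβ
      linarith
    linarith [mul_add |β| M 1, abs_nonneg β]
  -- Every member of the family has to lie in the model; for large β, where the density formula may
  -- fail, the path is continued by its value at 0.
  have key : ∀ β : ℝ, ∃ R, (∃ β', |β'| * M ≤ 1 / 4 ∧ IsTilt P R (pathDensity g γ γ' β')) ∧
      (|β| ≤ 1 / (4 * (M + 1)) → IsTilt P R (pathDensity g γ γ' β)) := by
    intro β
    by_cases hβ : |β| ≤ 1 / (4 * (M + 1))
    · obtain ⟨R, hR⟩ := h.exists_isTilt hrel (hsmall β hβ)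
      exact ⟨R, ⟨β, hsmall β hβ, hR⟩, fun _ => hR⟩
    · have h0 : |(0 : ℝ)| * M ≤ 1 / 4 := by simp
      obtain ⟨R, hR⟩ := h.exists_isTilt hrel h0
      exact ⟨R, ⟨0, h0, hR⟩, fun h' => absurd h' hβ⟩
  choose R hR1 hR2 using key
  have hsup : ∀ β, Support (R β) (c / 3) := fun β => by
    obtain ⟨β', hb, hR⟩ := hR1 β
    exact h.support hR hb hc hs
  have hmodel : ∀ β, ObsModel s (R β) := fun β => by
    obtain ⟨β', hb, hR⟩ := hR1 β
    exact ⟨Direction.memLp_Y hR hP.memLp, ⟨c / 3, by positivity, hsup β⟩,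
      (relation_iff s).2 (h.condProbRelation hR hb hrel)⟩
  -- The linear coefficient is the score. The quadratic one comes from multiplying the two tilts and
  -- does not affect the score.
  have hdens : ∀ β, pathDensity g γ γ' β = fun w => 1 + (β * Direction.score g γ γ' w
      + β ^ 2 * (evalDTX γ w * evalDTX γ' w)) := fun β => by
    ext w
    simp only [pathDensity, evalDTX, tiltDTX, Direction.score]; ring
  have hzero : R 0 = P := by
    have := hR2 0 (by rw [abs_zero]; exact hε.le)
    rw [hdens] at this
    simp only [zero_mul, add_zero, ne_eq, OfNat.ofNat_ne_zero, not_false_eq_true, zero_pow] at this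
    exact this.eq_of_one
  have b1 : ∀ w, |Direction.score g γ γ' w| ≤ 3 * M + M * M := fun w => by
    have := (abs_add_le (g w + evalDTX γ w) (evalDTX γ' w)).trans
      (add_le_add (abs_add_le _ _) le_rfl)
    have h1 := h.bound w
    have h2 := h.bound_left (D w) (T w) (X w)
    have h3 := h.bound_right (D w) (T w) (X w)
    have := mul_nonneg hM hM
    unfold Direction.score evalDTX at *
    linarith
  have b2 : ∀ w, |evalDTX γ w * evalDTX γ' w| ≤ 3 * M + M * M := fun w => by
    rw [abs_mul]
    have := mul_le_mul (h.bound_left (D w) (T w) (X w)) (h.bound_right (D w) (T w) (X w))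
      (abs_nonneg _) hM
    unfold evalDTX
    linarith
  refine ⟨fun β => fullLaw (R β), fun β => (hmodel β).inModel_fullLaw, ?_, ?_, ?_, ?_, ?_⟩
  · rw [obsLaw_fullLaw, hzero]
  · exact ⟨c / 3, by positivity, Eventually.of_forall fun β => by
      rw [obsLaw_fullLaw]; exact hsup β⟩
  · refine ⟨2 * ∫ w, Y w ^ 2 ∂(P : Measure (Obs 𝒳)), Eventually.of_forall fun β => ?_⟩
    obtain ⟨β', hb, hR⟩ := hR1 β
    rw [obsLaw_fullLaw]
    exact Direction.integral_Y_sq_le hR hP.memLp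
  · refine MemLp_of_abs_le ?_ _ b1
    exact ((h.meas.add (measurable_evalDTX h.meas_left)).add
      (measurable_evalDTX h.meas_right)).aestronglyMeasurable
  · simp only [obsLaw_fullLaw]
    refine hasScore_of_isTilt b1 b2 hzero (fun β => ?_) ?_
    · obtain ⟨β', hb, hR⟩ := hR1 β
      exact hR.absolutelyContinuous
    · filter_upwards [Metric.closedBall_mem_nhds (0 : ℝ) hε] with β hβ
      rw [← hdens]
      exact hR2 β (by simpa using hβ)

end Directions
end DiD

namespace DiD

/-! ### Bounded approximation that preserves conditional mean zero. -/

section Truncation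

/-- Truncation to `[-n, n]`. -/
def clip (n : ℕ) (x : ℝ) : ℝ := max (-(n : ℝ)) (min n x)

@[fun_prop] lemma measurable_clip (n : ℕ) : Measurable (clip n) :=
  measurable_const.max (measurable_const.min measurable_id)

lemma abs_clip_le (n : ℕ) (x : ℝ) : |clip n x| ≤ n := by
  have : (0 : ℝ) ≤ n := n.cast_nonneg
  exact abs_le.2 ⟨le_max_left _ _, max_le (by linarith) (min_le_left _ _)⟩

lemma clip_of_abs_le {n : ℕ} {x : ℝ} (h : |x| ≤ n) : clip n x = x := by
  obtain ⟨h1, h2⟩ := abs_le.1 h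
  rw [clip, min_eq_right h2, max_eq_right h1]

lemma abs_sub_clip_le (n : ℕ) (x : ℝ) : |x - clip n x| ≤ |x| := by
  have : (0 : ℝ) ≤ n := n.cast_nonneg
  by_cases h : |x| ≤ n
  · rw [clip_of_abs_le h, sub_self, abs_zero]; exact abs_nonneg x
  · rcases le_total 0 x with hx | hx
    · rw [abs_of_nonneg hx] at h ⊢
      have e : clip n x = n := by
        rw [clip, min_eq_left (by linarith), max_eq_right (by linarith)]
      rw [e, abs_of_nonneg (by linarith)]; linarith
    · rw [abs_of_nonpos hx] at h ⊢
      have e : clip n x = -n := by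
        rw [clip, min_eq_right (by linarith), max_eq_left (by linarith)]
      rw [e, abs_of_nonpos (by linarith)]; linarith

variable {Ω B : Type*} [MeasurableSpace Ω] [MeasurableSpace B]

lemma memLp_clip {μ : Measure Ω} [IsFiniteMeasure μ] {f : Ω → ℝ} (hf : Measurable f) (n : ℕ) :
    MemLp (fun x => clip n (f x)) 2 μ :=
  MemLp_of_abs_le ((measurable_clip n).comp hf).aestronglyMeasurable n fun _ => abs_clip_le n _

lemma tendsto_nrm_sub_clip {μ : Measure Ω} {f : Ω → ℝ} (hf : Measurable f) (h : MemLp f 2 μ) :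
    Tendsto (fun n : ℕ => nrm μ (fun x => f x - clip n (f x))) atTop (𝓝 0) := by
  refine squeeze_zero (fun n => nrm_nonneg _) (fun n => ?_) (tendsto_nrm_tail hf h)
  refine nrm_mono (h.indicator (measurableSet_lt measurable_const hf.abs)) (ae_of_all _ fun x => ?_)
  by_cases hx : (n : ℝ) < |f x|
  · simp only [Set.indicator, Set.mem_ofPred_eq, hx, if_true]
    exact abs_sub_clip_le n _
  · rw [clip_of_abs_le (not_lt.1 hx)]
    simp

/-- A square-integrable function with conditional mean zero is approximated by bounded functions
with conditional mean zero. -/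
lemma exists_bounded_residual {μ : ProbabilityMeasure Ω} {V : Ω → B} (hV : Measurable V)
    {f : Ω → ℝ} (hf : Measurable f) (h : MemLp f 2 (μ : Measure Ω))
    (h0 : ∀ u : B → ℝ, Measurable u → (∀ x, |u x| ≤ 1) → ∫ ω, u (V ω) * f ω ∂(μ : Measure Ω) = 0)
    (n : ℕ) : ∃ g : Ω → ℝ, Measurable g ∧ (∀ ω, |g ω| ≤ 2 * n) ∧
      (∀ u : B → ℝ, Measurable u → (∀ x, |u x| ≤ 1) →
        ∫ ω, g ω * u (V ω) ∂(μ : Measure Ω) = 0) ∧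
      nrm (μ : Measure Ω) (fun ω => f ω - g ω)
        ≤ 2 * nrm (μ : Measure Ω) (fun ω => f ω - clip n (f ω)) := by
  set F : Ω → ℝ := fun ω => clip n (f ω) with hF
  have hFm : Measurable F := (measurable_clip n).comp hf
  have hF2 : MemLp F 2 (μ : Measure Ω) := memLp_clip hf n
  have hFi : Integrable F (μ : Measure Ω) := hF2.integrable (by norm_num)
  have hfi : Integrable f (μ : Measure Ω) := h.integrable (by norm_num)
  have hd2 : MemLp (fun ω => f ω - F ω) 2 (μ : Measure Ω) := h.sub hF2
  have hdi : Integrable (fun ω => f ω - F ω) (μ : Measure Ω) := hd2.integrable (by norm_num)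
  have hcm : Measurable (fun ω => condMean μ F V (V ω)) := (measurable_condMean μ F V).comp hV
  have hbd : ∀ᵐ ω ∂(μ : Measure Ω), |condMean μ F V (V ω)| ≤ n := by
    filter_upwards [condMean_ae_eq_condExp hV hFi,
      ae_bdd_abs_condExp_of_ae_bdd_abs (m := MeasurableSpace.comap V inferInstance) (R := (n : ℝ))
        (ae_of_all (μ : Measure Ω) fun ω => abs_clip_le n (f ω))] with ω e1 e2
    rw [e1]; exact e2
  have hzero : ∀ᵐ ω ∂(μ : Measure Ω), condMean μ f V (V ω) = 0 := by
    refine ae_of_ae_map hV.aemeasurable (ae_eq_condMean_of_integral hV hfi (r := fun _ => 0)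
      measurable_const (integrable_const 0) fun u hu hub => ?_)
    rw [h0 u hu hub]; simp
  -- Since f has conditional mean zero, recentering its truncation subtracts minus the conditional
  -- mean of the truncation error. By contraction this costs no more than the error itself, hence
  -- the factor 2.
  have hsub : ∀ᵐ ω ∂(μ : Measure Ω),
      condMean μ (fun ω => f ω - F ω) V (V ω) = - condMean μ F V (V ω) := by
    filter_upwards [condMean_ae_eq_condExp hV hFi, condMean_ae_eq_condExp hV hfi,
      condMean_ae_eq_condExp hV hdi, hzero,
      condExp_sub hfi hFi (MeasurableSpace.comap V inferInstance)] with ω e1 e2 e3 e4 e5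
    rw [e3]
    refine Eq.trans e5 ?_
    rw [Pi.sub_apply, ← e1, ← e2, e4, zero_sub]
  -- The conditional mean is bounded by n almost surely only; clipping it gives a bound at every
  -- point without changing it almost surely.
  refine ⟨fun ω => F ω - clip n (condMean μ F V (V ω)),
    hFm.sub ((measurable_clip n).comp hcm), fun ω => ?_, fun u hu hub => ?_, ?_⟩
  · have := (abs_sub (F ω) (clip n (condMean μ F V (V ω)))).trans
      (add_le_add (abs_clip_le n _) (abs_clip_le n _))
    linarith
  · have i1 : Integrable (fun ω => u (V ω) * F ω) (μ : Measure Ω) :=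
      hFi.bdd_mul (c := 1) (hu.comp hV).aestronglyMeasurable (ae_of_all _ fun ω => hub _)
    have i2 := integrable_mul_condMean hV hFi hu i1
    have e : (fun ω => (F ω - clip n (condMean μ F V (V ω))) * u (V ω)) =ᵐ[(μ : Measure Ω)]
        fun ω => u (V ω) * F ω - u (V ω) * condMean μ F V (V ω) := by
      filter_upwards [hbd] with ω hω
      rw [clip_of_abs_le hω]; ring
    rw [integral_congr_ae e, integral_sub i1 i2, integral_mul_condMean hV hFi hu i1, sub_self]
  · have e : (fun ω => f ω - (F ω - clip n (condMean μ F V (V ω)))) =ᵐ[(μ : Measure Ω)]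
        fun ω => (f ω - F ω) - condMean μ (fun ω => f ω - F ω) V (V ω) := by
      filter_upwards [hbd, hsub] with ω e1 e2
      rw [clip_of_abs_le e1, e2]; ring
    rw [nrm_congr e]
    have h1 := nrm_sub_le hd2 (memLp_condMean hV hd2)
    have h2 : nrm (μ : Measure Ω) (fun ω => condMean μ (fun ω => f ω - F ω) V (V ω))
        ≤ nrm (μ : Measure Ω) (fun ω => f ω - F ω) :=
      Real.sqrt_le_sqrt (integral_condMean_sq_le hV hd2)
    linarith

end Truncation

/-! ### ψ* as a residual plus compatible perturbations of the law of (D,T,X). -/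

section Decomposition
variable {𝒳 : Type*} [MeasurableSpace 𝒳]

/-- The part of `weight * κ(X)` that perturbs the first factor of the law of `(D, T, X)`. -/
def adjustLeft (s : Setting) (P : ProbabilityMeasure (Obs 𝒳)) (κ : 𝒳 → ℝ) (d t : Fin 2) (x : 𝒳) :
    ℝ :=
  match s with
  | .cs1 => ((d : ℕ) : ℝ) * ((t : ℕ) : ℝ) * κ x
  | .cs2 => ((d : ℕ) : ℝ) * pTx P 1 x * κ x
  | .cs3 => pDtx P 1 1 x * pT P 1 * κ x
  | .cs4 => ((d : ℕ) : ℝ) * pT P 1 * κ x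
  | .cs5 => pD P 1 * pT P 1 * κ x

/-- The part of `weight * κ(X)` that perturbs the second factor of the law of `(D, T, X)`. -/
def adjustRight (s : Setting) (P : ProbabilityMeasure (Obs 𝒳)) (κ : 𝒳 → ℝ) (d t : Fin 2) (x : 𝒳) :
    ℝ :=
  match s with
  | .cs1 => 0
  | .cs2 => pDx P 1 x * κ x * (((t : ℕ) : ℝ) - pTx P 1 x)
  | .cs3 => κ x * (((t : ℕ) : ℝ) * (((d : ℕ) : ℝ) - pDtx P 1 1 x))
  | .cs4 => 0
  -- Written as a multiple so that it has the shape required by `Compatible` with k = 0: in this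
  -- setting ψ* does not perturb the law of T.
  | .cs5 => 0 * (((t : ℕ) : ℝ) - pT P 1)

variable {P : ProbabilityMeasure (Obs 𝒳)} {s : Setting} {c : ℝ}

lemma measurable_adjustLeft {κ : 𝒳 → ℝ} (hκ : Measurable κ) (d t : Fin 2) :
    Measurable (adjustLeft s P κ d t) := by
  cases s <;> unfold adjustLeft <;> fun_prop

lemma measurable_adjustRight {κ : 𝒳 → ℝ} (hκ : Measurable κ) (d t : Fin 2) :
    Measurable (adjustRight s P κ d t) := by
  cases s <;> unfold adjustRight <;> fun_prop

lemma abs_natCast_fin_le (d : Fin 2) : |((d : ℕ) : ℝ)| ≤ 1 := by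
  fin_cases d <;> simp

lemma abs_mul_le_of_le {a b C : ℝ} (ha : |a| ≤ 1) (hb : |b| ≤ C) : |a * b| ≤ C := by
  rw [abs_mul]
  exact (mul_le_of_le_one_left (abs_nonneg _) ha).trans hb

lemma abs_natCast_sub_le (t : Fin 2) {p : ℝ} (hp : |p| ≤ 1) (h0 : 0 ≤ p) :
    |((t : ℕ) : ℝ) - p| ≤ 1 := by
  rw [abs_of_nonneg h0] at hp
  rw [abs_le]
  fin_cases t <;> simp <;> constructor <;> linarith

lemma abs_adjustLeft_le {κ : 𝒳 → ℝ} {C : ℝ} (hκ : ∀ x, |κ x| ≤ C) (d t : Fin 2) (x : 𝒳) :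
    |adjustLeft s P κ d t x| ≤ C := by
  have hd := abs_natCast_fin_le d
  have ht := abs_natCast_fin_le t
  cases s with
  | cs1 => exact abs_mul_le_of_le (abs_mul_le_one hd ht) (hκ x)
  | cs2 => exact abs_mul_le_of_le (abs_mul_le_one hd (abs_pTx_le 1 x)) (hκ x)
  | cs3 => exact abs_mul_le_of_le (abs_mul_le_one (abs_pDtx_le 1 1 x) (abs_pT_le 1)) (hκ x)
  | cs4 => exact abs_mul_le_of_le (abs_mul_le_one hd (abs_pT_le 1)) (hκ x)
  | cs5 => exact abs_mul_le_of_le (abs_mul_le_one (abs_pD_le 1) (abs_pT_le 1)) (hκ x)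

lemma abs_adjustRight_le {κ : 𝒳 → ℝ} {C : ℝ} (hκ : ∀ x, |κ x| ≤ C) (d t : Fin 2) (x : 𝒳) :
    |adjustRight s P κ d t x| ≤ C := by
  have hC : 0 ≤ C := (abs_nonneg _).trans (hκ x)
  have ht := abs_natCast_fin_le t
  cases s with
  | cs1 => simpa [adjustRight] using hC
  | cs2 =>
    change |pDx P 1 x * κ x * _| ≤ C
    rw [mul_comm]
    exact abs_mul_le_of_le (abs_natCast_sub_le t (abs_pTx_le 1 x) (condProb_nonneg _ _))
      (abs_mul_le_of_le (abs_pDx_le 1 x) (hκ x))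
  | cs3 =>
    change |κ x * _| ≤ C
    rw [mul_comm]
    exact abs_mul_le_of_le (abs_mul_le_one ht
      (abs_natCast_sub_le d (abs_pDtx_le 1 1 x) (condProb_nonneg _ _))) (hκ x)
  | cs4 => simpa [adjustRight] using hC
  | cs5 => simpa [adjustRight] using hC

/-- The split that puts the covariate part of ψ* into the tangent space. In (CS-2) the weight is D
p_T + p_D (T - p_T), in (CS-3) after scaling p_D(1,X) p_T + T(D - p_D(1,X)); the second summand is
centered and becomes γ'. -/
lemma adjust_eq_weight (hc : 0 < c) (hs : Support P c) (κ : 𝒳 → ℝ) (w : Obs 𝒳) :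
    evalDTX (adjustLeft s P κ) w + evalDTX (adjustRight s P κ) w
      = weight s P P w / weightScale s P * κ (X w) := by
  have hT := (hc.trans_le (hs.le_pT hc 1)).ne'
  have hD := (hc.trans_le (hs.le_pD hc 1)).ne'
  cases s with
  | cs1 => simp [evalDTX, adjustLeft, adjustRight, weight, weightScale, D_eq_iD, T_eq_iT, G_eq_mul]
  | cs2 =>
    simp only [evalDTX, adjustLeft, adjustRight, weight, weightScale, D_eq_iD, T_eq_iT, div_one]
    ring
  | cs3 =>
    simp only [evalDTX, adjustLeft, adjustRight, weight, weightScale, D_eq_iD, T_eq_iT, G_eq_mul]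
    field_simp
    ring
  | cs4 =>
    simp only [evalDTX, adjustLeft, adjustRight, weight, weightScale, D_eq_iD, add_zero]
    field_simp
  | cs5 =>
    simp only [evalDTX, adjustLeft, adjustRight, weight, weightScale, zero_mul, add_zero]
    field_simp

/-- The first part of the adjustment has the mean of `G_{1,1} κ(X)`. -/
lemma integral_adjustLeft (hrel : CondProbRelation s P) {κ : 𝒳 → ℝ} (hκ : Measurable κ)
    (iκ : Integrable (fun w => κ (X w)) (P : Measure (Obs 𝒳))) :
    ∫ w, evalDTX (adjustLeft s P κ) w ∂(P : Measure (Obs 𝒳))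
      = ∫ w, G 1 1 w * κ (X w) ∂(P : Measure (Obs 𝒳)) := by
  have hone := RegressesTo.of_X (P := P) (a := fun _ => 1) measurable_const fun _ => le_rfl
  have key : ∀ {f : Obs 𝒳 → ℝ} {ρ : 𝒳 → ℝ}, RegressesTo P f ρ →
      (∀ᵐ w ∂(P : Measure (Obs 𝒳)), ρ (X w) = pDTx P 1 1 (X w)) →
      ∫ w, f w * κ (X w) ∂(P : Measure (Obs 𝒳)) = ∫ w, G 1 1 w * κ (X w) ∂(P : Measure (Obs 𝒳)) := by
    intro f ρ h e
    rw [h.integral_eq (k := 1) (by simpa using e) hκ iκ, one_mul]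
  cases s with
  | cs1 => simp only [evalDTX, adjustLeft, D_eq_iD, T_eq_iT, G_eq_mul]
  | cs2 =>
    rw [← key ((RegressesTo.group 1).mul_X (measurable_pTx P 1) (abs_pTx_le 1))]
    · simp only [evalDTX, adjustLeft, D_eq_iD, mul_comm]
    · filter_upwards [hrel 1 1] with w hw
      rw [hw]; ring
  | cs3 =>
    rw [← key ((RegressesTo.of_X (measurable_pDtx P 1 1) (abs_pDtx_le 1 1)).mul_X
      (a := fun _ => pT P 1) measurable_const fun _ => le_rfl)]
    · simp only [evalDTX, adjustLeft, mul_comm]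
    · filter_upwards [hrel 1, pDTx_eq_mul (P := P) 1 1] with w hw e
      rw [e, hw]; ring
  | cs4 =>
    rw [← key ((RegressesTo.group 1).mul_X (a := fun _ => pT P 1) measurable_const fun _ => le_rfl)]
    · simp only [evalDTX, adjustLeft, D_eq_iD, mul_comm]
    · filter_upwards [hrel 1 1] with w hw
      rw [hw]; ring
  | cs5 =>
    rw [← key (hone.mul_X (a := fun _ => pD P 1 * pT P 1) measurable_const fun _ => le_rfl)]
    · simp only [evalDTX, adjustLeft, mul_one]
    · filter_upwards [hrel 1 1] with w hw
      rw [hw]; ring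

/-- Bounded directions built from a bounded function of the covariates. -/
lemma adjust_direction (hrel : CondProbRelation s P) {κ : 𝒳 → ℝ} (hκ : Measurable κ) {C : ℝ}
    (hC : ∀ x, |κ x| ≤ C) (h0 : ∫ w, G 1 1 w * κ (X w) ∂(P : Measure (Obs 𝒳)) = 0)
    {g : Obs 𝒳 → ℝ} (hg : Measurable g) {N : ℝ} (hN : ∀ w, |g w| ≤ N)
    (hres : ∀ d t (u : 𝒳 → ℝ), Measurable u → (∀ x, |u x| ≤ 1) →
      ∫ w, g w * (u (X w) * G d t w) ∂(P : Measure (Obs 𝒳)) = 0) :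
    Direction s P (max N C) g (adjustLeft s P κ) (adjustRight s P κ) where
  meas := hg
  meas_left := measurable_adjustLeft hκ
  meas_right := measurable_adjustRight hκ
  bound w := (hN w).trans (le_max_left _ _)
  bound_left d t x := (abs_adjustLeft_le hC d t x).trans (le_max_right _ _)
  bound_right d t x := (abs_adjustRight_le hC d t x).trans (le_max_right _ _)
  residual := hres
  compatible := by
    have hz := (integral_adjustLeft hrel hκ (integrable_of_abs_le_X hκ hC)).trans h0
    cases s with
    | cs1 => exact ⟨rfl, hz⟩
    | cs2 => exact ⟨fun d x => ((d : ℕ) : ℝ) * pTx P 1 x * κ x, fun x => pDx P 1 x * κ x,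
        rfl, rfl, hz⟩
    | cs3 => exact ⟨fun x => pDtx P 1 1 x * pT P 1 * κ x, κ, rfl, rfl, hz⟩
    | cs4 => exact ⟨fun d x => ((d : ℕ) : ℝ) * pT P 1 * κ x, rfl, rfl, hz⟩
    | cs5 => exact ⟨fun x => pD P 1 * pT P 1 * κ x, 0, rfl, rfl, hz⟩

/-- The part of the influence function that has mean zero given `(D, T, X)`. -/
def residualPart (P : ProbabilityMeasure (Obs 𝒳)) (c : ℝ) (w : Obs 𝒳) : ℝ :=
  (∑ d : Fin 2, ∑ t : Fin 2, sgn d t *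
    (RegularFamily.ratio P c d t (X w) * G d t w * (Y w - mCell P d t (X w)))) / pDT P

/-- The centered conditional effect, scaled by `Pr(D = 1, T = 1)`. -/
def centeredEffect (P : ProbabilityMeasure (Obs 𝒳)) (θ : ℝ) (x : 𝒳) : ℝ := (mY P x - θ) / pDT P

lemma measurable_residualPart : Measurable (residualPart P c) := by
  refine Measurable.div_const (Finset.measurable_sum _ fun d _ => Finset.measurable_sum _ fun t _ =>
    Measurable.const_mul ?_ _) _
  exact (((RegularFamily.measurable_ratio P c d t).comp measurable_X).mul (measurable_G d t)).mul
    (measurable_Y.sub ((measurable_mCell P d t).comp measurable_X))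

lemma measurable_centeredEffect (θ : ℝ) : Measurable (centeredEffect P θ) :=
  ((measurable_mY P).sub_const θ).div_const _

lemma memLp_residualPart (hc : 0 < c) (hs : Support P c) (hY : MemLp Y 2 (P : Measure (Obs 𝒳))) :
    MemLp (residualPart P c) 2 (P : Measure (Obs 𝒳)) := by
  have : MemLp (fun w => ∑ d : Fin 2, ∑ t : Fin 2, sgn d t *
      (RegularFamily.ratio P c d t (X w) * G d t w * (Y w - mCell P d t (X w)))) 2
      (P : Measure (Obs 𝒳)) :=
    memLp_finsetSum _ fun d _ => memLp_finsetSum _ fun t _ =>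
      (RegularFamily.memLp_residual hc hs hY d t).const_mul _
  unfold residualPart
  simp only [div_eq_mul_inv]
  exact this.mul_const _

lemma memLp_centeredEffect (hc : 0 < c) (hs : Support P c) (hY : MemLp Y 2 (P : Measure (Obs 𝒳)))
    (θ : ℝ) : MemLp (fun w => centeredEffect P θ (X w)) 2 (P : Measure (Obs 𝒳)) := by
  have : MemLp (fun w => mY P (X w) - θ) 2 (P : Measure (Obs 𝒳)) :=
    (hs.memLp_mY hc hY).sub (memLp_const θ)
  unfold centeredEffect
  simp only [div_eq_mul_inv]
  exact this.mul_const _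

/-- In each cell, u(d,t,X) times the ratio is a bounded function of X, and Y - m_Y(d,t,X) is
orthogonal to those within the cell. -/
lemma integral_mul_residualPart (hc : 0 < c)
    (hY : MemLp Y 2 (P : Measure (Obs 𝒳))) {u : Fin 2 × Fin 2 × 𝒳 → ℝ} (hu : Measurable u)
    (hub : ∀ v, |u v| ≤ 1) :
    ∫ w, u (D w, T w, X w) * residualPart P c w ∂(P : Measure (Obs 𝒳)) = 0 := by
  have hm : ∀ d t, Measurable fun x => u (d, t, x) * RegularFamily.ratio P c d t x := fun d t =>
    (hu.comp (measurable_prodMk_left.comp measurable_prodMk_left)).mul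
      (RegularFamily.measurable_ratio P c d t)
  have hb : ∀ d t x, |u (d, t, x) * RegularFamily.ratio P c d t x| ≤ c⁻¹ := fun d t x =>
    abs_mul_le_of_le (hub _) (RegularFamily.abs_ratio_le P hc d t x)
  have e : ∀ w, u (D w, T w, X w) * residualPart P c w
      = ∑ d : Fin 2, ∑ t : Fin 2, sgn d t / pDT P *
        (u (d, t, X w) * RegularFamily.ratio P c d t (X w) * G d t w * (Y w - mCell P d t (X w))) := by
    intro w
    unfold residualPart
    rw [mul_div_assoc', Finset.mul_sum, Finset.sum_div]
    refine Finset.sum_congr rfl fun d _ => ?_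
    rw [Finset.mul_sum, Finset.sum_div]
    refine Finset.sum_congr rfl fun t _ => ?_
    by_cases h : D w = d ∧ T w = t
    · rw [h.1, h.2]; ring
    · simp [G, h]
  have i : ∀ d t, Integrable (fun w => u (d, t, X w) * RegularFamily.ratio P c d t (X w) * G d t w *
      (Y w - mCell P d t (X w))) (P : Measure (Obs 𝒳)) := fun d t => by
    obtain ⟨i1, i2, -⟩ := integral_mul_G_residual hY d t (hm d t) (hb d t)
    simp only [mul_sub]
    exact i1.sub i2
  simp only [e]
  rw [integral_finsetSum _ fun d _ => integrable_finsetSum _ fun t _ => (i d t).const_mul _]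
  refine Finset.sum_eq_zero fun d _ => ?_
  rw [integral_finsetSum _ fun t _ => (i d t).const_mul _]
  refine Finset.sum_eq_zero fun t _ => ?_
  rw [integral_const_mul, (integral_mul_G_residual hY d t (hm d t) (hb d t)).2.2, mul_zero]

/-- This is the definition of `theta` rearranged; it makes the covariate perturbation
mass-preserving. -/
lemma integral_G_mul_centeredEffect (hc : 0 < c) (hs : Support P c)
    (hY : MemLp Y 2 (P : Measure (Obs 𝒳))) :
    ∫ w, G 1 1 w * centeredEffect P (theta P) (X w) ∂(P : Measure (Obs 𝒳)) = 0 := by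
  have hp := (hs.pDT_pos hc).ne'
  have i1 : Integrable (fun w => G 1 1 w * mY P (X w)) (P : Measure (Obs 𝒳)) :=
    ((hs.memLp_mY hc hY).integrable (by norm_num)).bdd_mul (c := 1)
      (measurable_G 1 1).aestronglyMeasurable (ae_of_all _ (abs_G_le 1 1))
  have e : ∀ w : Obs 𝒳, G 1 1 w * centeredEffect P (theta P) (X w)
      = (G 1 1 w * mY P (X w) - theta P * G 1 1 w) * (pDT P)⁻¹ := fun w => by
    unfold centeredEffect; ring
  simp only [e]
  rw [integral_mul_const, integral_sub i1 ((integrable_G 1 1).const_mul _), integral_const_mul,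
    ← pDT_eq_integral, theta, div_mul_cancel₀ _ hp, sub_self, zero_mul]

/-- `ψ*` as a sum of a residual part and of the adjustment for the covariates. -/
lemma psi_ae_eq (hc : 0 < c) (hs : Support P c) (hrel : CondProbRelation s P) (θ : ℝ) :
    psi s P θ =ᵐ[(P : Measure (Obs 𝒳))] fun w => residualPart P c w
      + weight s P P w / weightScale s P * centeredEffect P θ (X w) := by
  refine (influence_ae_eq_psi hc hs hrel θ).symm.trans (ae_of_all _ fun w => ?_)
  have hk := weightScale_ne (s := s) hc hs
  have hp := (hs.pDT_pos hc).ne'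
  simp only [influence, residualPart, centeredEffect]
  field_simp

end Decomposition
end DiD

namespace DiD

/-! ### ψ* as a limit of scores, and submodels with positive information. -/

section Scores
variable {𝒳 : Type*} [MeasurableSpace 𝒳] {P : ProbabilityMeasure (Obs 𝒳)} {s : Setting}

lemma ObsModel.memLp_psi [StandardBorelSpace 𝒳] (hP : ObsModel s P) (θ : ℝ) :
    MemLp (psi s P θ) 2 (P : Measure (Obs 𝒳)) := by
  obtain ⟨c, hc, hs⟩ := hP.common_support
  have hrel := (relation_iff s).1 hP.relation
  refine MemLp.ae_eq (psi_ae_eq hc hs hrel θ).symm ((memLp_residualPart hc hs hP.memLp).add ?_)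
  refine MemLp.bdd_mul_two (M := (3 + 2 * c⁻¹) / |weightScale s P|)
    ((measurable_weight s).div_const _) (fun w => ?_) (memLp_centeredEffect hc hs hP.memLp θ)
  rw [abs_div]
  exact div_le_div_of_nonneg_right (abs_weight_le hc hs s w) (abs_nonneg _)

/-- The residual part has mean zero, and the regression property of the weight turns the other mean
into a multiple of that of the centered effect on the treated, which vanishes. -/
lemma ObsModel.integral_psi [StandardBorelSpace 𝒳] (hP : ObsModel s P) :
    ∫ w, psi s P (theta P) w ∂(P : Measure (Obs 𝒳)) = 0 := by
  obtain ⟨c, hc, hs⟩ := hP.common_support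
  have hrel := (relation_iff s).1 hP.relation
  have i1 := (memLp_residualPart hc hs hP.memLp).integrable (by norm_num)
  have i2 := (memLp_centeredEffect hc hs hP.memLp (theta P)).integrable (by norm_num)
  have h1 := integral_mul_residualPart hc hP.memLp (u := fun _ => 1) measurable_const
    (fun _ => by simp)
  simp only [one_mul] at h1
  have h2 := integral_weight_mul_base (R := P) hc hs hrel (measurable_centeredEffect (theta P)) i2
  rw [integral_G_mul_centeredEffect hc hs hP.memLp, mul_zero] at h2
  have i3 : Integrable (fun w => weight s P P w * centeredEffect P (theta P) (X w))
      (P : Measure (Obs 𝒳)) :=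
    i2.bdd_mul (measurable_weight s).aestronglyMeasurable (ae_of_all _ (abs_weight_le hc hs s))
  have e : ∀ w, residualPart P c w
      + weight s P P w / weightScale s P * centeredEffect P (theta P) (X w)
      = residualPart P c w + weight s P P w * centeredEffect P (theta P) (X w)
        * (weightScale s P)⁻¹ := fun w => by ring
  rw [integral_congr_ae (psi_ae_eq hc hs hrel (theta P))]
  simp only [e]
  rw [integral_add i1 (i3.mul_const _), integral_mul_const, h1, h2]
  simp

/-- `ψ*` is a limit of scores of regular parametric submodels. -/
theorem ObsModel.exists_scores_tendsto_psi [StandardBorelSpace 𝒳] (hP : ObsModel s P) :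
    ∃ S : ℕ → Obs 𝒳 → ℝ, (∀ n, ∃ Q, RegularSubmodel s P Q (S n)) ∧
      Tendsto (fun n => nrm (P : Measure (Obs 𝒳)) fun w => psi s P (theta P) w - S n w)
        atTop (𝓝 0) := by
  obtain ⟨c, hc, hs⟩ := hP.common_support
  have hrel := (relation_iff s).1 hP.relation
  have hp := hs.pDT_pos hc
  have hV : Measurable (fun w : Obs 𝒳 => (D w, T w, X w)) :=
    measurable_D.prodMk (measurable_T.prodMk measurable_X)
  have hres := memLp_residualPart hc hs hP.memLp
  set k := centeredEffect P (theta P) with hk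
  have hkm : Measurable k := measurable_centeredEffect _
  have hkX : Measurable fun w : Obs 𝒳 => k (X w) := hkm.comp measurable_X
  have hk2 : MemLp (fun w => k (X w)) 2 (P : Measure (Obs 𝒳)) :=
    memLp_centeredEffect hc hs hP.memLp _
  have hki := hk2.integrable (by norm_num)
  choose g hgm hgb hg0 hgn using fun n => exists_bounded_residual hV measurable_residualPart hres
    (fun u hu hub => integral_mul_residualPart hc hP.memLp hu hub) n
  -- Truncation destroys the centering on the treated cell that compatibility requires; subtracting
  -- a n restores it.
  set a : ℕ → ℝ := fun n => (∫ w, G 1 1 w * clip n (k (X w)) ∂(P : Measure (Obs 𝒳))) / pDT P with ha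
  set κ : ℕ → 𝒳 → ℝ := fun n x => clip n (k x) - a n with hκ
  have hκm : ∀ n, Measurable (κ n) := fun n => ((measurable_clip n).comp hkm).sub_const _
  have hκb : ∀ n x, |κ n x| ≤ n + |a n| := fun n x =>
    (abs_sub _ _).trans (add_le_add (abs_clip_le n _) le_rfl)
  have iGc : ∀ n, Integrable (fun w => G 1 1 w * clip n (k (X w))) (P : Measure (Obs 𝒳)) := fun n =>
    ((memLp_clip hkX n).integrable (by norm_num)).bdd_mul (c := 1)
      (measurable_G 1 1).aestronglyMeasurable (ae_of_all _ (abs_G_le 1 1))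
  have iGk : Integrable (fun w => G 1 1 w * k (X w)) (P : Measure (Obs 𝒳)) :=
    hki.bdd_mul (c := 1) (measurable_G 1 1).aestronglyMeasurable (ae_of_all _ (abs_G_le 1 1))
  have hκ0 : ∀ n, ∫ w, G 1 1 w * κ n (X w) ∂(P : Measure (Obs 𝒳)) = 0 := fun n => by
    have e : ∀ w : Obs 𝒳, G 1 1 w * κ n (X w) = G 1 1 w * clip n (k (X w)) - a n * G 1 1 w :=
      fun w => by simp only [hκ]; ring
    simp only [e]
    rw [integral_sub (iGc n) ((integrable_G 1 1).const_mul _), integral_const_mul,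
      ← pDT_eq_integral, ha, div_mul_cancel₀ _ hp.ne', sub_self]
  have hdir : ∀ n : ℕ, Direction s P (max (2 * n) (n + |a n|)) (g n) (adjustLeft s P (κ n))
      (adjustRight s P (κ n)) := fun n => by
    refine adjust_direction hrel (hκm n) (hκb n) (hκ0 n) (hgm n) (hgb n) fun d t u hu hub => ?_
    have hψ : Measurable (fun v : Fin 2 × Fin 2 × 𝒳 =>
        u v.2.2 * if v.1 = d ∧ v.2.1 = t then (1 : ℝ) else 0) := by
      refine (hu.comp measurable_snd.snd).mul (Measurable.ite ?_ measurable_const measurable_const)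
      exact (measurable_fst (measurableSet_singleton d)).inter
        (measurable_snd.fst (measurableSet_singleton t))
    exact hg0 n _ hψ fun v => abs_mul_le_one (hub _) (by split_ifs <;> simp)
  refine ⟨fun n => Direction.score (g n) (adjustLeft s P (κ n)) (adjustRight s P (κ n)),
    fun n => (hdir n).exists_regularSubmodel hP, ?_⟩
  set L := (3 + 2 * c⁻¹) / |weightScale s P| with hL
  have hL0 : 0 ≤ L := div_nonneg (by positivity) (abs_nonneg _)
  have hLb : ∀ w, |weight s P P w / weightScale s P| ≤ L := fun w => by
    rw [abs_div]
    exact div_le_div_of_nonneg_right (abs_weight_le hc hs s w) (abs_nonneg _)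
  -- The untruncated effect is centered on the treated cell, so the correction is controlled by the
  -- truncation error and vanishes in the limit.
  have ha_le : ∀ n, |a n| ≤ (pDT P)⁻¹ * nrm (P : Measure (Obs 𝒳))
      (fun w => k (X w) - clip n (k (X w))) := fun n => by
    have hd2 : MemLp (fun w => k (X w) - clip n (k (X w))) 2 (P : Measure (Obs 𝒳)) :=
      hk2.sub (memLp_clip hkX n)
    have h1 := abs_integral_mul_le (nrm_le_one (R := P) (measurable_G 1 1) (abs_G_le 1 1)).1 hd2
    have h2 : ∫ w, G 1 1 w * (k (X w) - clip n (k (X w))) ∂(P : Measure (Obs 𝒳)) = - (a n * pDT P) := by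
      simp only [mul_sub]
      rw [integral_sub iGk (iGc n), hk, integral_G_mul_centeredEffect hc hs hP.memLp, ha,
        div_mul_cancel₀ _ hp.ne', zero_sub]
    rw [h2, abs_neg, abs_mul, abs_of_pos hp] at h1
    rw [inv_mul_eq_div, le_div_iff₀ hp]
    exact h1.trans (mul_le_of_le_one_left (nrm_nonneg _)
      (nrm_le_one (measurable_G 1 1) (abs_G_le 1 1)).2)
  have lim : Tendsto (fun n : ℕ => 2 * nrm (P : Measure (Obs 𝒳))
      (fun w => residualPart P c w - clip n (residualPart P c w))
      + L * (nrm (P : Measure (Obs 𝒳)) (fun w => k (X w) - clip n (k (X w)))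
        + (pDT P)⁻¹ * nrm (P : Measure (Obs 𝒳)) (fun w => k (X w) - clip n (k (X w)))))
      atTop (𝓝 0) := by
    have l1 := (tendsto_nrm_sub_clip (μ := (P : Measure (Obs 𝒳))) measurable_residualPart hres).const_mul 2
    have l2 := tendsto_nrm_sub_clip (μ := (P : Measure (Obs 𝒳))) hkX hk2
    simpa using l1.add ((l2.add (l2.const_mul (pDT P)⁻¹)).const_mul L)
  refine squeeze_zero (fun n => nrm_nonneg _) (fun n => ?_) lim
  have hd2 : MemLp (fun w => k (X w) - clip n (k (X w))) 2 (P : Measure (Obs 𝒳)) :=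
    hk2.sub (memLp_clip hkX n)
  have hg2 : MemLp (g n) 2 (P : Measure (Obs 𝒳)) :=
    MemLp_of_abs_le (hgm n).aestronglyMeasurable _ (hgb n)
  have hr2 : MemLp (fun w => residualPart P c w - g n w) 2 (P : Measure (Obs 𝒳)) := hres.sub hg2
  have hδ2 : MemLp (fun w => k (X w) - clip n (k (X w)) + a n) 2 (P : Measure (Obs 𝒳)) :=
    hd2.add (memLp_const (a n))
  have hw2 : MemLp (fun w => weight s P P w / weightScale s P *
      (k (X w) - clip n (k (X w)) + a n)) 2 (P : Measure (Obs 𝒳)) :=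
    MemLp.bdd_mul_two ((measurable_weight s).div_const _) hLb hδ2
  have e : (fun w => psi s P (theta P) w
      - Direction.score (g n) (adjustLeft s P (κ n)) (adjustRight s P (κ n)) w)
      =ᵐ[(P : Measure (Obs 𝒳))] fun w => (residualPart P c w - g n w)
        + weight s P P w / weightScale s P * (k (X w) - clip n (k (X w)) + a n) := by
    filter_upwards [psi_ae_eq hc hs hrel (theta P)] with w hw
    have := adjust_eq_weight (s := s) hc hs (κ n) w
    rw [hw, Direction.score]
    simp only [hκ] at this ⊢
    linear_combination -this
  rw [nrm_congr e]
  refine (nrm_add_le hr2 hw2).trans (add_le_add (hgn n) ?_)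
  refine (nrm_bdd_mul_le hLb hL0 hδ2).trans (mul_le_mul_of_nonneg_left ?_ hL0)
  refine (nrm_add_le hd2 (memLp_const (a n))).trans (add_le_add le_rfl ?_)
  rw [nrm_const_le]
  exact ha_le n

/-- A bounded function of `(D, T, X)` that vanishes in mean square vanishes in every cell. -/
lemma Support.exists_eq_zero {c : ℝ} (hc : 0 < c) (hs : Support P c) {u : Fin 2 → Fin 2 → 𝒳 → ℝ}
    (hu : ∀ d t, Measurable (u d t)) {C : ℝ} (hC : ∀ d t x, |u d t x| ≤ C)
    (h : ∫ w, evalDTX u w ^ 2 ∂(P : Measure (Obs 𝒳)) ≤ 0) : ∃ x, ∀ d t, u d t x = 0 := by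
  have hC0 : ∀ x : 𝒳, 0 ≤ C := fun x => (abs_nonneg _).trans (hC 0 0 x)
  have hsq : ∀ d t x, |u d t x ^ 2| ≤ C ^ 2 := fun d t x => by
    rw [abs_pow]; exact pow_le_pow_left₀ (abs_nonneg _) (hC d t x) 2
  have hm := fun d t => (hu d t).pow_const 2
  have iu := fun d t => integrable_of_abs_le_X (P := P) (hm d t) (hsq d t)
  have iG : ∀ d t, Integrable (fun w => G d t w * u d t (X w) ^ 2) (P : Measure (Obs 𝒳)) :=
    fun d t => (iu d t).bdd_mul (c := 1) (measurable_G d t).aestronglyMeasurable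
      (ae_of_all _ (abs_G_le d t))
  have iE : Integrable (fun w => evalDTX u w ^ 2) (P : Measure (Obs 𝒳)) :=
    integrable_of_abs_le ((measurable_evalDTX hu).pow_const 2) fun w => hsq (D w) (T w) (X w)
  have hz : ∀ d t, ∀ᵐ w ∂(P : Measure (Obs 𝒳)), u d t (X w) = 0 := by
    intro d t
    have h1 := hs.integral_le hc d t (hm d t) (fun x => sq_nonneg _) (iG d t)
    have h2 : ∫ w, G d t w * u d t (X w) ^ 2 ∂(P : Measure (Obs 𝒳)) ≤ 0 := by
      refine (integral_mono (iG d t) iE fun w => ?_).trans h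
      by_cases hw : D w = d ∧ T w = t
      · simp [G, evalDTX, hw.1, hw.2]
      · simp [G, hw, sq_nonneg]
    have h3 : ∫ w, u d t (X w) ^ 2 ∂(P : Measure (Obs 𝒳)) = 0 :=
      le_antisymm (by by_contra hcon; push Not at hcon; nlinarith)
        (integral_nonneg fun w => sq_nonneg _)
    filter_upwards [(integral_eq_zero_iff_of_nonneg (fun w => sq_nonneg _) (iu d t)).1 h3] with w hw
    exact pow_eq_zero_iff (two_ne_zero) |>.1 hw
  obtain ⟨w, hw⟩ := (ae_all_iff.2 fun d => ae_all_iff.2 fun t => hz d t).exists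
  exact ⟨X w, hw⟩

/-- In every setting some bounded direction has positive information. -/
lemma ObsModel.exists_informative_submodel [StandardBorelSpace 𝒳] (hP : ObsModel s P) :
    ∃ Q S, RegularSubmodel s P Q S ∧ 0 < ∫ w, S w ^ 2 ∂(P : Measure (Obs 𝒳)) := by
  obtain ⟨c, hc, hs⟩ := hP.common_support
  have hT1 : |pT P 1| ≤ 1 := abs_pT_le 1
  have hT0 : 0 ≤ pT P 1 := pT_nonneg 1
  have hD1 : |pD P 1| ≤ 1 := abs_pD_le 1
  have hD0 : 0 ≤ pD P 1 := pD_nonneg 1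
  have iTc : ∫ w : Obs 𝒳, ((((T w : Fin 2) : ℕ) : ℝ) - pT P 1) ∂(P : Measure (Obs 𝒳)) = 0 := by
    simp only [T_eq_iT]
    rw [integral_sub (integrable_iT 1) (integrable_const _), ← pT_eq_integral]; simp
  have iDc : ∫ w : Obs 𝒳, ((((D w : Fin 2) : ℕ) : ℝ) - pD P 1) ∂(P : Measure (Obs 𝒳)) = 0 := by
    simp only [D_eq_iD]
    rw [integral_sub (integrable_iD 1) (integrable_const _), ← pD_eq_integral]; simp
  -- By `Support.exists_eq_zero`, it is enough that at no covariate value does γ + γ' vanish in all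
  -- cells. Each witness below takes, in two cells, the values -p and 1 - p for the same p, which
  -- cannot both be zero.
  suffices h : ∃ γ γ' : Fin 2 → Fin 2 → 𝒳 → ℝ, (∀ d t, Measurable (γ d t)) ∧
      (∀ d t, Measurable (γ' d t)) ∧ (∀ d t x, |γ d t x| ≤ 1) ∧ (∀ d t x, |γ' d t x| ≤ 1) ∧
      Compatible s P γ γ' ∧ ∀ x, ∃ d t, γ d t x + γ' d t x ≠ 0 by
    obtain ⟨γ, γ', h1, h2, h3, h4, h5, h6⟩ := h
    have hdir : Direction s P 1 (fun _ => 0) γ γ' :=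
      ⟨measurable_const, h1, h2, fun _ => by simp, h3, h4, fun d t u _ _ => by simp, h5⟩
    obtain ⟨Q, hQ⟩ := hdir.exists_regularSubmodel hP
    refine ⟨Q, _, hQ, not_le.1 fun hle => ?_⟩
    have e : ∀ w, Direction.score (fun _ => 0) γ γ' w
        = evalDTX (fun d t x => γ d t x + γ' d t x) w := fun w => by
      simp [Direction.score, evalDTX]
    simp only [e] at hle
    obtain ⟨x, hx⟩ := hs.exists_eq_zero hc (fun d t => (h1 d t).add (h2 d t))
      (fun d t x => (abs_add_le _ _).trans (add_le_add (h3 d t x) (h4 d t x))) hle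
    obtain ⟨d, t, hdt⟩ := h6 x
    exact hdt (hx d t)
  cases s with
  | cs1 =>
    refine ⟨fun _ t _ => ((t : ℕ) : ℝ) - pT P 1, 0, fun _ _ => measurable_const,
      fun _ _ => measurable_const, fun _ t _ => abs_natCast_sub_le t hT1 hT0, fun _ _ _ => by simp,
      ⟨rfl, iTc⟩, fun x => ?_⟩
    by_contra hcon
    push Not at hcon
    have h0 := hcon 0 0
    have h1 := hcon 0 1
    simp only [Pi.zero_apply, Fin.val_zero, Fin.val_one, Nat.cast_zero, Nat.cast_one] at h0 h1
    linarith
  | cs2 =>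
    refine ⟨fun _ _ _ => 0, fun _ t x => 1 * (((t : ℕ) : ℝ) - pTx P 1 x),
      fun _ _ => measurable_const, fun _ t => by fun_prop, fun _ _ _ => by simp,
      fun _ t x => by
        simp only [one_mul]; exact abs_natCast_sub_le t (abs_pTx_le 1 x) (condProb_nonneg _ _),
      ⟨fun _ _ => 0, fun _ => 1, rfl, rfl, by simp [evalDTX]⟩, fun x => ?_⟩
    by_contra hcon
    push Not at hcon
    have h0 := hcon 0 0
    have h1 := hcon 0 1
    simp only [Fin.val_zero, Fin.val_one, Nat.cast_zero, Nat.cast_one] at h0 h1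
    linarith
  | cs3 =>
    refine ⟨fun _ _ _ => 0, fun d t x => 1 * (((t : ℕ) : ℝ) * (((d : ℕ) : ℝ) - pDtx P 1 1 x)),
      fun _ _ => measurable_const, fun _ t => by fun_prop, fun _ _ _ => by simp,
      fun d t x => by
        simp only [one_mul]
        exact abs_mul_le_one (abs_natCast_fin_le t)
          (abs_natCast_sub_le d (abs_pDtx_le 1 1 x) (condProb_nonneg _ _)),
      ⟨fun _ => 0, fun _ => 1, rfl, rfl, by simp [evalDTX]⟩, fun x => ?_⟩
    by_contra hcon
    push Not at hcon
    have h0 := hcon 0 1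
    have h1 := hcon 1 1
    simp only [Fin.val_zero, Fin.val_one, Nat.cast_zero, Nat.cast_one] at h0 h1
    linarith
  | cs4 =>
    refine ⟨fun d _ _ => ((d : ℕ) : ℝ) - pD P 1, 0, fun _ _ => measurable_const,
      fun _ _ => measurable_const, fun d _ _ => abs_natCast_sub_le d hD1 hD0, fun _ _ _ => by simp,
      ⟨fun d _ => ((d : ℕ) : ℝ) - pD P 1, rfl, rfl, iDc⟩, fun x => ?_⟩
    by_contra hcon
    push Not at hcon
    have h0 := hcon 0 0
    have h1 := hcon 1 0
    simp only [Pi.zero_apply, Fin.val_zero, Fin.val_one, Nat.cast_zero, Nat.cast_one] at h0 h1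
    linarith
  | cs5 =>
    refine ⟨fun _ _ _ => 0, fun _ t _ => 1 * (((t : ℕ) : ℝ) - pT P 1),
      fun _ _ => measurable_const, fun _ _ => measurable_const, fun _ _ _ => by simp,
      fun _ t _ => by simp only [one_mul]; exact abs_natCast_sub_le t hT1 hT0,
      ⟨fun _ => 0, 1, rfl, rfl, by simp [evalDTX]⟩, fun x => ?_⟩
    by_contra hcon
    push Not at hcon
    have h0 := hcon 0 0
    have h1 := hcon 0 1
    simp only [Fin.val_zero, Fin.val_one, Nat.cast_zero, Nat.cast_one] at h0 h1
    linarith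

end Scores

/-! ### Efficient influence function, uniqueness and efficiency bound. -/

section Efficiency
variable {𝒳 : Type*} [MeasurableSpace 𝒳] [StandardBorelSpace 𝒳] {P : ProbabilityMeasure (Obs 𝒳)}
  {s : Setting}

lemma integral_mul_eq_inner {Ω : Type*} [MeasurableSpace Ω] {μ : Measure Ω} {f g : Ω → ℝ}
    (hf : MemLp f 2 μ) (hg : MemLp g 2 μ) : ∫ x, f x * g x ∂μ = inner ℝ (hf.toLp f) (hg.toLp g) := by
  rw [L2.inner_def]
  refine integral_congr_ae ?_
  filter_upwards [hf.coeFn_toLp, hg.coeFn_toLp] with x e1 e2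
  rw [e1, e2]
  simp [mul_comm]

lemma tendsto_toLp {Ω : Type*} [MeasurableSpace Ω] {μ : Measure Ω} {f : Ω → ℝ} {S : ℕ → Ω → ℝ}
    (hf : MemLp f 2 μ) (hS : ∀ n, MemLp (S n) 2 μ)
    (h : Tendsto (fun n => nrm μ fun x => f x - S n x) atTop (𝓝 0)) :
    Tendsto (fun n => (hS n).toLp (S n)) atTop (𝓝 (hf.toLp f)) := by
  rw [tendsto_iff_norm_sub_tendsto_zero]
  refine h.congr fun n => ?_
  rw [norm_sub_rev, ← MemLp.toLp_sub, ← nrm_toLp (hf.sub (hS n))]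
  rfl

lemma ObsModel.isEfficientInfluenceFunction_psi (hP : ObsModel s P) :
    IsEfficientInfluenceFunction s P (psi s P (theta P)) where
  mean_zero := hP.integral_psi
  gradient _ _ h := h.hasDerivAt_atet
  tangent := by
    have hψ := hP.memLp_psi (theta P)
    refine ⟨hψ, ?_⟩
    obtain ⟨S, hS, hlim⟩ := hP.exists_scores_tendsto_psi
    choose Q hQ using hS
    refine mem_closure_of_tendsto (tendsto_toLp hψ (fun n => (hQ n).memLp_score) hlim)
      (Eventually.of_forall fun n => Submodule.subset_span ⟨Q n, S n, hQ n, rfl⟩)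

/-- Two efficient influence functions agree almost surely. -/
lemma IsEfficientInfluenceFunction.ae_eq {ψ ψ' : Obs 𝒳 → ℝ}
    (h : IsEfficientInfluenceFunction s P ψ) (h' : IsEfficientInfluenceFunction s P ψ') :
    ψ =ᵐ[(P : Measure (Obs 𝒳))] ψ' := by
  obtain ⟨m, t⟩ := h.tangent
  obtain ⟨m', t'⟩ := h'.tangent
  have hmem : m.toLp ψ - m'.toLp ψ' ∈ tangentSpace s P := Submodule.sub_mem _ t t'
  -- Both functions represent the same derivative along every submodel, so their difference is
  -- orthogonal to all scores, hence to the closed span.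
  have horth : m.toLp ψ - m'.toLp ψ' ∈ (tangentSpace s P)ᗮ := by
    rw [tangentSpace, Submodule.orthogonal_closure, Submodule.mem_orthogonal]
    intro v hv
    induction hv using Submodule.span_induction with
    | mem v hv =>
      obtain ⟨Q, S, hQ, rfl⟩ := hv
      have := (h.gradient Q S hQ).unique (h'.gradient Q S hQ)
      rw [integral_mul_eq_inner m hQ.memLp_score, integral_mul_eq_inner m' hQ.memLp_score] at this
      rw [real_inner_comm, inner_sub_left, this, sub_self]
    | zero => exact inner_zero_left _
    | add x y _ _ hx hy => rw [inner_add_left, hx, hy, add_zero]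
    | smul a x _ hx => rw [inner_smul_left, hx, mul_zero]
  have hzero : m.toLp ψ - m'.toLp ψ' = 0 :=
    inner_self_eq_zero.1 (Submodule.inner_right_of_mem_orthogonal hmem horth)
  exact (MemLp.toLp_eq_toLp_iff m m').1 (sub_eq_zero.1 hzero)

/-- The upper bound is Cauchy-Schwarz for E[ψ*S]. It is the least one because scores tending to ψ*
have Cramér-Rao bounds tending to E[ψ*²]. -/
lemma ObsModel.isEfficiencyBound (hP : ObsModel s P) :
    IsEfficiencyBound s P (∫ w, psi s P (theta P) w ^ 2 ∂(P : Measure (Obs 𝒳))) := by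
  have hψ := hP.memLp_psi (theta P)
  set V := ∫ w, psi s P (theta P) w ^ 2 ∂(P : Measure (Obs 𝒳)) with hV
  have hVn : V = ‖hψ.toLp _‖ ^ 2 := by rw [hV, ← nrm_sq, nrm_toLp hψ]
  have hV0 : 0 ≤ V := integral_nonneg fun _ => sq_nonneg _
  refine ⟨?_, fun b hb => ?_⟩
  · rintro v ⟨Q, S, hQ, hpos, θ', hθ', rfl⟩
    rw [hθ'.unique hQ.hasDerivAt_atet, div_le_iff₀ hpos, ← sq_abs, hV, ← nrm_sq, ← nrm_sq, ← mul_pow]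
    exact pow_le_pow_left₀ (abs_nonneg _) (abs_integral_mul_le hψ hQ.memLp_score) 2
  · rcases hV0.eq_or_lt with h0 | hpos
    -- If ψ* vanishes, approximating scores may carry no information; some submodel with positive
    -- information is needed so that the set of bounds is nonempty and its upper bounds are
    -- nonnegative.
    · obtain ⟨Q, S, hQ, hS⟩ := hP.exists_informative_submodel
      rw [← h0]
      exact le_trans (by positivity) (hb ⟨Q, S, hQ, hS, _, hQ.hasDerivAt_atet, rfl⟩)
    · obtain ⟨S, hS, hlim⟩ := hP.exists_scores_tendsto_psi
      choose Q hQ using hS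
      have hl := tendsto_toLp hψ (fun n => (hQ n).memLp_score) hlim
      have l1 : Tendsto (fun n => ∫ w, S n w ^ 2 ∂(P : Measure (Obs 𝒳))) atTop (𝓝 V) := by
        rw [hVn]
        refine (hl.norm.pow 2).congr fun n => ?_
        rw [← nrm_toLp, nrm_sq]
      have l2 : Tendsto (fun n => ∫ w, psi s P (theta P) w * S n w ∂(P : Measure (Obs 𝒳))) atTop
          (𝓝 V) := by
        rw [hVn, ← real_inner_self_eq_norm_sq]
        refine (tendsto_const_nhds.inner hl).congr fun n => ?_
        rw [integral_mul_eq_inner hψ (hQ n).memLp_score]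
      -- The Cramér-Rao bound of the n-th submodel is E[ψ*S_n]²/E[S_n²], which tends to V²/V = V.
      have l3 := (l2.pow 2).div l1 hpos.ne'
      rw [sq, mul_div_assoc, div_self hpos.ne', mul_one] at l3
      refine le_of_tendsto l3 ?_
      filter_upwards [l1.eventually (lt_mem_nhds hpos)] with n hn
      exact hb ⟨Q n, S n, hQ n, hn, _, (hQ n).hasDerivAt_atet, rfl⟩

end Efficiency
end DiD

end

/-- In each of the five settings, at every law `Q` of the full data that satisfies the
identification assumptions, `ψ*` is the (almost surely unique) efficient influence function of the
ATET and `E[ψ*²]` is the semiparametric efficiency bound. -/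
theorem theorem1 {𝒳 : Type*} [MeasurableSpace 𝒳] [StandardBorelSpace 𝒳]
    (s : DiD.Setting) (Q : ProbabilityMeasure (DiD.Full 𝒳)) (hQ : DiD.InModel s Q) :
    DiD.IsEfficientInfluenceFunction s (DiD.obsLaw Q) (DiD.psi s (DiD.obsLaw Q) (DiD.atet Q)) ∧
    (∀ ψ : DiD.Obs 𝒳 → ℝ, DiD.IsEfficientInfluenceFunction s (DiD.obsLaw Q) ψ →
      ψ =ᵐ[(DiD.obsLaw Q : Measure (DiD.Obs 𝒳))] DiD.psi s (DiD.obsLaw Q) (DiD.atet Q)) ∧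
    DiD.IsEfficiencyBound s (DiD.obsLaw Q)
      (∫ w, DiD.psi s (DiD.obsLaw Q) (DiD.atet Q) w ^ 2
        ∂(DiD.obsLaw Q : Measure (DiD.Obs 𝒳))) := by
  have hP := hQ.obsModel
  rw [hQ.atet_eq]
  exact ⟨hP.isEfficientInfluenceFunction_psi,
    fun ψ h => h.ae_eq hP.isEfficientInfluenceFunction_psi, hP.isEfficiencyBound⟩
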